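/- Let $\alpha>0$ and let $V\in C^3(\mathbb R)$ be a bistable potential, meaning that there are $a,b>0$ with $uV'(u)\ge au^2-b$ for all $u\in\mathbb R$; that $V(0)=V'(0)=0$, $V''(0)>0$; that $V(1)<0$, $V'(1)=0$, $V''(1)>0$; and that $\{u\in\mathbb R : V'(u)=0,\ V(u)\le 0\}=\{0,1\}$. Consider the damped wave equation $$\alpha u_{tt}+u_t=u_{xx}-V'(u),\qquad x\in\mathbb R. \tag{1}$$ For $f\in L^2_{\mathrm{loc}}(\mathbb R)$ put $\|f\|_{L^2_{\mathrm{ul}}}=\sup_{\xi\in\mathbb R}\|f\|_{L^2([\xi,\xi+1])}$. Let $L^2_{\mathrm{ul}}(\mathbb R)$ be the space of those $f\in L^2_{\mathrm{loc}}(\mathbb R)$ with $\|f\|_{L^2_{\mathrm{ul}}}<\infty$ and $\|f(\cdot-\xi)-f\|_{L^2_{\mathrm{ul}}}\to0$ as $\xi\to0$, and let $H^1_{\mathrm{ul}}(\mathbb R)$ be the space of those $f\in L^2_{\mathrm{ul}}(\mathbb R)$ whose weak derivative $\partial_xf$ exists and belongs to $L^2_{\mathrm{ul}}(\mathbb R)$,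 with norm $\|f\|_{H^1_{\mathrm{ul}}}=(\|f\|_{L^2_{\mathrm{ul}}}^2+\|\partial_x f\|_{L^2_{\mathrm{ul}}}^2)^{1/2}$. For an interval $J\subseteq\mathbb R$, a solution of (1) on $J$ is a function $u\in C^0(J,H^1_{\mathrm{ul}}(\mathbb R))\cap C^1(J,L^2_{\mathrm{ul}}(\mathbb R))$ that satisfies (1) weakly: for every $\varphi\in C_c^\infty(\mathbb R)$ the function $t\mapsto \alpha\int_{\mathbb R} u_t(x,t)\varphi(x)\,dx$ is differentiable on $J$ (one-sidedly at an end point of $J$), with derivative $\int_{\mathbb R} (u\varphi''-u_t\varphi-V'(u)\varphi)(x,t)\,dx$. **Proposition.** Let $u$ be a solution of (1) on $[0,+\infty)$, and let $(x_n,t_n)_{n\in\mathbb N}$ be a sequence in $\mathbb R\times[0,+\infty)$ with $t_n\to+\infty$. Then there exist a subsequence, still denoted $(x_n,t_n)$, and a solution $\bar u$ of (1) on $\mathbb R$ such that, for all $L>0$ and all $T>0$, $$\sup_{t\in[-T,T]}\Bigl(\|u(x_n+\cdot,t_n+t)-\bar u(\cdot,t)\|_{H^1([-L,L])}+\|u_t(x_n+\cdot,t_n+t)-\bar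 u_t(\cdot,t)\|_{L^2([-L,L])}\Bigr)\longrightarrow 0\quad\text{as } n\to\infty$$ (the supremum being considered for those $n$ with $t_n\ge T$, that is, for all large $n$). -/

import Mathlib

open MeasureTheory Filter Topology Set
open scoped ENNReal ContDiff

/-- Smooth bistable potentials: `V` is of class `C³`, coercive, with nondegenerate critical points
at `0` (where `V = 0`) and at `1` (where `V < 0`), and with no other critical point at a level
`≤ 0`. -/
structure IsBistablePotential (V : ℝ → ℝ) : Prop where
  contDiff : ContDiff ℝ 3 V
  coercive : ∃ a > 0, ∃ b > 0, ∀ u : ℝ, a * u ^ 2 - b ≤ u * deriv V u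
  zero : V 0 = 0
  deriv_zero : deriv V 0 = 0
  deriv2_zero : 0 < deriv (deriv V) 0
  one : V 1 < 0
  deriv_one : deriv V 1 = 0
  deriv2_one : 0 < deriv (deriv V) 1
  critical : {u : ℝ | deriv V u = 0 ∧ V u ≤ 0} = {0, 1}

/-- `φ ∈ C_c^∞(ℝ)`. -/
def IsTestFunction (φ : ℝ → ℝ) : Prop :=
  ContDiff ℝ ∞ φ ∧ HasCompactSupport φ

/-- `g` is a weak derivative of `f` on `ℝ`. -/
def HasWeakDeriv (f g : ℝ → ℝ) : Prop :=
  LocallyIntegrable f ∧ LocallyIntegrable g ∧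
    ∀ φ : ℝ → ℝ, IsTestFunction φ → ∫ x, f x * deriv φ x = -∫ x, g x * φ x

open Classical in
/-- The weak derivative `∂ₓ f` (unique almost everywhere; by convention `0` if there is none). -/
noncomputable def weakDeriv (f : ℝ → ℝ) : ℝ → ℝ :=
  if h : ∃ g, HasWeakDeriv f g then h.choose else 0

/-- The norm of `L²(s)`, with values in `[0, ∞]`. -/
noncomputable def l2Norm (s : Set ℝ) (f : ℝ → ℝ) : ℝ≥0∞ :=
  eLpNorm f 2 (volume.restrict s)

/-- The norm of `H¹(s)` for functions that are weakly differentiable on `ℝ`. -/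
noncomputable def h1Norm (s : Set ℝ) (f : ℝ → ℝ) : ℝ≥0∞ :=
  (l2Norm s f ^ 2 + l2Norm s (weakDeriv f) ^ 2) ^ (1 / 2 : ℝ)

/-- The uniformly local `L²` norm, `sup_ξ ‖f‖_{L²([ξ, ξ+1])}`. -/
noncomputable def l2ulNorm (f : ℝ → ℝ) : ℝ≥0∞ :=
  ⨆ ξ : ℝ, l2Norm (Icc ξ (ξ + 1)) f

/-- The uniformly local `H¹` norm. -/
noncomputable def h1ulNorm (f : ℝ → ℝ) : ℝ≥0∞ :=
  (l2ulNorm f ^ 2 + l2ulNorm (weakDeriv f) ^ 2) ^ (1 / 2 : ℝ)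

/-- `f ∈ L²_ul(ℝ)`: finite uniformly local norm, and translations act continuously on `f`. -/
def MemL2ul (f : ℝ → ℝ) : Prop :=
  AEStronglyMeasurable f volume ∧ l2ulNorm f < ⊤ ∧
    Tendsto (fun ξ : ℝ => l2ulNorm (fun x => f (x - ξ) - f x)) (𝓝 0) (𝓝 0)

/-- `f ∈ H¹_ul(ℝ)`: `f` and its weak derivative belong to `L²_ul(ℝ)`. -/
def MemH1ul (f : ℝ → ℝ) : Prop :=
  MemL2ul f ∧ (∃ g, HasWeakDeriv f g) ∧ MemL2ul (weakDeriv f)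

/-- `u ∈ C⁰(J, H¹_ul(ℝ)) ∩ C¹(J, L²_ul(ℝ))` with time derivative `ut`, where `u t` denotes the
function `x ↦ u(x,t)`. Functions of `x` are identified when they agree almost everywhere: every
condition depends on the classes of `u t` and `ut t` only. -/
structure IsEnergyPath (J : Set ℝ) (u ut : ℝ → ℝ → ℝ) : Prop where
  memH1ul : ∀ t ∈ J, MemH1ul (u t)
  continuous_h1ul : ∀ t ∈ J, Tendsto (fun s => h1ulNorm (u s - u t)) (𝓝[J] t) (𝓝 0)
  memL2ul : ∀ t ∈ J, MemL2ul (ut t)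
  hasDeriv_l2ul : ∀ t ∈ J,
    Tendsto (fun s => l2ulNorm ((s - t)⁻¹ • (u s - u t) - ut t)) (𝓝[J \ {t}] t) (𝓝 0)
  continuous_l2ul : ∀ t ∈ J, Tendsto (fun s => l2ulNorm (ut s - ut t)) (𝓝[J] t) (𝓝 0)

/-- `u` is a solution on the time interval `J`, in the energy class and with time derivative `ut`,
of the damped wave equation `α u_tt + u_t = u_xx - V'(u)`. The equation is understood in the weak
sense: tested against any `φ ∈ C_c^∞(ℝ)`, it holds at every time `t ∈ J`. -/
structure IsDampedWaveSolution (α : ℝ) (V : ℝ → ℝ) (J : Set ℝ) (u ut : ℝ → ℝ → ℝ) : Prop where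
  energyPath : IsEnergyPath J u ut
  equation : ∀ φ : ℝ → ℝ, IsTestFunction φ → ∀ t ∈ J,
    HasDerivWithinAt (fun s => α * ∫ x, ut s x * φ x)
      ((∫ x, u t x * deriv (deriv φ) x) - (∫ x, ut t x * φ x) - ∫ x, deriv V (u t x) * φ x) J t

/-! ### Test functions and translations in `L²(ℝ)` -/

/-! Write p = u_x and q = u_t. The damped wave equation does not smooth, so compactness of
translates must come from estimates that are uniform over all times t ≥ 1.

Bounds (`WaveSystem.exists_bound`). The energy, localized by the weight χ = wt² and augmented by a
small multiple δ of α u q + u²/2, has time derivative at most -γN + c, where N is the local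
quadratic norm of (u, p, q). The potential has no growth restriction, so N alone does not control
the energy. `exists_energy_le_add_half` supplies the substitute: where N is bounded, the energy is
at most a constant plus half the supremum of all translated energies. Hence a large enough bound on
that supremum reproduces itself from one unit of time to the next.

Uniform continuity (`WaveSystem.exists_modulus`). The difference between a solution and its
translate is a wave system whose source is at most K times the difference of positions. That
difference stays small for all t ≥ 1 because p and q are bounded, and it is treated as a forcing
term. The damping then keeps the differences of p and q small (`WaveSystem.exists_linear_bound`),
with no exponential growth.

Compactness. The Sobolev embedding and Arzelà-Ascoli give locally uniform convergence of the
positions. By the uniform moduli, difference quotients of the positions approximate p and q with an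
error independent of the index, so strong convergence passes to both derivatives
(`wNorm_cauchy_of_approx`, `CompactFamily.exists_wConv_p`, `CompactFamily.exists_wConv_q`). The
uniformly local norm is lower semicontinuous under local convergence (`LocConv.l2ulNorm_le`), so the
limit inherits the regularity of a solution; the tested equations pass to the limit.

The energies have to be differentiated along weak solutions. The Riemann invariants βq ± p with β² =
α solve transport equations. In L² such a path is differentiable once translated along its
characteristics, and translation is an isometry, which yields the product rule
`WeakTransport.hasDerivAt_integral_mul`. All energy identities are algebraic consequences of it. -/

/-- The Hilbert space `L²(ℝ)`. -/
abbrev L2R : Type := Lp ℝ 2 (volume : Measure ℝ)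

namespace IsTestFunction

variable {φ ψ : ℝ → ℝ}

lemma continuous (h : IsTestFunction φ) : Continuous φ := h.1.continuous

lemma memLp (h : IsTestFunction φ) : MemLp φ 2 volume :=
  h.continuous.memLp_of_hasCompactSupport h.2

lemma differentiable (h : IsTestFunction φ) : Differentiable ℝ φ :=
  h.1.differentiable (by simp)

protected lemma deriv (h : IsTestFunction φ) : IsTestFunction (deriv φ) := by
  refine ⟨?_, h.2.deriv⟩
  exact h.1.iterate_deriv 1

lemma comp_add (h : IsTestFunction φ) (s : ℝ) : IsTestFunction (fun x => φ (x + s)) := by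
  refine ⟨h.1.comp (by fun_prop), ?_⟩
  exact h.2.comp_homeomorph (Homeomorph.addRight s)

lemma mul_left (h : IsTestFunction φ) {m : ℝ → ℝ} (hm : ContDiff ℝ ∞ m) :
    IsTestFunction (fun x => m x * φ x) :=
  ⟨hm.mul h.1, h.2.mul_left⟩

lemma add (h : IsTestFunction φ) (h' : IsTestFunction ψ) : IsTestFunction (fun x => φ x + ψ x) :=
  ⟨h.1.add h'.1, h.2.add h'.2⟩

lemma const_mul (h : IsTestFunction φ) (c : ℝ) : IsTestFunction (fun x => c * φ x) :=
  h.mul_left contDiff_const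

/-- The class in `L²(ℝ)` of a test function. -/
noncomputable def toL2 (h : IsTestFunction φ) : L2R := h.memLp.toLp φ

lemma coeFn_toL2 (h : IsTestFunction φ) : (h.toL2 : ℝ → ℝ) =ᵐ[volume] φ := h.memLp.coeFn_toLp

lemma inner_toLp {f : ℝ → ℝ} (hf : MemLp f 2 volume) (h : IsTestFunction φ) :
    inner ℝ (hf.toLp f) h.toL2 = ∫ x, f x * φ x := by
  rw [L2.inner_def]
  refine integral_congr_ae ?_
  filter_upwards [hf.coeFn_toLp, h.coeFn_toL2] with x h1 h2
  rw [h1, h2]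
  simp [mul_comm]

end IsTestFunction

/-- Test functions are dense, so the bound extends to every ψ in L², and ψ = F gives ‖F‖² ≤ M‖F‖.
This converts weak identities into norm estimates. -/
lemma norm_le_of_forall_inner_test {F : L2R} {M : ℝ}
    (h : ∀ φ (hφ : IsTestFunction φ), |inner ℝ F hφ.toL2| ≤ M * ‖hφ.toL2‖) : ‖F‖ ≤ M := by
  have hd := Lp.dense_hasCompactSupport_contDiff (E := ℝ) (F := ℝ) (μ := volume) (p := 2)
    (by simp)
  have hc : IsClosed {ψ : L2R | |inner ℝ F ψ| ≤ M * ‖ψ‖} := by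
    refine isClosed_le ?_ ?_ <;> fun_prop
  have hall : ∀ ψ : L2R, ψ ∈ {ψ : L2R | |inner ℝ F ψ| ≤ M * ‖ψ‖} := by
    intro ψ
    refine hc.closure_subset_iff.2 ?_ (hd ψ)
    rintro f ⟨g, hfg, hg1, hg2⟩
    have hg : IsTestFunction g := ⟨hg2, hg1⟩
    have : f = hg.toL2 := Lp.ext (hfg.trans hg.coeFn_toL2.symm)
    rw [this]
    exact h g hg
  have h1 := hall F
  simp only [mem_ofPred_eq, real_inner_self_eq_norm_sq, abs_of_nonneg (sq_nonneg ‖F‖)] at h1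
  by_contra! hlt
  -- For F = 0 the inequality ‖F‖² ≤ M‖F‖ says nothing about the sign of M; pairing with a nonzero
  -- bump rules out M < 0.
  rcases (norm_nonneg F).eq_or_lt with h0 | h0
  · have hz : F = 0 := norm_eq_zero.1 h0.symm
    obtain ⟨b, hb⟩ : ∃ b : ContDiffBump (0 : ℝ), True := ⟨⟨1, 2, by norm_num, by norm_num⟩, trivial⟩
    have ht : IsTestFunction b := ⟨b.contDiff, b.hasCompactSupport⟩
    have h2 := h b ht
    rw [hz, inner_zero_left, abs_zero] at h2
    have hM : M < 0 := by rwa [← h0] at hlt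
    have h3 : ‖ht.toL2‖ = 0 := le_antisymm (by nlinarith [norm_nonneg ht.toL2]) (norm_nonneg _)
    have h4 : (b : ℝ → ℝ) =ᵐ[volume] fun _ => (0 : ℝ) := by
      have := ht.coeFn_toL2
      rw [norm_eq_zero.1 h3] at this
      exact this.symm.trans (Lp.coeFn_zero ..)
    have h5 := (b.continuous.ae_eq_iff_eq volume continuous_const).1 h4
    have h6 := congrFun h5 0
    rw [b.one_of_mem_closedBall (by simp [b.rIn_pos.le])] at h6
    exact one_ne_zero h6
  · nlinarith

/-- Translation `a ↦ a(· + s)` as an isometry of `L²(ℝ)`. -/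
noncomputable def shiftL2 (s : ℝ) : L2R →ₗᵢ[ℝ] L2R :=
  Lp.compMeasurePreservingₗᵢ ℝ (fun x => x + s) (measurePreserving_add_right volume s)

lemma shiftL2_toL2 {φ : ℝ → ℝ} (h : IsTestFunction φ) (s : ℝ) :
    shiftL2 s h.toL2 = (h.comp_add s).toL2 := rfl

lemma coeFn_shiftL2 (s : ℝ) (a : L2R) : shiftL2 s a =ᵐ[volume] fun x => a (x + s) :=
  Lp.coeFn_compMeasurePreserving a (measurePreserving_add_right volume s)

lemma shiftL2_shiftL2 (s r : ℝ) (a : L2R) : shiftL2 s (shiftL2 r a) = shiftL2 (s + r) a := by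
  refine Lp.ext ?_
  have h1 := coeFn_shiftL2 s (shiftL2 r a)
  have h2 := (measurePreserving_add_right volume s).quasiMeasurePreserving.ae_eq_comp
    (coeFn_shiftL2 r a)
  filter_upwards [h1, h2, coeFn_shiftL2 (s + r) a] with x h1 h2 h3
  rw [h1, h3]
  simpa [add_assoc] using h2

lemma shiftL2_zero (a : L2R) : shiftL2 0 a = a := by
  refine Lp.ext ?_
  filter_upwards [coeFn_shiftL2 0 a] with x h
  rw [h, add_zero]

lemma inner_shiftL2 (s : ℝ) (a b : L2R) :
    inner ℝ (shiftL2 s a) b = inner ℝ a (shiftL2 (-s) b) := by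
  rw [← LinearIsometry.inner_map_map (shiftL2 s) a, shiftL2_shiftL2, add_neg_cancel, shiftL2_zero]

lemma ContinuousAt.shiftL2 {f : ℝ → L2R} {s : ℝ → ℝ} {t : ℝ} (hf : ContinuousAt f t)
    (hs : ContinuousAt s t) : ContinuousAt (fun z => shiftL2 (s z) (f z)) t := by
  have hg : Continuous (fun r : ℝ => (⟨fun x => x + r, by fun_prop⟩ : C(ℝ, ℝ))) :=
    ContinuousMap.continuous_of_continuous_uncurry _ 
      (show Continuous fun p : ℝ × ℝ => p.2 + p.1 by fun_prop)
  exact hf.compMeasurePreservingLp (g := fun z => ⟨fun x => x + s z, by fun_prop⟩)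
    (hg.continuousAt.comp hs) (fun z => measurePreserving_add_right volume (s z)) (by simp)

lemma IsTestFunction.abs_taylor_le {φ : ℝ → ℝ} (h : IsTestFunction φ) :
    ∃ C, 0 ≤ C ∧ ∀ x s, |φ (x + s) - (φ x + s * deriv φ x)| ≤ C * s ^ 2 := by
  obtain ⟨C, hC⟩ := h.deriv.deriv.2.exists_bound_of_continuous h.deriv.deriv.continuous
  have hC0 : 0 ≤ C := (norm_nonneg _).trans (hC 0)
  have hlip : ∀ x y, |deriv φ y - deriv φ x| ≤ C * |y - x| := fun x y =>
    convex_univ.norm_image_sub_le_of_norm_deriv_le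
      (fun z _ => h.deriv.differentiable z) (fun z _ => hC z) (mem_univ _) (mem_univ _)
  refine ⟨C, hC0, fun x s => ?_⟩
  have hd : ∀ y, HasDerivAt (fun y => φ y - y * deriv φ x) (deriv φ y - deriv φ x) y := fun y =>
    (h.differentiable y).hasDerivAt.sub (by simpa using (hasDerivAt_id y).mul_const (deriv φ x))
  have := (convex_uIcc x (x + s)).norm_image_sub_le_of_norm_hasDerivWithin_le
    (f := fun y => φ y - y * deriv φ x) (C := C * |s|)
    (fun y _ => (hd y).hasDerivWithinAt) (fun y hy => ?_) left_mem_uIcc right_mem_uIcc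
  · simp only [Real.norm_eq_abs, add_sub_cancel_left] at this
    rw [mul_assoc, abs_mul_abs_self, ← sq] at this
    convert this using 2
    ring
  · refine (hlip x y).trans (mul_le_mul_of_nonneg_left ?_ hC0)
    have := abs_sub_left_of_mem_uIcc hy
    simpa using this

/-- The Taylor remainder is pointwise O(s²) and, for |s| ≤ 1, lives on one compact set, so it is
O(s²) in L². -/
lemma hasDerivAt_shiftL2_test_zero {φ : ℝ → ℝ} (h : IsTestFunction φ) :
    HasDerivAt (fun s => shiftL2 s h.toL2) h.deriv.toL2 0 := by
  obtain ⟨C, hC0, hC⟩ := h.abs_taylor_le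
  -- The closed unit neighbourhood contains the supports of all translates by |s| ≤ 1.
  set K : Set ℝ := Metric.cthickening 1 (tsupport φ) with hK
  have hKc : IsCompact K := h.2.isCompact.cthickening
  set m : ℝ := ((volume K) ^ (1 / (2 : ℝ≥0∞).toReal)).toReal with hm
  have hmtop : (volume K) ^ (1 / (2 : ℝ≥0∞).toReal) ≠ ⊤ :=
    ENNReal.rpow_ne_top_of_nonneg (by positivity) hKc.measure_lt_top.ne
  have key : ∀ s : ℝ, |s| ≤ 1 → ‖shiftL2 s h.toL2 - h.toL2 - s • h.deriv.toL2‖ ≤ C * m * s ^ 2 := by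
    intro s hs
    have e1 : shiftL2 s h.toL2 - h.toL2 - s • h.deriv.toL2
        = ((h.comp_add s).memLp.sub (h.memLp.add (h.deriv.memLp.const_smul s))).toLp _ := by
      rw [shiftL2_toL2, sub_sub]
      rfl
    rw [e1, Lp.norm_toLp]
    have hsub : ∀ x, φ x ≠ 0 → x ∈ K := fun x hx =>
      Metric.self_subset_cthickening _ (subset_tsupport _ hx)
    have := eLpNorm_sub_le_of_dist_bdd volume (p := 2) (by simp) hKc.measurableSet
      (f := fun x => φ (x + s)) (g := φ + s • deriv φ) (c := C * s ^ 2) (by positivity)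
      (fun x => by simpa [Real.dist_eq] using hC x s) ?_ ?_
    · refine ENNReal.toReal_le_of_le_ofReal (by positivity) (this.trans_eq ?_)
      rw [← ENNReal.ofReal_toReal hmtop, ← ENNReal.ofReal_mul (by positivity)]
      congr 1
      ring
    · intro x hx
      refine Metric.mem_cthickening_of_dist_le x (x + s) 1 _ (subset_tsupport _ hx) ?_
      simpa [Real.dist_eq] using hs
    · intro x hx
      by_contra hxK
      have h1 : x ∉ tsupport φ := fun hx' => hxK (Metric.self_subset_cthickening _ hx')
      have h2 : φ x = 0 := image_eq_zero_of_notMem_tsupport h1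
      have h3 : deriv φ x = 0 := by
        by_contra h3
        exact h1 (support_deriv_subset h3)
      simp [h2, h3] at hx
  rw [hasDerivAt_iff_isLittleO_nhds_zero]
  have hO : (fun s : ℝ => shiftL2 (0 + s) h.toL2 - shiftL2 0 h.toL2 - s • h.deriv.toL2)
      =O[𝓝 0] fun s : ℝ => s ^ 2 := by
    refine Asymptotics.IsBigO.of_bound (C * m) ?_
    filter_upwards [Metric.closedBall_mem_nhds (0 : ℝ) one_pos] with s hs
    rw [zero_add, shiftL2_zero, Real.norm_of_nonneg (sq_nonneg s)]
    exact key s (by simpa using hs)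
  refine hO.trans_isLittleO ?_
  simpa using Asymptotics.isLittleO_pow_id (𝕜 := ℝ) (n := 2) (by norm_num)

/-! ### Weak transport equations and characteristics in L²(ℝ) -/

lemma hasDerivAt_shiftL2_test {φ : ℝ → ℝ} (h : IsTestFunction φ) (c t₀ t : ℝ) :
    HasDerivAt (fun s => shiftL2 (c * (s - t₀)) h.toL2)
      (c • shiftL2 (c * (t - t₀)) h.deriv.toL2) t := by
  have h1 : HasDerivAt (fun s => c * (s - t)) c t := by
    simpa using ((hasDerivAt_id t).sub_const t).const_mul c
  have h2 : HasDerivAt (fun s => shiftL2 (c * (s - t)) h.toL2) (c • h.deriv.toL2) t := by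
    have h0 := hasDerivAt_shiftL2_test_zero h
    rw [show (0 : ℝ) = c * (t - t) by ring] at h0
    exact h0.scomp t h1
  have h3 := (shiftL2 (c * (t - t₀))).toContinuousLinearMap.hasFDerivAt.comp_hasDerivAt t h2
  simp only [LinearIsometry.coe_toContinuousLinearMap, map_smul] at h3
  refine h3.congr_of_eventuallyEq (Eventually.of_forall fun s => ?_)
  simp only [Function.comp, shiftL2_shiftL2]
  congr 1
  ring_nf

/-- The scalar mean value inequality applies to each pairing with a constant proportional to the
norm of the test function, and duality recovers the norm. Subtracting the fixed vector G₀ makes this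
a criterion for strong differentiability at a point. -/
lemma norm_sub_le_of_weak_hasDerivAt {F G : ℝ → L2R} {a b M : ℝ} (G₀ : L2R)
    (hF : ∀ φ (hφ : IsTestFunction φ), ∀ t ∈ uIcc a b,
      HasDerivAt (fun s => inner ℝ (F s) hφ.toL2) (inner ℝ (G t) hφ.toL2) t)
    (hG : ∀ t ∈ uIcc a b, ‖G t - G₀‖ ≤ M) :
    ‖F b - F a - (b - a) • G₀‖ ≤ M * |b - a| := by
  refine norm_le_of_forall_inner_test fun φ hφ => ?_
  have hd : ∀ t ∈ uIcc a b, HasDerivWithinAt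
      (fun s => inner ℝ (F s) hφ.toL2 - s * inner ℝ G₀ hφ.toL2) (inner ℝ (G t - G₀) hφ.toL2)
      (uIcc a b) t := by
    intro t ht
    rw [inner_sub_left]
    refine ((hF φ hφ t ht).sub ?_).hasDerivWithinAt
    simpa using (hasDerivAt_id t).mul_const (inner ℝ G₀ hφ.toL2)
  have := (convex_uIcc a b).norm_image_sub_le_of_norm_hasDerivWithin_le
    (C := M * ‖hφ.toL2‖) hd (fun t ht => ?_) left_mem_uIcc right_mem_uIcc
  · rw [inner_sub_left, inner_sub_left, inner_smul_left]
    simp only [Real.norm_eq_abs, conj_trivial] at this ⊢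
    calc _ = _ := by congr 1; ring
      _ ≤ _ := this
      _ = _ := by ring
  · exact (norm_inner_le_norm _ _).trans
      (mul_le_mul_of_nonneg_right (hG t ht) (norm_nonneg _))

/-- A path in `L²(ℝ)` solving a transport equation weakly is differentiable along the
characteristics. -/
lemma hasDerivAt_shiftL2_of_weak_transport {a g : ℝ → L2R} {c t₀ : ℝ} {J : Set ℝ} (hJ : IsOpen J)
    (ht₀ : t₀ ∈ J) (ha : ContinuousOn a J) (hg : ContinuousOn g J)
    (h : ∀ φ (hφ : IsTestFunction φ), ∀ t ∈ J, HasDerivAt (fun s => inner ℝ (a s) hφ.toL2)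
      (-c * inner ℝ (a t) hφ.deriv.toL2 + inner ℝ (g t) hφ.toL2) t) :
    HasDerivAt (fun t => shiftL2 (-(c * (t - t₀))) (a t)) (g t₀) t₀ := by
  set F : ℝ → L2R := fun t => shiftL2 (-(c * (t - t₀))) (a t) with hFdef
  set G : ℝ → L2R := fun t => shiftL2 (-(c * (t - t₀))) (g t) with hGdef
  have hF : ∀ φ (hφ : IsTestFunction φ), ∀ t ∈ J,
      HasDerivAt (fun s => inner ℝ (F s) hφ.toL2) (inner ℝ (G t) hφ.toL2) t := by
    intro φ hφ t ht
    simp only [hFdef, hGdef, inner_shiftL2, neg_neg]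
    set ψ := shiftL2 (c * (t - t₀)) hφ.toL2 with hψ
    have h1 : HasDerivAt (fun s => inner ℝ (a s) ψ)
        (-c * inner ℝ (a t) (shiftL2 (c * (t - t₀)) hφ.deriv.toL2) + inner ℝ (g t) ψ) t := by
      have hd : IsTestFunction.toL2 (hφ.comp_add (c * (t - t₀))).deriv
          = shiftL2 (c * (t - t₀)) hφ.deriv.toL2 := by
        rw [shiftL2_toL2]
        congr 1
        ext x
        exact deriv_comp_add_const φ (c * (t - t₀)) x
      have := h _ (hφ.comp_add (c * (t - t₀))) t ht
      rwa [hd] at this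
    -- The moving test function is split into its frozen value ψ and an increment vanishing at s =
    -- t. The frozen part uses the weak equation; for the increment, continuity of `a` is enough,
    -- since only the test function is differentiated. The two transport terms cancel.
    have h2 : HasDerivAt (fun s => inner ℝ (a s) (shiftL2 (c * (s - t₀)) hφ.toL2 - ψ))
        (c * inner ℝ (a t) (shiftL2 (c * (t - t₀)) hφ.deriv.toL2)) t := by
      have hs := hasDerivAt_shiftL2_test hφ c t₀ t
      rw [hasDerivAt_iff_tendsto_slope] at hs ⊢
      have ha' : Tendsto a (𝓝[≠] t) (𝓝 (a t)) :=
        ((ha t ht).continuousAt (hJ.mem_nhds ht)).tendsto.mono_left nhdsWithin_le_nhds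
      have := ha'.inner (𝕜 := ℝ) hs
      rw [inner_smul_right] at this
      refine this.congr fun s => ?_
      simp only [slope_def_module, hψ, sub_self, inner_zero_right, sub_zero, inner_smul_right,
        smul_eq_mul]
    have h3 := h1.add h2
    have e : -c * inner ℝ (a t) (shiftL2 (c * (t - t₀)) hφ.deriv.toL2) + inner ℝ (g t) ψ
        + c * inner ℝ (a t) (shiftL2 (c * (t - t₀)) hφ.deriv.toL2) = inner ℝ (g t) ψ := by ring
    rw [e] at h3
    refine h3.congr_of_eventuallyEq (Eventually.of_forall fun s => ?_)
    simp [inner_sub_right]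
  have hGc : ContinuousAt G t₀ :=
    ((hg t₀ ht₀).continuousAt (hJ.mem_nhds ht₀)).shiftL2 (by fun_prop)
  have hG0 : G t₀ = g t₀ := by simp [hGdef, shiftL2_zero]
  -- Continuity of `G` at t₀ gives M = ε in the weak mean value inequality near t₀, which is exactly
  -- strong differentiability there.
  rw [hasDerivAt_iff_isLittleO, Asymptotics.isLittleO_iff]
  intro ε hε
  rw [Metric.continuousAt_iff] at hGc
  obtain ⟨δ, hδ, hGδ⟩ := hGc ε hε
  obtain ⟨r, hr, hrJ⟩ := Metric.isOpen_iff.1 hJ t₀ ht₀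
  filter_upwards [Metric.ball_mem_nhds t₀ (lt_min hδ hr)] with t ht
  have hsub : ∀ s ∈ uIcc t₀ t, dist s t₀ < min δ r := fun s hs => by
    have := abs_sub_left_of_mem_uIcc hs
    rw [Real.dist_eq]
    rw [Metric.mem_ball, Real.dist_eq] at ht
    exact this.trans_lt ht
  have := norm_sub_le_of_weak_hasDerivAt (F := F) (G := G) (a := t₀) (b := t) (M := ε) (g t₀)
    (fun φ hφ s hs => hF φ hφ s (hrJ ((hsub s hs).trans_le (min_le_right _ _))))
    (fun s hs => by
      rw [← hG0, ← dist_eq_norm]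
      exact (hGδ ((hsub s hs).trans_le (min_le_left _ _))).le)
  simpa [hFdef] using this

/-- Both factors have the same speed, so one translation straightens both, and being an isometry it
does not change their inner product. The ordinary product rule applies to the translated curves,
although `a` and `b` themselves need not be differentiable. -/
lemma hasDerivAt_inner_of_weak_transport {a g b k : ℝ → L2R} {c t₀ : ℝ} {J : Set ℝ}
    (hJ : IsOpen J) (ht₀ : t₀ ∈ J)
    (ha : ContinuousOn a J) (hg : ContinuousOn g J) (hb : ContinuousOn b J)
    (hk : ContinuousOn k J)
    (h : ∀ φ (hφ : IsTestFunction φ), ∀ t ∈ J, HasDerivAt (fun s => inner ℝ (a s) hφ.toL2)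
      (-c * inner ℝ (a t) hφ.deriv.toL2 + inner ℝ (g t) hφ.toL2) t)
    (h' : ∀ φ (hφ : IsTestFunction φ), ∀ t ∈ J, HasDerivAt (fun s => inner ℝ (b s) hφ.toL2)
      (-c * inner ℝ (b t) hφ.deriv.toL2 + inner ℝ (k t) hφ.toL2) t) :
    HasDerivAt (fun t => inner ℝ (a t) (b t))
      (inner ℝ (a t₀) (k t₀) + inner ℝ (g t₀) (b t₀)) t₀ := by
  have h1 := (hasDerivAt_shiftL2_of_weak_transport hJ ht₀ ha hg h).inner ℝ
    (hasDerivAt_shiftL2_of_weak_transport hJ ht₀ hb hk h')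
  simpa [shiftL2_zero, LinearIsometry.inner_map_map] using h1

/-! ### Weights and uniformly local spaces -/

/-- The weight `1 / (1 + (κ x)²)`. -/
noncomputable def wt (κ x : ℝ) : ℝ := (1 + (κ * x) ^ 2)⁻¹

section Weight

variable {κ : ℝ}

lemma wt_pos (κ x : ℝ) : 0 < wt κ x := by unfold wt; positivity

lemma wt_le_one (κ x : ℝ) : wt κ x ≤ 1 :=
  inv_le_one_of_one_le₀ (by nlinarith [sq_nonneg (κ * x)])

lemma contDiff_wt (κ : ℝ) {n : WithTop ℕ∞} : ContDiff ℝ n (wt κ) := by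
  unfold wt
  exact ContDiff.inv (by fun_prop) (fun x => by positivity)

lemma continuous_wt (κ : ℝ) : Continuous (wt κ) := (contDiff_wt κ (n := 0)).continuous

lemma hasDerivAt_wt (κ x : ℝ) :
    HasDerivAt (wt κ) (-(2 * κ ^ 2 * x) * wt κ x ^ 2) x := by
  have h1 : HasDerivAt (fun x : ℝ => 1 + (κ * x) ^ 2) (2 * κ ^ 2 * x) x := by
    have := (((hasDerivAt_id x).const_mul κ).pow 2).const_add 1
    convert! this using 1
    simp
    ring
  have h2 := h1.inv (by positivity)
  convert! h2 using 1
  unfold wt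
  field_simp

lemma continuous_deriv_wt (κ : ℝ) : Continuous (deriv (wt κ)) :=
  (contDiff_wt κ (n := 1)).continuous_deriv le_rfl

/-- This is 2κ|x| ≤ 1 + (κx)². The factor κ is what later lets the dissipation absorb the flux terms
created by the weight. -/
lemma abs_deriv_wt_le (hκ : 0 ≤ κ) (x : ℝ) : |deriv (wt κ) x| ≤ κ * wt κ x := by
  rw [(hasDerivAt_wt κ x).deriv, abs_mul, abs_of_nonneg (sq_nonneg (wt κ x)), sq (wt κ x),
    ← mul_assoc]
  refine mul_le_mul_of_nonneg_right ?_ (wt_pos κ x).le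
  unfold wt
  rw [← div_eq_mul_inv, div_le_iff₀ (by positivity), abs_neg, abs_mul, abs_of_nonneg (by positivity)]
  have : (2 : ℝ) * (κ * |x|) ≤ 1 + (κ * x) ^ 2 := by
    have h1 : (κ * x) ^ 2 = (κ * |x|) ^ 2 := by rw [mul_pow, mul_pow, sq_abs]
    nlinarith [sq_nonneg (κ * |x| - 1)]
  nlinarith

lemma wt_le_mul_wt {x y : ℝ} (h : |x - y| ≤ 1) : wt κ x ≤ (2 + 2 * κ ^ 2) * wt κ y := by
  unfold wt
  rw [← div_eq_mul_inv, inv_eq_one_div, div_le_div_iff₀ (by positivity) (by positivity)]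
  have h1 : (x - y) ^ 2 ≤ 1 := by rw [← sq_abs]; nlinarith [abs_nonneg (x - y)]
  nlinarith [sq_nonneg κ, sq_nonneg (κ * (2 * x - y)), sq_nonneg (κ * x),
    mul_le_mul_of_nonneg_left h1 (sq_nonneg κ), sq_nonneg (κ ^ 2 * x)]

lemma wt_ge_of_abs_le {x R : ℝ} (h : |x| ≤ R) : wt κ R ≤ wt κ x := by
  unfold wt
  refine inv_anti₀ (by positivity) ?_
  rw [mul_pow, mul_pow, ← sq_abs x]
  gcongr

lemma integrable_wt (hκ : κ ≠ 0) : Integrable (wt κ) :=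
  integrable_inv_one_add_sq.comp_mul_left' hκ

end Weight

/-- The weight varies by a bounded factor over unit distance, so wt(x) is at most a constant times
its integral over [x-1, x]. Tonelli's theorem then rewrites the left side as a weighted integral of
the unit-window integrals of e. -/
lemma lintegral_wt_mul_le {κ : ℝ} (hκ : κ ≠ 0) : ∃ C : ℝ, 0 < C ∧ ∀ e : ℝ → ℝ≥0∞, AEMeasurable e →
    ∀ S : ℝ≥0∞, (∀ ξ, ∫⁻ x in Icc ξ (ξ + 1), e x ≤ S) →
      ∫⁻ x, ENNReal.ofReal (wt κ x) * e x ≤ ENNReal.ofReal C * S := by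
  set I : ℝ := ∫ x, wt κ x with hI
  have hI0 : 0 ≤ I := integral_nonneg fun x => (wt_pos κ x).le
  -- I + 1 instead of I gives a positive constant from I ≥ 0 alone.
  refine ⟨(2 + 2 * κ ^ 2) * (I + 1), by positivity, fun e he S hS => ?_⟩
  have hw : Measurable fun x => ENNReal.ofReal (wt κ x) := (continuous_wt κ).measurable.ennreal_ofReal
  set s : Set (ℝ × ℝ) := {p | p.1 ∈ Icc p.2 (p.2 + 1)} with hs
  have hsm : MeasurableSet s := by
    refine IsClosed.measurableSet ?_
    exact (isClosed_le continuous_snd continuous_fst).inter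
      (isClosed_le continuous_fst (by fun_prop))
  have h1 : ∀ x, ENNReal.ofReal (wt κ x) * e x ≤ ENNReal.ofReal (2 + 2 * κ ^ 2) *
      ∫⁻ η, s.indicator (fun p => ENNReal.ofReal (wt κ p.2) * e p.1) (x, η) := by
    intro x
    have e1 : ∀ η, s.indicator (fun p : ℝ × ℝ => ENNReal.ofReal (wt κ p.2) * e p.1) (x, η)
        = (Icc (x - 1) x).indicator (fun η => ENNReal.ofReal (wt κ η) * e x) η := by
      intro η
      have : (x, η) ∈ s ↔ η ∈ Icc (x - 1) x := by
        simp only [hs, mem_ofPred_eq, mem_Icc]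
        constructor <;> rintro ⟨h, h'⟩ <;> constructor <;> linarith
      by_cases hη : η ∈ Icc (x - 1) x
      · rw [indicator_of_mem hη, indicator_of_mem (this.2 hη)]
      · rw [indicator_of_notMem hη, indicator_of_notMem (fun h => hη (this.1 h))]
    simp only [e1]
    rw [lintegral_indicator measurableSet_Icc, lintegral_mul_const _ hw, ← mul_assoc]
    gcongr
    calc ENNReal.ofReal (wt κ x) = ∫⁻ η in Icc (x - 1) x, ENNReal.ofReal (wt κ x) := by simp
      _ ≤ ∫⁻ η in Icc (x - 1) x, ENNReal.ofReal (2 + 2 * κ ^ 2) * ENNReal.ofReal (wt κ η) := by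
          refine setLIntegral_mono' measurableSet_Icc fun η hη => ?_
          rw [← ENNReal.ofReal_mul (by positivity)]
          refine ENNReal.ofReal_le_ofReal (wt_le_mul_wt ?_)
          rw [abs_le]
          constructor <;> linarith [hη.1, hη.2]
      _ = _ := lintegral_const_mul _ hw
  calc ∫⁻ x, ENNReal.ofReal (wt κ x) * e x
      ≤ ∫⁻ x, ENNReal.ofReal (2 + 2 * κ ^ 2) *
        ∫⁻ η, s.indicator (fun p => ENNReal.ofReal (wt κ p.2) * e p.1) (x, η) := lintegral_mono h1
    _ = ENNReal.ofReal (2 + 2 * κ ^ 2) * ∫⁻ x,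
        ∫⁻ η, s.indicator (fun p => ENNReal.ofReal (wt κ p.2) * e p.1) (x, η) :=
      lintegral_const_mul' _ _ (by simp)
    _ = ENNReal.ofReal (2 + 2 * κ ^ 2) * ∫⁻ η,
        ∫⁻ x, s.indicator (fun p => ENNReal.ofReal (wt κ p.2) * e p.1) (x, η) := by
      rw [lintegral_lintegral_swap]
      refine AEMeasurable.indicator ?_ hsm
      exact (hw.comp measurable_snd).aemeasurable.mul he.comp_fst
    _ = ENNReal.ofReal (2 + 2 * κ ^ 2) * ∫⁻ η, ENNReal.ofReal (wt κ η) *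
          ∫⁻ x in Icc η (η + 1), e x := by
      congr 1
      refine lintegral_congr fun η => ?_
      rw [← lintegral_const_mul' _ _ (by simp), ← lintegral_indicator measurableSet_Icc]
      refine lintegral_congr fun x => ?_
      by_cases hx : x ∈ Icc η (η + 1)
      · rw [indicator_of_mem hx, indicator_of_mem (show (x, η) ∈ s from hx)]
      · rw [indicator_of_notMem hx, indicator_of_notMem (show (x, η) ∉ s from hx)]
    _ ≤ ENNReal.ofReal (2 + 2 * κ ^ 2) * ∫⁻ η, ENNReal.ofReal (wt κ η) * S := by
      gcongr with η
      exact hS η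
    _ = ENNReal.ofReal (2 + 2 * κ ^ 2) * (ENNReal.ofReal I * S) := by
      rw [lintegral_mul_const _ hw, ← ofReal_integral_eq_lintegral_ofReal (integrable_wt hκ)
        (Eventually.of_forall fun x => (wt_pos κ x).le)]
    _ ≤ ENNReal.ofReal ((2 + 2 * κ ^ 2) * (I + 1)) * S := by
      rw [← mul_assoc, ← ENNReal.ofReal_mul (by positivity)]
      gcongr
      linarith

/-! ### Comparison of weighted, local and uniformly local norms -/

lemma eLpNorm_two_sq {f : ℝ → ℝ} {μ : Measure ℝ} : eLpNorm f 2 μ ^ 2 = ∫⁻ x, ‖f x‖ₑ ^ 2 ∂μ := by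
  have := eLpNorm_nnreal_pow_eq_lintegral (f := f) (μ := μ) (p := 2) (by norm_num)
  simpa using this

lemma sq_le_sq_iff_ennreal {a b : ℝ≥0∞} : a ^ 2 ≤ b ^ 2 ↔ a ≤ b :=
  ENNReal.pow_le_pow_left_iff two_ne_zero

/-- The weighted `L²` norm. -/
noncomputable def wNorm (κ : ℝ) (f : ℝ → ℝ) : ℝ≥0∞ := eLpNorm (fun x => wt κ x * f x) 2 volume

/-- Since wt² ≤ wt, window averaging applies to |f|². In the other direction, `l2Norm_unit_le_wNorm`
recovers the uniformly local norm from the weighted norms of all translates. -/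
lemma exists_wNorm_le {κ : ℝ} (hκ : κ ≠ 0) : ∃ C : ℝ, 0 < C ∧ ∀ f : ℝ → ℝ,
    AEStronglyMeasurable f volume → wNorm κ f ≤ ENNReal.ofReal C * l2ulNorm f := by
  obtain ⟨C, hC0, hC⟩ := lintegral_wt_mul_le hκ
  refine ⟨√C, by positivity, fun f hf => ?_⟩
  rw [← sq_le_sq_iff_ennreal, wNorm, eLpNorm_two_sq, mul_pow, ← ENNReal.ofReal_pow (by positivity),
    Real.sq_sqrt hC0.le]
  calc ∫⁻ x, ‖wt κ x * f x‖ₑ ^ 2 ≤ ∫⁻ x, ENNReal.ofReal (wt κ x) * ‖f x‖ₑ ^ 2 := by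
        refine lintegral_mono fun x => ?_
        simp only [enorm_mul, mul_pow]
        gcongr
        rw [Real.enorm_of_nonneg (wt_pos κ x).le, sq]
        exact mul_le_of_le_one_right' (by simpa using wt_le_one κ x)
    _ ≤ _ := by
        refine hC _ (by fun_prop) _ fun ξ => ?_
        rw [← eLpNorm_two_sq]
        gcongr
        exact le_iSup (fun ξ => l2Norm (Icc ξ (ξ + 1)) f) ξ

lemma l2Norm_shift (s : Set ℝ) (f : ℝ → ℝ) (ξ : ℝ) :
    l2Norm ((fun x => ξ + x) ⁻¹' s) (fun x => f (ξ + x)) = l2Norm s f := by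
  have hmp : MeasurePreserving (fun x : ℝ => ξ + x) (volume.restrict ((fun x => ξ + x) ⁻¹' s))
      (volume.restrict s) :=
    (measurePreserving_add_left volume ξ).restrict_preimage_emb (measurableEmbedding_addLeft ξ) s
  rw [l2Norm, l2Norm, ← hmp.map_eq, (measurableEmbedding_addLeft ξ).eLpNorm_map_measure]
  rfl

lemma l2Norm_Icc_shift (a b : ℝ) (f : ℝ → ℝ) (ξ : ℝ) :
    l2Norm (Icc a b) (fun x => f (ξ + x)) = l2Norm (Icc (ξ + a) (ξ + b)) f := by
  rw [← l2Norm_shift _ f ξ]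
  congr 1
  ext x
  simp

lemma l2Norm_Icc_le_wNorm {κ R : ℝ} (f : ℝ → ℝ) :
    l2Norm (Icc (-R) R) f ≤ ENNReal.ofReal (wt κ R)⁻¹ * wNorm κ f := by
  have h0 := wt_pos κ R
  have : l2Norm (Icc (-R) R) f ≤ ENNReal.ofReal (wt κ R)⁻¹ *
      eLpNorm (fun x => wt κ x * f x) 2 (volume.restrict (Icc (-R) R)) := by
    refine eLpNorm_le_mul_eLpNorm_of_ae_le_mul ?_ 2
    filter_upwards [ae_restrict_mem measurableSet_Icc] with x hx
    rw [norm_mul, Real.norm_of_nonneg (wt_pos κ x).le, ← mul_assoc]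
    refine le_mul_of_one_le_left (norm_nonneg _) ?_
    rw [inv_mul_eq_div, one_le_div h0]
    exact wt_ge_of_abs_le (abs_le.2 hx)
  exact this.trans (by unfold wNorm; gcongr; exact Measure.restrict_le_self)

lemma l2Norm_mono_set {s s' : Set ℝ} (h : s ⊆ s') (f : ℝ → ℝ) : l2Norm s f ≤ l2Norm s' f :=
  eLpNorm_mono_measure f (Measure.restrict_mono h le_rfl)

lemma l2Norm_unit_le_wNorm {κ : ℝ} (f : ℝ → ℝ) (ξ : ℝ) :
    l2Norm (Icc ξ (ξ + 1)) f ≤ ENNReal.ofReal (wt κ 1)⁻¹ * wNorm κ (fun x => f (ξ + x)) := by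
  have := l2Norm_Icc_shift 0 1 f ξ
  rw [add_zero] at this
  rw [← this]
  exact (l2Norm_mono_set (Icc_subset_Icc_left (by norm_num)) _).trans (l2Norm_Icc_le_wNorm _)

lemma l2Norm_unit_le_l2ulNorm (f : ℝ → ℝ) (ξ : ℝ) : l2Norm (Icc ξ (ξ + 1)) f ≤ l2ulNorm f :=
  le_iSup (fun ξ => l2Norm (Icc ξ (ξ + 1)) f) ξ

lemma l2ulNorm_congr_ae {f g : ℝ → ℝ} (h : f =ᵐ[volume] g) : l2ulNorm f = l2ulNorm g := by
  unfold l2ulNorm l2Norm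
  congr 1
  ext ξ
  exact eLpNorm_congr_ae (ae_restrict_of_ae h)

lemma l2ulNorm_shift (f : ℝ → ℝ) (ξ : ℝ) : l2ulNorm (fun x => f (ξ + x)) = l2ulNorm f := by
  unfold l2ulNorm
  refine le_antisymm (iSup_le fun η => ?_) (iSup_le fun η => ?_)
  · rw [l2Norm_Icc_shift, ← add_assoc]
    exact le_iSup (fun η => l2Norm (Icc η (η + 1)) f) (ξ + η)
  · refine le_trans (le_of_eq ?_) (le_iSup _ (η - ξ))
    rw [l2Norm_Icc_shift]
    congr 2 <;> ring

lemma l2ulNorm_le_mul {f g : ℝ → ℝ} {c : ℝ} (h : ∀ x, |f x| ≤ c * |g x|) :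
    l2ulNorm f ≤ ENNReal.ofReal c * l2ulNorm g := by
  refine iSup_le fun ξ => ?_
  refine (eLpNorm_le_mul_eLpNorm_of_ae_le_mul (g := g) (c := c) (ae_of_all _ h) 2).trans ?_
  gcongr
  exact l2Norm_unit_le_l2ulNorm g ξ

lemma l2ulNorm_le_of_bound {f : ℝ → ℝ} {c : ℝ} (h : ∀ x, |f x| ≤ c) :
    l2ulNorm f ≤ ENNReal.ofReal c := by
  refine iSup_le fun ξ => ?_
  refine (eLpNorm_le_of_ae_bound (ae_of_all _ h)).trans ?_
  simp

lemma l2ulNorm_const_mul (c : ℝ) (f : ℝ → ℝ) :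
    l2ulNorm (fun x => c * f x) ≤ ENNReal.ofReal |c| * l2ulNorm f :=
  l2ulNorm_le_mul fun x => by rw [abs_mul]

lemma l2ulNorm_add_le {f g : ℝ → ℝ} (hf : AEStronglyMeasurable f volume)
    (hg : AEStronglyMeasurable g volume) :
    l2ulNorm (fun x => f x + g x) ≤ l2ulNorm f + l2ulNorm g := by
  refine iSup_le fun ξ => (eLpNorm_add_le hf.restrict hg.restrict (by norm_num)).trans ?_
  exact add_le_add (l2Norm_unit_le_l2ulNorm f ξ) (l2Norm_unit_le_l2ulNorm g ξ)

lemma l2ulNorm_sub_comm (f g : ℝ → ℝ) :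
    l2ulNorm (fun x => f x - g x) = l2ulNorm (fun x => g x - f x) := by
  refine le_antisymm ?_ ?_ <;>
  · refine iSup_mono fun ξ => le_of_eq ?_
    exact eLpNorm_sub_comm _ _ _ _

lemma tendsto_ennreal_zero_add {ι : Type*} {l : Filter ι} {f g h : ι → ℝ≥0∞}
    (hf : Tendsto f l (𝓝 0)) (hg : Tendsto g l (𝓝 0)) (hle : ∀ᶠ i in l, h i ≤ f i + g i) :
    Tendsto h l (𝓝 0) := by
  refine tendsto_of_tendsto_of_tendsto_of_le_of_le' tendsto_const_nhds ?_
    (Eventually.of_forall fun _ => zero_le) hle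
  simpa using hf.add hg

lemma tendsto_ennreal_zero_mul {ι : Type*} {l : Filter ι} {f h : ι → ℝ≥0∞} (c : ℝ)
    (hf : Tendsto f l (𝓝 0)) (hle : ∀ᶠ i in l, h i ≤ ENNReal.ofReal c * f i) :
    Tendsto h l (𝓝 0) := by
  refine tendsto_of_tendsto_of_tendsto_of_le_of_le' tendsto_const_nhds ?_
    (Eventually.of_forall fun _ => zero_le) hle
  simpa using ENNReal.Tendsto.const_mul hf (Or.inr (ENNReal.ofReal_ne_top (r := c)))

namespace MemL2ul

variable {f g : ℝ → ℝ}

lemma congr_ae (h : MemL2ul f) (hfg : f =ᵐ[volume] g) : MemL2ul g := by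
  refine ⟨h.1.congr hfg, by rw [← l2ulNorm_congr_ae hfg]; exact h.2.1, h.2.2.congr fun ξ => ?_⟩
  refine l2ulNorm_congr_ae ?_
  have := (measurePreserving_sub_right volume ξ).quasiMeasurePreserving.ae_eq_comp hfg
  filter_upwards [hfg, this] with x h1 h2
  simp only [Function.comp] at h2
  rw [h1, h2]

lemma aesm_sub_right (h : MemL2ul f) (ξ : ℝ) : AEStronglyMeasurable (fun x => f (x - ξ)) volume :=
  h.1.comp_measurePreserving (measurePreserving_sub_right volume ξ)

lemma aesm_add_left (h : MemL2ul f) (ξ : ℝ) : AEStronglyMeasurable (fun x => f (ξ + x)) volume :=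
  h.1.comp_measurePreserving (measurePreserving_add_left volume ξ)

lemma add (hf : MemL2ul f) (hg : MemL2ul g) : MemL2ul (fun x => f x + g x) := by
  refine ⟨hf.1.add hg.1, (l2ulNorm_add_le hf.1 hg.1).trans_lt (ENNReal.add_lt_top.2 ⟨hf.2.1, hg.2.1⟩),
    tendsto_ennreal_zero_add hf.2.2 hg.2.2 (Eventually.of_forall fun ξ => ?_)⟩
  refine le_trans (le_of_eq ?_) (l2ulNorm_add_le ((hf.aesm_sub_right ξ).sub hf.1)
    ((hg.aesm_sub_right ξ).sub hg.1))
  congr 1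
  ext x
  ring

/-- Post-composition with a map that is Lipschitz on the range of `f` and bounded there. -/
lemma of_le (hf : MemL2ul f) (hg : AEStronglyMeasurable g volume) (hfin : l2ulNorm g < ⊤) {c : ℝ}
    (h : ∀ x y, |g x - g y| ≤ c * |f x - f y|) : MemL2ul g :=
  ⟨hg, hfin, tendsto_ennreal_zero_mul c hf.2.2
    (Eventually.of_forall fun _ => l2ulNorm_le_mul fun _ => h _ _)⟩

lemma const_mul (hf : MemL2ul f) (c : ℝ) : MemL2ul (fun x => c * f x) :=
  hf.of_le (hf.1.const_mul c) ((l2ulNorm_const_mul c f).trans_lt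
    (ENNReal.mul_lt_top ENNReal.ofReal_lt_top hf.2.1)) (c := |c|)
    (fun x y => by rw [← mul_sub, abs_mul])

lemma sub (hf : MemL2ul f) (hg : MemL2ul g) : MemL2ul (fun x => f x - g x) := by
  simpa [sub_eq_add_neg] using hf.add (hg.const_mul (-1))

lemma shift (hf : MemL2ul f) (ξ : ℝ) : MemL2ul (fun x => f (ξ + x)) := by
  refine ⟨hf.aesm_add_left ξ, by rw [l2ulNorm_shift]; exact hf.2.1, hf.2.2.congr fun η => ?_⟩
  rw [← l2ulNorm_shift _ ξ]
  simp only [add_sub_assoc]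

lemma memLp_mul (hf : MemL2ul f) {κ : ℝ} (hκ : κ ≠ 0) {m : ℝ → ℝ} (hm : Continuous m) {c : ℝ}
    (h : ∀ x, |m x| ≤ c * wt κ x) : MemLp (fun x => m x * f x) 2 volume := by
  obtain ⟨C, hC0, hC⟩ := exists_wNorm_le hκ
  have h1 : MemLp (fun x => wt κ x * f x) 2 volume :=
    ⟨(continuous_wt κ).aestronglyMeasurable.mul hf.1, (hC f hf.1).trans_lt
      (ENNReal.mul_lt_top ENNReal.ofReal_lt_top hf.2.1)⟩
  refine MemLp.of_le_mul (c := c) h1 (hm.aestronglyMeasurable.mul hf.1) (ae_of_all _ fun x => ?_)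
  rw [norm_mul, norm_mul, ← mul_assoc, Real.norm_of_nonneg (wt_pos κ x).le]
  exact mul_le_mul_of_nonneg_right (h x) (norm_nonneg _)

lemma memLp_wt_mul (hf : MemL2ul f) {κ : ℝ} (hκ : κ ≠ 0) :
    MemLp (fun x => wt κ x * f x) 2 volume :=
  hf.memLp_mul hκ (continuous_wt κ) (c := 1)
    fun x => by rw [one_mul, abs_of_pos (wt_pos κ x)]

lemma memLp_deriv_wt_mul (hf : MemL2ul f) {κ : ℝ} (hκ : 0 < κ) :
    MemLp (fun x => deriv (wt κ) x * f x) 2 volume :=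
  hf.memLp_mul hκ.ne' (continuous_deriv_wt κ) (c := κ) (abs_deriv_wt_le hκ.le)

lemma integrable_wt_sq (hf : MemL2ul f) (hg : MemL2ul g) {κ : ℝ} (hκ : κ ≠ 0) :
    Integrable (fun x => wt κ x ^ 2 * (f x * g x)) := by
  refine ((hf.memLp_wt_mul hκ).integrable_mul (hg.memLp_wt_mul hκ)).congr
    (ae_of_all _ fun x => ?_)
  simp only [Pi.mul_apply]
  ring

lemma integrable_wt_deriv (hf : MemL2ul f) (hg : MemL2ul g) {κ : ℝ} (hκ : 0 < κ) :
    Integrable (fun x => wt κ x * deriv (wt κ) x * (f x * g x)) := by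
  refine ((hf.memLp_wt_mul hκ.ne').integrable_mul (hg.memLp_deriv_wt_mul hκ)).congr
    (ae_of_all _ fun x => ?_)
  simp only [Pi.mul_apply]
  ring

/-- The quotient of a test function by the smooth positive weight is again a test function, so the
product is that of two L² functions. -/
lemma integrable_mul_test (hf : MemL2ul f) {φ : ℝ → ℝ} (hφ : IsTestFunction φ) :
    Integrable (fun x => f x * φ x) := by
  have h1 : IsTestFunction (fun x => (1 + (1 * x) ^ 2) * φ x) := hφ.mul_left (by fun_prop)
  refine ((hf.memLp_wt_mul one_ne_zero).integrable_mul h1.memLp).congr (ae_of_all _ fun x => ?_)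
  simp only [Pi.mul_apply, wt]
  field_simp

end MemL2ul

/-! ### Paths in the uniformly local space -/

lemma memL2ul_const (c : ℝ) : MemL2ul (fun _ => c) := by
  refine ⟨aestronglyMeasurable_const, (l2ulNorm_le_of_bound (c := |c|) fun _ => le_rfl).trans_lt
    ENNReal.ofReal_lt_top, ?_⟩
  refine tendsto_const_nhds.congr fun ξ => ?_
  refine (le_antisymm ((l2ulNorm_le_of_bound (c := 0) fun x => ?_).trans (by simp))
    zero_le).symm
  simp

/-- Paths that are continuous in the uniformly local `L²` norm at all positive times. -/
structure UlPath (f : ℝ → ℝ → ℝ) : Prop where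
  mem : ∀ t > 0, MemL2ul (f t)
  cont : ∀ t > 0, Tendsto (fun s => l2ulNorm (fun x => f s x - f t x)) (𝓝 t) (𝓝 0)

lemma eventually_pos_nhds {t : ℝ} (ht : 0 < t) : ∀ᶠ s in 𝓝 t, 0 < s := lt_mem_nhds ht

namespace UlPath

variable {f g : ℝ → ℝ → ℝ}

lemma add (hf : UlPath f) (hg : UlPath g) : UlPath (fun t x => f t x + g t x) := by
  refine ⟨fun t ht => (hf.mem t ht).add (hg.mem t ht), fun t ht =>
    tendsto_ennreal_zero_add (hf.cont t ht) (hg.cont t ht) ?_⟩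
  filter_upwards [eventually_pos_nhds ht] with s hs
  refine le_trans (le_of_eq ?_) (l2ulNorm_add_le ((hf.mem s hs).1.sub (hf.mem t ht).1)
    ((hg.mem s hs).1.sub (hg.mem t ht).1))
  congr 1
  ext x
  ring

lemma const_mul (hf : UlPath f) (c : ℝ) : UlPath (fun t x => c * f t x) := by
  refine ⟨fun t ht => (hf.mem t ht).const_mul c, fun t ht =>
    tendsto_ennreal_zero_mul |c| (hf.cont t ht) (Eventually.of_forall fun s => ?_)⟩
  exact l2ulNorm_le_mul fun x => by rw [← mul_sub, abs_mul]

lemma sub (hf : UlPath f) (hg : UlPath g) : UlPath (fun t x => f t x - g t x) := by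
  simpa [sub_eq_add_neg] using hf.add (hg.const_mul (-1))

lemma shift (hf : UlPath f) {k : ℝ} (hk : 0 ≤ k) (ξ : ℝ) : UlPath (fun t x => f (t + k) (ξ + x)) := by
  refine ⟨fun t ht => (hf.mem _ (by positivity)).shift ξ, fun t ht => ?_⟩
  have h1 : Tendsto (fun s : ℝ => s + k) (𝓝 t) (𝓝 (t + k)) :=
    (continuous_id.add continuous_const).tendsto t
  refine ((hf.cont (t + k) (by positivity)).comp h1).congr fun s => ?_
  exact (l2ulNorm_shift _ ξ).symm

end UlPath

/-! ### Weighted embedding into L²(ℝ) and weighted transport equations -/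

open Classical in
/-- The class of `m f` in `L²(ℝ)`, for functions `f` for which `m f` is square integrable. -/
noncomputable def mulL2 (m f : ℝ → ℝ) : L2R :=
  if h : MemLp (fun x => m x * f x) 2 volume then h.toLp _ else 0

lemma mulL2_eq {m f : ℝ → ℝ} (h : MemLp (fun x => m x * f x) 2 volume) :
    mulL2 m f = h.toLp _ := dif_pos h

lemma coeFn_mulL2 {m f : ℝ → ℝ} (h : MemLp (fun x => m x * f x) 2 volume) :
    mulL2 m f =ᵐ[volume] fun x => m x * f x := by
  rw [mulL2_eq h]
  exact h.coeFn_toLp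

lemma inner_mulL2_test {m f φ : ℝ → ℝ} (h : MemLp (fun x => m x * f x) 2 volume)
    (hφ : IsTestFunction φ) : inner ℝ (mulL2 m f) hφ.toL2 = ∫ x, f x * (m x * φ x) := by
  rw [mulL2_eq h, IsTestFunction.inner_toLp]
  congr 1
  ext x
  ring

lemma inner_mulL2 {m n f g : ℝ → ℝ} (h : MemLp (fun x => m x * f x) 2 volume)
    (h' : MemLp (fun x => n x * g x) 2 volume) :
    inner ℝ (mulL2 m f) (mulL2 n g) = ∫ x, m x * n x * (f x * g x) := by
  rw [L2.inner_def]
  refine integral_congr_ae ?_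
  filter_upwards [coeFn_mulL2 h, coeFn_mulL2 h'] with x h1 h2
  rw [h1, h2]
  simp
  ring

lemma norm_mulL2_sub {m f g : ℝ → ℝ} (hf : MemLp (fun x => m x * f x) 2 volume)
    (hg : MemLp (fun x => m x * g x) 2 volume) :
    ‖mulL2 m f - mulL2 m g‖ = (eLpNorm (fun x => m x * (f x - g x)) 2 volume).toReal := by
  rw [mulL2_eq hf, mulL2_eq hg, ← MemLp.toLp_sub, Lp.norm_toLp]
  congr 2
  ext x
  simp only [Pi.sub_apply]
  ring

lemma UlPath.continuousOn_mulL2 {f : ℝ → ℝ → ℝ} (hf : UlPath f) {κ : ℝ} (hκ : κ ≠ 0) {m : ℝ → ℝ}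
    (hm : Continuous m) {c : ℝ} (h : ∀ x, |m x| ≤ c * wt κ x) :
    ContinuousOn (fun t => mulL2 m (f t)) (Ioi 0) := by
  intro t ht
  have ht : 0 < t := ht
  refine ContinuousAt.continuousWithinAt ?_
  rw [ContinuousAt, tendsto_iff_norm_sub_tendsto_zero]
  obtain ⟨C, hC0, hC⟩ := exists_wNorm_le hκ
  have h1 : Tendsto (fun s => eLpNorm (fun x => m x * (f s x - f t x)) 2 volume) (𝓝 t) (𝓝 0) := by
    refine tendsto_ennreal_zero_mul (c * C) (hf.cont t ht) ?_
    filter_upwards [eventually_pos_nhds ht] with s hs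
    have hc : 0 ≤ c := by
      by_contra hc
      nlinarith [h 0, abs_nonneg (m 0), wt_pos κ 0]
    rw [ENNReal.ofReal_mul hc, mul_assoc]
    refine le_trans ?_ (mul_le_mul_right (hC _ ((hf.mem s hs).1.sub (hf.mem t ht).1)) _)
    refine eLpNorm_le_mul_eLpNorm_of_ae_le_mul (ae_of_all _ fun x => ?_) 2
    rw [norm_mul, norm_mul, ← mul_assoc, Real.norm_of_nonneg (wt_pos κ x).le]
    exact mul_le_mul_of_nonneg_right (h x) (norm_nonneg _)
  have h2 := (ENNReal.tendsto_toReal ENNReal.zero_ne_top).comp h1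
  refine h2.congr' ?_
  filter_upwards [eventually_pos_nhds ht] with s hs
  exact (norm_mulL2_sub ((hf.mem s hs).memLp_mul hκ hm h) ((hf.mem t ht).memLp_mul hκ hm h)).symm

/-- `f` solves `f_t = c f_x + g` weakly at all positive times. -/
structure WeakTransport (c : ℝ) (f g : ℝ → ℝ → ℝ) : Prop where
  path : UlPath f
  source : UlPath g
  eq : ∀ φ, IsTestFunction φ → ∀ t > 0, HasDerivAt (fun s => ∫ x, f s x * φ x)
    (-c * (∫ x, f t x * deriv φ x) + ∫ x, g t x * φ x) t

/-- Testing with wt·φ moves the weight onto f. The commutator of the weight with c ∂ₓ contributes -c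
wt' f to the source, which is again in L² because |wt'| ≤ κ wt. -/
lemma WeakTransport.weak_hasDerivAt_mulL2 {c κ : ℝ} (hκ : 0 < κ) {f g : ℝ → ℝ → ℝ}
    (h : WeakTransport c f g) {φ : ℝ → ℝ} (hφ : IsTestFunction φ) {t : ℝ} (ht : 0 < t) :
    HasDerivAt (fun s => inner ℝ (mulL2 (wt κ) (f s)) hφ.toL2)
      (-c * inner ℝ (mulL2 (wt κ) (f t)) hφ.deriv.toL2 +
        inner ℝ (mulL2 (wt κ) (g t) - c • mulL2 (deriv (wt κ)) (f t)) hφ.toL2) t := by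
  have hψ := hφ.mul_left (contDiff_wt κ)
  have hd : ∀ x, deriv (fun x => wt κ x * φ x) x = deriv (wt κ) x * φ x + wt κ x * deriv φ x :=
    fun x => (((hasDerivAt_wt κ x).differentiableAt.hasDerivAt).mul
      (hφ.differentiable x).hasDerivAt).deriv
  have h1 := h.eq _ hψ t ht
  refine (h1.congr_of_eventuallyEq ?_).congr_deriv ?_
  · filter_upwards [eventually_pos_nhds ht] with s hs
    exact inner_mulL2_test ((h.path.mem s hs).memLp_wt_mul hκ.ne') hφ
  · have hf := h.path.mem t ht
    rw [inner_sub_left, inner_smul_left, inner_mulL2_test (hf.memLp_wt_mul hκ.ne'),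
      inner_mulL2_test ((h.source.mem t ht).memLp_wt_mul hκ.ne'),
      inner_mulL2_test (hf.memLp_deriv_wt_mul hκ)]
    have i1 := hf.integrable_mul_test (hφ.deriv.mul_left (contDiff_wt κ))
    have i2 : Integrable fun x => f t x * (deriv (wt κ) x * φ x) :=
      hf.integrable_mul_test (hφ.mul_left ((contDiff_wt κ (n := ∞)).iterate_deriv 1))
    have : ∫ x, f t x * deriv (fun x => wt κ x * φ x) x =
        (∫ x, f t x * (deriv (wt κ) x * φ x)) + ∫ x, f t x * (wt κ x * deriv φ x) := by
      rw [← integral_add i2 i1]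
      congr 1
      ext x
      rw [hd]
      ring
    rw [this]
    simp
    ring

/-- Product rule for two weak solutions of transport equations with the same speed. -/
lemma WeakTransport.hasDerivAt_integral_mul {c κ : ℝ} (hκ : 0 < κ) {f g f' g' : ℝ → ℝ → ℝ}
    (h : WeakTransport c f g) (h' : WeakTransport c f' g') {t : ℝ} (ht : 0 < t) :
    HasDerivAt (fun t => ∫ x, wt κ x ^ 2 * (f t x * f' t x))
      ((∫ x, wt κ x ^ 2 * (f t x * g' t x)) + (∫ x, wt κ x ^ 2 * (g t x * f' t x))
        - 2 * c * ∫ x, wt κ x * deriv (wt κ) x * (f t x * f' t x)) t := by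
  have hw : ∀ x, |wt κ x| ≤ 1 * wt κ x := fun x => by rw [one_mul, abs_of_pos (wt_pos κ x)]
  have hc := fun {f : ℝ → ℝ → ℝ} (hf : UlPath f) => hf.continuousOn_mulL2 hκ.ne' (continuous_wt κ) hw
  have hc' := fun {f : ℝ → ℝ → ℝ} (hf : UlPath f) =>
    hf.continuousOn_mulL2 hκ.ne' (continuous_deriv_wt κ) (abs_deriv_wt_le hκ.le)
  have key := hasDerivAt_inner_of_weak_transport (c := c) isOpen_Ioi (mem_Ioi.2 ht) (hc h.path)
    ((hc h.source).sub ((hc' h.path).const_smul c)) (hc h'.path)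
    ((hc h'.source).sub ((hc' h'.path).const_smul c))
    (fun φ hφ t ht => h.weak_hasDerivAt_mulL2 hκ hφ ht)
    (fun φ hφ t ht => h'.weak_hasDerivAt_mulL2 hκ hφ ht)
  have m := fun {f : ℝ → ℝ} (hf : MemL2ul f) => hf.memLp_wt_mul hκ.ne'
  have m' := fun {f : ℝ → ℝ} (hf : MemL2ul f) => hf.memLp_deriv_wt_mul hκ
  refine (key.congr_of_eventuallyEq ?_).congr_deriv ?_
  · filter_upwards [eventually_pos_nhds ht] with s hs
    rw [inner_mulL2 (m (h.path.mem s hs)) (m (h'.path.mem s hs))]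
    simp only [sq]
  · have a1 := h.path.mem t ht
    have a2 := h'.path.mem t ht
    have a3 := h.source.mem t ht
    have a4 := h'.source.mem t ht
    simp only [Pi.sub_apply, Pi.smul_apply]
    rw [inner_sub_right, inner_sub_left, inner_smul_left, inner_smul_right,
      inner_mulL2 (m a1) (m a4), inner_mulL2 (m a1) (m' a2), inner_mulL2 (m a3) (m a2),
      inner_mulL2 (m' a1) (m a2)]
    simp only [sq, mul_comm (deriv (wt κ) _) (wt κ _), conj_trivial]
    ring

/-! ### Weak derivatives in one dimension -/

lemma IsTestFunction.exists_support_subset {φ : ℝ → ℝ} (hφ : IsTestFunction φ) :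
    ∃ R > 0, ∀ x, x ∉ Ioo (-R) R → φ x = 0 := by
  obtain ⟨R, hR⟩ := hφ.2.isCompact.isBounded.subset_ball 0
  refine ⟨max R 1, by positivity, fun x hx => image_eq_zero_of_notMem_tsupport fun h => hx ?_⟩
  have := hR h
  rw [Real.ball_eq_Ioo, zero_sub, zero_add] at this
  exact Ioo_subset_Ioo (neg_le_neg (le_max_left _ _)) (le_max_left _ _) this

lemma IsTestFunction.integrable {φ : ℝ → ℝ} (hφ : IsTestFunction φ) : Integrable φ :=
  hφ.continuous.integrable_of_hasCompactSupport hφ.2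

lemma integral_eq_intervalIntegral {f : ℝ → ℝ} {R : ℝ} (hR : 0 < R)
    (h : ∀ x, x ∉ Ioo (-R) R → f x = 0) : ∫ x, f x = ∫ x in (-R)..R, f x := by
  rw [intervalIntegral.integral_of_le (by linarith), setIntegral_eq_integral_of_forall_compl_eq_zero]
  exact fun x hx => h x fun h' => hx (Ioo_subset_Ioc_self h')

lemma IsTestFunction.exists_primitive {θ : ℝ → ℝ} (hθ : IsTestFunction θ) (h0 : ∫ x, θ x = 0) :
    ∃ ψ, IsTestFunction ψ ∧ deriv ψ = θ := by
  obtain ⟨R, hR, hsupp⟩ := hθ.exists_support_subset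
  have hd : ∀ x, HasDerivAt (fun x => ∫ y in (-R)..x, θ y) (θ x) x := fun x =>
    (hθ.continuous.integral_hasStrictDerivAt (-R) x).hasDerivAt
  have hderiv : deriv (fun x => ∫ y in (-R)..x, θ y) = θ := funext fun x => (hd x).deriv
  refine ⟨fun x => ∫ y in (-R)..x, θ y, ⟨?_, ?_⟩, hderiv⟩
  · rw [contDiff_infty_iff_deriv, hderiv]
    exact ⟨fun x => (hd x).differentiableAt, hθ.1⟩
  · refine HasCompactSupport.of_support_subset_isCompact (isCompact_Icc (a := -R) (b := R)) ?_
    intro x hx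
    by_contra hxR
    refine hx ?_
    rcases lt_or_ge x (-R) with h | h
    · refine (intervalIntegral.integral_congr (g := fun _ => 0) fun y hy => ?_).trans (by simp)
      rw [uIcc_of_ge h.le] at hy
      exact hsupp y fun h' => absurd h'.1 (not_lt.2 hy.2)
    · have hxR' : R < x := by
        by_contra h'
        exact hxR ⟨h, not_lt.1 h'⟩
      have e1 : ∫ y in R..x, θ y = 0 := by
        refine (intervalIntegral.integral_congr (g := fun _ => 0) fun y hy => ?_).trans (by simp)
        rw [uIcc_of_le hxR'.le] at hy
        exact hsupp y fun h' => absurd h'.2 (not_lt.2 hy.1)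
      have e2 := intervalIntegral.integral_add_adjacent_intervals
        (hθ.continuous.intervalIntegrable (μ := volume) (-R) R) (hθ.continuous.intervalIntegrable R x)
      rw [e1, add_zero, ← integral_eq_intervalIntegral hR hsupp, h0] at e2
      exact e2.symm

lemma MeasureTheory.LocallyIntegrable.integrable_mul_test {f φ : ℝ → ℝ} (hf : LocallyIntegrable f)
    (hφ : IsTestFunction φ) : Integrable (fun x => f x * φ x) := by
  simpa [mul_comm] using hf.integrable_smul_left_of_hasCompactSupport hφ.continuous hφ.2

lemma MeasureTheory.LocallyIntegrable.intervalIntegrable' {f : ℝ → ℝ} (hf : LocallyIntegrable f)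
    (x y : ℝ) : IntervalIntegrable f volume x y :=
  (hf.integrableOn_isCompact isCompact_uIcc).intervalIntegrable

/-- A locally integrable function whose weak derivative vanishes is constant. -/
lemma ae_eq_const_of_integral_mul_deriv_eq_zero {f : ℝ → ℝ} (hf : LocallyIntegrable f)
    (h : ∀ φ, IsTestFunction φ → ∫ x, f x * deriv φ x = 0) : ∃ c, f =ᵐ[volume] fun _ => c := by
  obtain ⟨b⟩ : Nonempty (ContDiffBump (0 : ℝ)) := ⟨⟨1, 2, by norm_num, by norm_num⟩⟩
  set ρ : ℝ → ℝ := b.normed volume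
  have hρ : IsTestFunction ρ := ⟨b.contDiff_normed, b.hasCompactSupport_normed⟩
  have hρ1 : ∫ x, ρ x = 1 := b.integral_normed
  refine ⟨∫ x, f x * ρ x, ae_eq_of_integral_contDiff_smul_eq hf (locallyIntegrable_const _) ?_⟩
  intro φ hφ1 hφ2
  have hφ : IsTestFunction φ := ⟨hφ1, hφ2⟩
  -- Removing the multiple of ρ with the same mean leaves a function of zero integral, hence the
  -- derivative of a test function, against which f integrates to zero. Thus f acts on φ as the
  -- constant ∫ f ρ.
  obtain ⟨ψ, hψ, hψ'⟩ := (hφ.add (hρ.const_mul (-∫ x, φ x))).exists_primitive (by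
    rw [integral_add hφ.integrable (hρ.const_mul _).integrable, integral_const_mul, hρ1]
    ring)
  have h1 := h ψ hψ
  rw [hψ'] at h1
  simp only [mul_add] at h1
  have e : ∀ x, f x * ((-∫ x, φ x) * ρ x) = (-∫ x, φ x) * (f x * ρ x) := fun x => by ring
  simp only [e] at h1
  rw [integral_add (hf.integrable_mul_test hφ) ((hf.integrable_mul_test hρ).const_mul _),
    integral_const_mul] at h1
  simp only [smul_eq_mul, integral_mul_const]
  simp only [mul_comm (φ _) (f _)]
  linarith

namespace HasWeakDeriv

variable {f g f' g' : ℝ → ℝ}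

lemma ae_unique (h : HasWeakDeriv f g) (h' : HasWeakDeriv f g') : g =ᵐ[volume] g' := by
  refine ae_eq_of_integral_contDiff_smul_eq h.2.1 h'.2.1 fun φ hφ1 hφ2 => ?_
  have := (h.2.2 φ ⟨hφ1, hφ2⟩).symm.trans (h'.2.2 φ ⟨hφ1, hφ2⟩)
  simpa [mul_comm] using this

lemma weakDeriv_ae_eq (h : HasWeakDeriv f g) : weakDeriv f =ᵐ[volume] g := by
  have hex : ∃ g, HasWeakDeriv f g := ⟨g, h⟩
  have e : weakDeriv f = hex.choose := dif_pos hex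
  rw [e]
  exact hex.choose_spec.ae_unique h

lemma congr_ae (h : HasWeakDeriv f g) (hf : f =ᵐ[volume] f') (hg : g =ᵐ[volume] g') :
    HasWeakDeriv f' g' := by
  refine ⟨h.1.congr hf, h.2.1.congr hg, fun φ hφ => ?_⟩
  rw [← integral_congr_ae (hf.mono fun x hx => ?_), h.2.2 φ hφ, neg_inj]
  · exact integral_congr_ae (hg.mono fun x hx => by simp only [hx])
  · simp only [hx]

lemma sub (h : HasWeakDeriv f g) (h' : HasWeakDeriv f' g') :
    HasWeakDeriv (fun x => f x - f' x) (fun x => g x - g' x) := by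
  refine ⟨h.1.sub h'.1, h.2.1.sub h'.2.1, fun φ hφ => ?_⟩
  simp only [sub_mul]
  rw [integral_sub (h.1.integrable_mul_test hφ.deriv) (h'.1.integrable_mul_test hφ.deriv),
    integral_sub (h.2.1.integrable_mul_test hφ) (h'.2.1.integrable_mul_test hφ),
    h.2.2 φ hφ, h'.2.2 φ hφ]
  ring

end HasWeakDeriv

/-- `u` is a primitive of the locally integrable function `p`. -/
structure IsPrimitive (u p : ℝ → ℝ) : Prop where
  locallyIntegrable : LocallyIntegrable p
  sub_eq : ∀ x y, u y - u x = ∫ z in x..y, p z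

namespace IsPrimitive

variable {u p u' p' : ℝ → ℝ}

lemma intervalIntegrable (h : IsPrimitive u p) (x y : ℝ) : IntervalIntegrable p volume x y :=
  h.locallyIntegrable.intervalIntegrable' x y

lemma continuous (h : IsPrimitive u p) : Continuous u := by
  have : u = fun y => u 0 + ∫ z in (0 : ℝ)..y, p z := by
    ext y
    rw [← h.sub_eq]
    ring
  rw [this]
  exact continuous_const.add (intervalIntegral.continuous_primitive h.intervalIntegrable 0)

lemma sub (h : IsPrimitive u p) (h' : IsPrimitive u' p') :
    IsPrimitive (fun x => u x - u' x) (fun x => p x - p' x) := by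
  refine ⟨h.1.sub h'.1, fun x y => ?_⟩
  rw [intervalIntegral.integral_sub (h.intervalIntegrable _ _) (h'.intervalIntegrable _ _),
    ← h.sub_eq, ← h'.sub_eq]
  ring

lemma shift (h : IsPrimitive u p) (ξ : ℝ) :
    IsPrimitive (fun x => u (ξ + x)) (fun x => p (ξ + x)) := by
  refine ⟨?_, fun x y => ?_⟩
  · rw [locallyIntegrable_iff]
    intro k hk
    have hmp : MeasurePreserving (fun x : ℝ => ξ + x) volume volume :=
      measurePreserving_add_left volume ξ
    have := (h.1.integrableOn_isCompact (hk.image (f := fun x => ξ + x) (by fun_prop)))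
    rw [hmp.integrableOn_image (measurableEmbedding_addLeft ξ)] at this
    exact this
  · rw [h.sub_eq, intervalIntegral.integral_comp_add_left (fun z => p z) ξ]

/-- Integration by parts for absolutely continuous functions, on an interval whose complement misses
both the test function and its derivative. -/
lemma hasWeakDeriv (h : IsPrimitive u p) : HasWeakDeriv u p := by
  refine ⟨h.continuous.locallyIntegrable, h.1, fun φ hφ => ?_⟩
  obtain ⟨R, hR, hsupp⟩ := hφ.exists_support_subset
  obtain ⟨R', hR', hsupp'⟩ := hφ.deriv.exists_support_subset
  set S := max R R' with hS
  have hS0 : 0 < S := lt_max_of_lt_left hR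
  have hs : ∀ x, x ∉ Ioo (-S) S → φ x = 0 := fun x hx => hsupp x fun h' => hx
    (Ioo_subset_Ioo (neg_le_neg (le_max_left _ _)) (le_max_left _ _) h')
  have hs' : ∀ x, x ∉ Ioo (-S) S → deriv φ x = 0 := fun x hx => hsupp' x fun h' => hx
    (Ioo_subset_Ioo (neg_le_neg (le_max_right _ _)) (le_max_right _ _) h')
  rw [integral_eq_intervalIntegral hS0 (fun x hx => by rw [hs' x hx, mul_zero]),
    integral_eq_intervalIntegral hS0 (fun x hx => by rw [hs x hx, mul_zero])]
  have hac : AbsolutelyContinuousOnInterval (fun x => ∫ z in (-S)..x, p z) (-S) S :=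
    (h.intervalIntegrable (-S) S).absolutelyContinuousOnInterval_intervalIntegral (by simp)
  have hφac : AbsolutelyContinuousOnInterval φ (-S) S :=
    ContDiffOn.absolutelyContinuousOnInterval ((hφ.1.of_le (by simp)).contDiffOn)
  have key := hac.integral_mul_deriv_eq_deriv_mul hφac
  rw [hs S (by simp), hs (-S) (by simp)] at key
  have e1 : ∫ x in (-S)..S, deriv (fun x => ∫ z in (-S)..x, p z) x * φ x
      = ∫ x in (-S)..S, p x * φ x := by
    refine intervalIntegral.integral_congr_ae ?_
    filter_upwards [LocallyIntegrable.ae_hasDerivAt_integral h.1] with x hx _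
    rw [(hx (-S)).deriv]
  have e2 : ∫ x in (-S)..S, deriv φ x = 0 := by
    rw [intervalIntegral.integral_deriv_eq_sub (fun x _ => hφ.differentiable x)
      (hφ.deriv.continuous.intervalIntegrable _ _), hs S (by simp), hs (-S) (by simp), sub_zero]
  have e3 : ∫ x in (-S)..S, u x * deriv φ x = ∫ x in (-S)..S,
      (u (-S) * deriv φ x + (∫ z in (-S)..x, p z) * deriv φ x) := by
    congr 1
    ext x
    rw [← h.sub_eq]
    ring
  rw [e3, intervalIntegral.integral_add, intervalIntegral.integral_const_mul, e2, key, e1]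
  · ring
  · exact (continuous_const.mul hφ.deriv.continuous).intervalIntegrable _ _
  · exact ((intervalIntegral.continuous_primitive h.intervalIntegrable (-S)).mul
      hφ.deriv.continuous).intervalIntegrable _ _

/-- One-dimensional Sobolev embedding: average u(x) = u(y) - ∫ p over y in [x, x+1]. The window has
measure one, so L¹ norms are bounded by L² norms without a constant. -/
lemma enorm_le (h : IsPrimitive u p) (x : ℝ) :
    ‖u x‖ₑ ≤ l2Norm (Icc x (x + 1)) u + l2Norm (Icc x (x + 1)) p := by
  have hprob : IsProbabilityMeasure (volume.restrict (Icc x (x + 1))) := ⟨by simp⟩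
  have h1 : ∀ y ∈ Icc x (x + 1), ‖u x‖ₑ ≤ ‖u y‖ₑ + ∫⁻ z in Icc x (x + 1), ‖p z‖ₑ := by
    intro y hy
    have e : u x = u y - ∫ z in x..y, p z := by rw [← h.sub_eq]; ring
    rw [e]
    refine (enorm_sub_le).trans (add_le_add le_rfl ?_)
    rw [intervalIntegral.integral_of_le hy.1]
    refine (enorm_integral_le_lintegral_enorm _).trans (lintegral_mono_set ?_)
    exact fun z hz => ⟨hz.1.le, hz.2.trans hy.2⟩
  have h2 : ‖u x‖ₑ ≤ ∫⁻ y in Icc x (x + 1), (‖u y‖ₑ + ∫⁻ z in Icc x (x + 1), ‖p z‖ₑ) := by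
    calc ‖u x‖ₑ = ∫⁻ y in Icc x (x + 1), ‖u x‖ₑ := by simp
      _ ≤ _ := setLIntegral_mono' measurableSet_Icc h1
  rw [lintegral_add_right _ measurable_const, lintegral_const, measure_univ, mul_one,
    ← eLpNorm_one_eq_lintegral_enorm, ← eLpNorm_one_eq_lintegral_enorm] at h2
  refine h2.trans (add_le_add ?_ ?_)
  · exact eLpNorm_le_eLpNorm_of_exponent_le (by norm_num)
      h.continuous.aestronglyMeasurable
  · exact eLpNorm_le_eLpNorm_of_exponent_le (by norm_num)
      h.1.aestronglyMeasurable.restrict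

/-- The pairing is a convolution with the reflected test function. Thus s ↦ u(s + ·) is a weakly
differentiable curve with velocity p(s + ·), and increments in space obey the same mean value
inequality as increments in time. -/
lemma hasDerivAt_integral_shift (h : IsPrimitive u p) {φ : ℝ → ℝ} (hφ : IsTestFunction φ) (s : ℝ) :
    HasDerivAt (fun s => ∫ x, u (s + x) * φ x) (∫ x, p (s + x) * φ x) s := by
  have hφ' : IsTestFunction (fun x => φ (-x)) :=
    ⟨hφ.1.comp (by fun_prop), hφ.2.comp_homeomorph (Homeomorph.neg ℝ)⟩
  have key := hφ'.2.hasDerivAt_convolution_right (ContinuousLinearMap.mul ℝ ℝ)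
    h.continuous.locallyIntegrable (μ := volume) (hφ'.1.of_le (by simp)) s
  have e0 : ∀ (g : ℝ → ℝ) (s : ℝ), ∫ x, u (s + x) * g x = ∫ x, u x * g (x - s) := fun g s => by
    rw [← integral_add_left_eq_self (fun x => u x * g (x - s)) s]
    simp
  refine (key.congr_of_eventuallyEq (Eventually.of_forall fun r => ?_)).congr_deriv ?_
  · rw [e0]
    simp [convolution]
  · have hψ := hφ.comp_add (-s)
    have := h.hasWeakDeriv.2.2 _ hψ
    simp only [convolution, ContinuousLinearMap.mul_apply', deriv_comp_neg, neg_sub, mul_neg]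
    rw [integral_neg, neg_eq_iff_eq_neg]
    have e1 : ∀ x, deriv (fun x => φ (x + -s)) x = deriv φ (x - s) := fun x => by
      rw [deriv_comp_add_const, sub_eq_add_neg]
    simp only [e1] at this
    rw [this, ← integral_add_left_eq_self _ s]
    simp

end IsPrimitive

/-- A weakly differentiable function has an absolutely continuous representative. -/
lemma HasWeakDeriv.exists_isPrimitive {f g : ℝ → ℝ} (h : HasWeakDeriv f g) :
    ∃ u, f =ᵐ[volume] u ∧ IsPrimitive u g := by
  have hG : IsPrimitive (fun x => ∫ z in (0 : ℝ)..x, g z) g := by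
    refine ⟨h.2.1, fun x y => ?_⟩
    rw [intervalIntegral.integral_interval_sub_left] <;>
    exact h.2.1.intervalIntegrable' _ _
  obtain ⟨c, hc⟩ := ae_eq_const_of_integral_mul_deriv_eq_zero
    (h.1.sub hG.continuous.locallyIntegrable) fun φ hφ => by
      have := (h.sub hG.hasWeakDeriv).2.2 φ hφ
      simpa using this
  refine ⟨fun x => c + ∫ z in (0 : ℝ)..x, g z, ?_, h.2.1, fun x y => ?_⟩
  · filter_upwards [hc] with x hx
    simp only [Pi.sub_apply] at hx
    linarith
  · rw [add_sub_add_left_eq_sub, hG.sub_eq]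

/-- Mean value inequality in the uniformly local norm, for weakly differentiable curves. -/
lemma exists_l2ulNorm_sub_le_of_weak_hasDerivAt : ∃ C : ℝ, 0 < C ∧
    ∀ (F G : ℝ → ℝ → ℝ) (g : ℝ → ℝ) (a b M : ℝ), 0 ≤ M → MemL2ul g →
      (∀ s ∈ uIcc a b, MemL2ul (F s)) → (∀ s ∈ uIcc a b, MemL2ul (G s)) →
      (∀ φ, IsTestFunction φ → ∀ s ∈ uIcc a b,
        HasDerivAt (fun s => ∫ x, F s x * φ x) (∫ x, G s x * φ x) s) →
      (∀ᶠ s in 𝓝ˢ (uIcc a b), MemL2ul (F s)) →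
      (∀ s ∈ uIcc a b, l2ulNorm (fun x => G s x - g x) ≤ ENNReal.ofReal M) →
      l2ulNorm (fun x => F b x - F a x - (b - a) * g x) ≤ ENNReal.ofReal (C * M * |b - a|) := by
  obtain ⟨C, hC0, hC⟩ := exists_wNorm_le one_ne_zero
  have hw0 : 0 < (wt 1 1)⁻¹ := inv_pos.2 (wt_pos 1 1)
  refine ⟨(wt 1 1)⁻¹ * C, by positivity, fun F G g a b M hM hg hF hG hd hev hGg => ?_⟩
  -- Each window is moved to the origin, where one fixed weight serves all of them; the constants
  -- therefore do not depend on ξ.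
  refine iSup_le fun ξ => (l2Norm_unit_le_wNorm (κ := 1) _ ξ).trans ?_
  have m := fun {f : ℝ → ℝ} (hf : MemL2ul f) => (hf.shift ξ).memLp_wt_mul one_ne_zero
  have key := norm_sub_le_of_weak_hasDerivAt (F := fun s => mulL2 (wt 1) (fun x => F s (ξ + x)))
    (G := fun s => mulL2 (wt 1) (fun x => G s (ξ + x))) (a := a) (b := b) (M := C * M)
    (mulL2 (wt 1) (fun x => g (ξ + x))) (fun φ hφ t ht => ?_) (fun t ht => ?_)
  · have hfin := ((hF b right_mem_uIcc).sub (hF a left_mem_uIcc)).sub (hg.const_mul (b - a))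
    have e : mulL2 (wt 1) (fun x => F b (ξ + x)) - mulL2 (wt 1) (fun x => F a (ξ + x))
        - (b - a) • mulL2 (wt 1) (fun x => g (ξ + x)) = (m hfin).toLp _ := by
      rw [mulL2_eq (m (hF b right_mem_uIcc)), mulL2_eq (m (hF a left_mem_uIcc)), mulL2_eq (m hg),
        ← MemLp.toLp_sub, ← MemLp.toLp_const_smul, ← MemLp.toLp_sub]
      congr 1
      ext x
      simp
      ring
    simp only [e, Lp.norm_toLp] at key
    have h2 : wNorm 1 (fun x => F b (ξ + x) - F a (ξ + x) - (b - a) * g (ξ + x))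
        ≤ ENNReal.ofReal (C * M * |b - a|) := by
      exact (ENNReal.ofReal_toReal (m hfin).eLpNorm_ne_top).symm.le.trans
        (ENNReal.ofReal_le_ofReal key)
    refine (mul_le_mul_right h2 _).trans ?_
    rw [← ENNReal.ofReal_mul hw0.le]
    simp only [mul_assoc]
    exact le_rfl
  · have hψ : IsTestFunction (fun x => wt 1 (x + -ξ) * φ (x + -ξ)) :=
      (hφ.mul_left (contDiff_wt 1)).comp_add (-ξ)
    have e : ∀ {f : ℝ → ℝ}, MemL2ul f → inner ℝ (mulL2 (wt 1) (fun x => f (ξ + x))) hφ.toL2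
        = ∫ x, f x * (wt 1 (x + -ξ) * φ (x + -ξ)) := by
      intro f hf
      rw [inner_mulL2_test (m hf),
        ← integral_add_left_eq_self (fun x => f x * (wt 1 (x + -ξ) * φ (x + -ξ))) ξ]
      simp
    rw [e (hG t ht)]
    refine (hd _ hψ t ht).congr_of_eventuallyEq ?_
    filter_upwards [hev.filter_mono (nhds_le_nhdsSet ht)] with s hs
    exact e hs
  · rw [norm_mulL2_sub (m (hG t ht)) (m hg)]
    refine ENNReal.toReal_le_of_le_ofReal (by positivity) ?_
    rw [ENNReal.ofReal_mul hC0.le]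
    refine (hC _ (((hG t ht).shift ξ).sub (hg.shift ξ)).1).trans ?_
    rw [l2ulNorm_shift (fun x => G t x - g x) ξ]
    exact mul_le_mul_right (hGg t ht) _

/-! ### Energy identities for the damped wave equation -/

/-- `f` is integrable with integral `I`. -/
def HasInt (f : ℝ → ℝ) (I : ℝ) : Prop := Integrable f ∧ ∫ x, f x = I

namespace HasInt

variable {f g : ℝ → ℝ} {I J : ℝ}

lemma of_integrable (hf : Integrable f) : HasInt f (∫ x, f x) := ⟨hf, rfl⟩

lemma add (hf : HasInt f I) (hg : HasInt g J) : HasInt (fun x => f x + g x) (I + J) :=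
  ⟨hf.1.add hg.1, by rw [integral_add hf.1 hg.1, hf.2, hg.2]⟩

lemma sub (hf : HasInt f I) (hg : HasInt g J) : HasInt (fun x => f x - g x) (I - J) :=
  ⟨hf.1.sub hg.1, by rw [integral_sub hf.1 hg.1, hf.2, hg.2]⟩

lemma const_mul (hf : HasInt f I) (c : ℝ) : HasInt (fun x => c * f x) (c * I) :=
  ⟨hf.1.const_mul c, by rw [integral_const_mul, hf.2]⟩

lemma mono (hf : HasInt f I) (hg : HasInt g J) (h : ∀ x, f x ≤ g x) : I ≤ J := by
  rw [← hf.2, ← hg.2]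
  exact integral_mono hf.1 hg.1 h

lemma eq (hf : HasInt f I) (hg : HasInt g J) (h : ∀ x, f x = g x) : I = J := by
  rw [← hf.2, ← hg.2]
  exact integral_congr_ae (ae_of_all _ h)

end HasInt

/-- A weak solution of `α u_tt + u_t = u_xx - G` at positive times, where `p = u_x` and
`q = u_t`. -/
structure WaveSystem (α : ℝ) (u p q G : ℝ → ℝ → ℝ) : Prop where
  path_u : UlPath u
  path_p : UlPath p
  path_q : UlPath q
  path_G : UlPath G
  prim : ∀ t > 0, IsPrimitive (u t) (p t)
  deriv_u : ∀ φ, IsTestFunction φ → ∀ t > 0,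
    HasDerivAt (fun s => ∫ x, u s x * φ x) (∫ x, q t x * φ x) t
  eq : ∀ φ, IsTestFunction φ → ∀ t > 0, HasDerivAt (fun s => α * ∫ x, q s x * φ x)
    (-(∫ x, p t x * deriv φ x) - (∫ x, q t x * φ x) - ∫ x, G t x * φ x) t

lemma integral_comb_mul_test {f g φ : ℝ → ℝ} (hf : MemL2ul f) (hg : MemL2ul g)
    (hφ : IsTestFunction φ) (a b : ℝ) : ∫ x, (a * f x + b * g x) * φ x
      = a * (∫ x, f x * φ x) + b * ∫ x, g x * φ x := by
  have h1 := (HasInt.of_integrable (hf.integrable_mul_test hφ)).const_mul a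
  have h2 := (HasInt.of_integrable (hg.integrable_mul_test hφ)).const_mul b
  rw [← (h1.add h2).2]
  congr 1
  ext x
  ring

lemma UlPath.comb {f g : ℝ → ℝ → ℝ} (hf : UlPath f) (hg : UlPath g) (a b : ℝ) :
    UlPath (fun t x => a * f t x + b * g t x) := (hf.const_mul a).add (hg.const_mul b)

lemma MemL2ul.comb {f g : ℝ → ℝ} (hf : MemL2ul f) (hg : MemL2ul g) (a b : ℝ) :
    MemL2ul (fun x => a * f x + b * g x) := (hf.const_mul a).add (hg.const_mul b)

namespace WaveSystem

variable {α : ℝ} {u p q G : ℝ → ℝ → ℝ}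

lemma sub {u' p' q' G' : ℝ → ℝ → ℝ} (h : WaveSystem α u p q G) (h' : WaveSystem α u' p' q' G') :
    WaveSystem α (fun t x => u t x - u' t x) (fun t x => p t x - p' t x)
      (fun t x => q t x - q' t x) (fun t x => G t x - G' t x) := by
  have e : ∀ {f g φ : ℝ → ℝ}, MemL2ul f → MemL2ul g → IsTestFunction φ →
      ∫ x, (f x - g x) * φ x = (∫ x, f x * φ x) - ∫ x, g x * φ x := by
    intro f g φ hf hg hφ
    rw [← integral_sub (hf.integrable_mul_test hφ) (hg.integrable_mul_test hφ)]
    simp only [sub_mul]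
  refine ⟨h.path_u.sub h'.path_u, h.path_p.sub h'.path_p, h.path_q.sub h'.path_q,
    h.path_G.sub h'.path_G, fun t ht => (h.prim t ht).sub (h'.prim t ht), fun φ hφ t ht => ?_,
    fun φ hφ t ht => ?_⟩
  · rw [e (h.path_q.mem t ht) (h'.path_q.mem t ht) hφ]
    refine ((h.deriv_u φ hφ t ht).sub (h'.deriv_u φ hφ t ht)).congr_of_eventuallyEq ?_
    filter_upwards [eventually_pos_nhds ht] with s hs
    exact e (h.path_u.mem s hs) (h'.path_u.mem s hs) hφ
  · rw [e (h.path_q.mem t ht) (h'.path_q.mem t ht) hφ,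
      e (h.path_p.mem t ht) (h'.path_p.mem t ht) hφ.deriv,
      e (h.path_G.mem t ht) (h'.path_G.mem t ht) hφ]
    refine (((h.eq φ hφ t ht).sub (h'.eq φ hφ t ht)).congr_of_eventuallyEq ?_).congr_deriv (by ring)
    filter_upwards [eventually_pos_nhds ht] with s hs
    simp only [Pi.sub_apply]
    rw [e (h.path_q.mem s hs) (h'.path_q.mem s hs) hφ]
    ring

lemma shift (h : WaveSystem α u p q G) {k : ℝ} (hk : 0 ≤ k) (ξ : ℝ) :
    WaveSystem α (fun t x => u (t + k) (ξ + x)) (fun t x => p (t + k) (ξ + x))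
      (fun t x => q (t + k) (ξ + x)) (fun t x => G (t + k) (ξ + x)) := by
  have e : ∀ f φ : ℝ → ℝ, ∫ x, f (ξ + x) * φ x = ∫ x, f x * φ (x + -ξ) := by
    intro f φ
    rw [← integral_add_left_eq_self (fun x => f x * φ (x + -ξ)) ξ]
    simp
  refine ⟨h.path_u.shift hk ξ, h.path_p.shift hk ξ, h.path_q.shift hk ξ, h.path_G.shift hk ξ,
    fun t ht => (h.prim _ (by positivity)).shift ξ, fun φ hφ t ht => ?_, fun φ hφ t ht => ?_⟩
  · simp only [e]
    exact (h.deriv_u _ (hφ.comp_add (-ξ)) (t + k) (by positivity)).comp_add_const t k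
  · simp only [e]
    have := (h.eq _ (hφ.comp_add (-ξ)) (t + k) (by positivity)).comp_add_const t k
    simpa only [deriv_comp_add_const] using this

/-- The position solves a transport equation of any speed c, since c u_x can be compensated in the
source. It can therefore be paired with either Riemann invariant. -/
lemma weakTransport_u (h : WaveSystem α u p q G) (c : ℝ) :
    WeakTransport c u (fun t x => 1 * q t x + (-c) * p t x) := by
  refine ⟨h.path_u, h.path_q.comb h.path_p _ _, fun φ hφ t ht => ?_⟩
  refine (h.deriv_u φ hφ t ht).congr_deriv ?_
  rw [integral_comb_mul_test (h.path_q.mem t ht) (h.path_p.mem t ht) hφ,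
    (h.prim t ht).hasWeakDeriv.2.2 φ hφ]
  ring

/-- The combinations βq ± p diagonalize the principal part of α q_t = p_x - q - G, p_t = q_x. The
second equation is obtained weakly, by testing u_t = q with φ'. -/
lemma weakTransport_riemann (h : WaveSystem α u p q G) (hα : 0 < α) {β : ℝ} (hβ : β ^ 2 = α)
    {ε : ℝ} (hε : ε ^ 2 = 1) :
    WeakTransport (ε / β) (fun t x => β * q t x + ε * p t x)
      (fun t x => (-β⁻¹) * q t x + (-β⁻¹) * G t x) := by
  have hβ0 : β ≠ 0 := by
    rintro rfl
    norm_num at hβ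
    exact hα.ne hβ
  refine ⟨h.path_q.comb h.path_p _ _, h.path_q.comb h.path_G _ _, fun φ hφ t ht => ?_⟩
  have h1 := (h.eq φ hφ t ht).const_mul β⁻¹
  have h2 := ((h.deriv_u _ hφ.deriv t ht).neg).const_mul ε
  refine ((h1.add h2).congr_of_eventuallyEq ?_).congr_deriv ?_
  · filter_upwards [eventually_pos_nhds ht] with s hs
    simp only [Pi.add_apply, Pi.neg_apply]
    rw [integral_comb_mul_test (h.path_q.mem s hs) (h.path_p.mem s hs) hφ,
      (h.prim s hs).hasWeakDeriv.2.2 φ hφ, ← hβ]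
    field_simp
  · rw [integral_comb_mul_test (h.path_q.mem t ht) (h.path_p.mem t ht) hφ.deriv,
      integral_comb_mul_test (h.path_q.mem t ht) (h.path_G.mem t ht) hφ]
    field_simp
    linear_combination (∫ x, p t x * deriv φ x) * hε

end WaveSystem

/-! ### Weighted bilinear products and quadratic energy identities -/

/-- The weighted product `∫ χ f g`, where `χ = wt²`. -/
noncomputable def wI (κ : ℝ) (f g : ℝ → ℝ) : ℝ := ∫ x, wt κ x ^ 2 * (f x * g x)

/-- The product `∫ (χ' / 2) f g`, where `χ = wt²`. -/
noncomputable def wJ (κ : ℝ) (f g : ℝ → ℝ) : ℝ := ∫ x, wt κ x * deriv (wt κ) x * (f x * g x)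

section Bilinear

variable {κ : ℝ} {f g h : ℝ → ℝ}

lemma hasInt_wI (hκ : 0 < κ) (hf : MemL2ul f) (hg : MemL2ul g) :
    HasInt (fun x => wt κ x ^ 2 * (f x * g x)) (wI κ f g) :=
  HasInt.of_integrable (hf.integrable_wt_sq hg hκ.ne')

lemma hasInt_wJ (hκ : 0 < κ) (hf : MemL2ul f) (hg : MemL2ul g) :
    HasInt (fun x => wt κ x * deriv (wt κ) x * (f x * g x)) (wJ κ f g) :=
  HasInt.of_integrable (hf.integrable_wt_deriv hg hκ)

lemma wI_comm (κ : ℝ) (f g : ℝ → ℝ) : wI κ f g = wI κ g f := by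
  simp only [wI, mul_comm (f _)]

lemma wJ_comm (κ : ℝ) (f g : ℝ → ℝ) : wJ κ f g = wJ κ g f := by
  simp only [wJ, mul_comm (f _)]

lemma wI_comb_left (hκ : 0 < κ) (hf : MemL2ul f) (hg : MemL2ul g) (hh : MemL2ul h) (a b : ℝ) :
    wI κ (fun x => a * f x + b * g x) h = a * wI κ f h + b * wI κ g h :=
  (hasInt_wI hκ (hf.comb hg a b) hh).eq
    (((hasInt_wI hκ hf hh).const_mul a).add ((hasInt_wI hκ hg hh).const_mul b)) fun x => by ring

lemma wJ_comb_left (hκ : 0 < κ) (hf : MemL2ul f) (hg : MemL2ul g) (hh : MemL2ul h) (a b : ℝ) :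
    wJ κ (fun x => a * f x + b * g x) h = a * wJ κ f h + b * wJ κ g h :=
  (hasInt_wJ hκ (hf.comb hg a b) hh).eq
    (((hasInt_wJ hκ hf hh).const_mul a).add ((hasInt_wJ hκ hg hh).const_mul b)) fun x => by ring

lemma wI_comb_right (hκ : 0 < κ) (hf : MemL2ul f) (hg : MemL2ul g) (hh : MemL2ul h) (a b : ℝ) :
    wI κ h (fun x => a * f x + b * g x) = a * wI κ h f + b * wI κ h g := by
  rw [wI_comm, wI_comb_left hκ hf hg hh, wI_comm κ f, wI_comm κ g]

lemma wJ_comb_right (hκ : 0 < κ) (hf : MemL2ul f) (hg : MemL2ul g) (hh : MemL2ul h) (a b : ℝ) :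
    wJ κ h (fun x => a * f x + b * g x) = a * wJ κ h f + b * wJ κ h g := by
  rw [wJ_comm, wJ_comb_left hκ hf hg hh, wJ_comm κ f, wJ_comm κ g]

end Bilinear

namespace WaveSystem

variable {α κ : ℝ} {u p q G : ℝ → ℝ → ℝ}

/-- Half the sum of the squares of βq + p and βq - p is αq² + p². The invariants have opposite
speeds, so of the weight terms only the cross flux of p and q survives. -/
lemma hasDerivAt_wI_kinetic (h : WaveSystem α u p q G) (hα : 0 < α) (hκ : 0 < κ) {t : ℝ}
    (ht : 0 < t) :
    HasDerivAt (fun t => α * wI κ (q t) (q t) + wI κ (p t) (p t))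
      (-2 * wI κ (q t) (q t) - 2 * wI κ (q t) (G t) - 4 * wJ κ (p t) (q t)) t := by
  obtain ⟨β, hβ0, hβ⟩ : ∃ β : ℝ, 0 < β ∧ β ^ 2 = α := ⟨√α, by positivity, Real.sq_sqrt hα.le⟩
  have k1 := (h.weakTransport_riemann hα hβ (ε := 1) (by norm_num)).hasDerivAt_integral_mul hκ
    (h.weakTransport_riemann hα hβ (ε := 1) (by norm_num)) ht
  have k2 := (h.weakTransport_riemann hα hβ (ε := -1) (by norm_num)).hasDerivAt_integral_mul hκ
    (h.weakTransport_riemann hα hβ (ε := -1) (by norm_num)) ht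
  have key := (k1.add k2).const_mul (1 / 2)
  simp only [← wI.eq_1, ← wJ.eq_1] at key
  refine (key.congr_of_eventuallyEq ?_).congr_deriv ?_
  · filter_upwards [eventually_pos_nhds ht] with s hs
    have hq := h.path_q.mem s hs
    have hp := h.path_p.mem s hs
    simp only [Pi.add_apply]
    simp only [wI_comb_left hκ hq hp (hq.comb hp _ _), wI_comb_right hκ hq hp hq,
      wI_comb_right hκ hq hp hp, wI_comm κ (p s) (q s)]
    rw [← hβ]
    ring
  · have hq := h.path_q.mem t ht
    have hp := h.path_p.mem t ht
    have hG := h.path_G.mem t ht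
    simp only [wI_comb_left hκ hq hp (hq.comb hG _ _), wI_comb_right hκ hq hG hq,
      wI_comb_right hκ hq hG hp, wI_comb_left hκ hq hG (hq.comb hp _ _), wI_comb_right hκ hq hp hq,
      wI_comb_right hκ hq hp hG, wJ_comb_left hκ hq hp (hq.comb hp _ _), wJ_comb_right hκ hq hp hq,
      wJ_comb_right hκ hq hp hp, wI_comm κ (p t) (q t), wI_comm κ (G t) (q t), wJ_comm κ (p t) (q t)]
    field_simp
    ring

/-- Write α u q as β/2 times u times the sum of the two invariants, and give u the speed of the
invariant it multiplies. The term u²/2 uses speed zero. -/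
lemma hasDerivAt_wI_mixed (h : WaveSystem α u p q G) (hα : 0 < α) (hκ : 0 < κ) {t : ℝ}
    (ht : 0 < t) :
    HasDerivAt (fun t => α * wI κ (u t) (q t) + (1 / 2) * wI κ (u t) (u t))
      (α * wI κ (q t) (q t) - wI κ (p t) (p t) - wI κ (u t) (G t) - 2 * wJ κ (u t) (p t)) t := by
  obtain ⟨β, hβ0, hβ⟩ : ∃ β : ℝ, 0 < β ∧ β ^ 2 = α := ⟨√α, by positivity, Real.sq_sqrt hα.le⟩
  have k1 := (h.weakTransport_u (1 / β)).hasDerivAt_integral_mul hκ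
    (h.weakTransport_riemann hα hβ (ε := 1) (by norm_num)) ht
  have k2 := (h.weakTransport_u (-1 / β)).hasDerivAt_integral_mul hκ
    (h.weakTransport_riemann hα hβ (ε := -1) (by norm_num)) ht
  have k3 := ((h.weakTransport_u 0).hasDerivAt_integral_mul hκ (h.weakTransport_u 0) ht).const_mul
    (1 / 2)
  have key := ((k1.add k2).const_mul (β / 2)).add k3
  simp only [← wI.eq_1, ← wJ.eq_1] at key
  refine (key.congr_of_eventuallyEq ?_).congr_deriv ?_
  · filter_upwards [eventually_pos_nhds ht] with s hs
    have hq := h.path_q.mem s hs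
    have hp := h.path_p.mem s hs
    have hu := h.path_u.mem s hs
    simp only [Pi.add_apply]
    simp only [wI_comb_right hκ hq hp hu]
    rw [← hβ]
    ring
  · have hq := h.path_q.mem t ht
    have hp := h.path_p.mem t ht
    have hG := h.path_G.mem t ht
    have hu := h.path_u.mem t ht
    simp only [wI_comb_right hκ hq hG hu, wI_comb_left hκ hq hp (hq.comb hp _ _),
      wI_comb_left hκ hq hp hu, wI_comb_right hκ hq hp hu,
      wI_comb_right hκ hq hp hq, wI_comb_right hκ hq hp hp, wJ_comb_right hκ hq hp hu,
      wI_comm κ (p t) (q t), wI_comm κ (p t) (u t), wI_comm κ (q t) (u t)]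
    rw [← hβ]
    field_simp
    ring

end WaveSystem

/-! ### The potential energy and the basic energy inequality -/

lemma abs_le_of_enorm_le {a c : ℝ} (hc : 0 ≤ c) (h : ‖a‖ₑ ≤ ENNReal.ofReal c) : |a| ≤ c := by
  rw [Real.enorm_eq_ofReal_abs] at h
  exact (ENNReal.ofReal_le_ofReal_iff hc).1 h

lemma IsPrimitive.abs_le_l2ulNorm {u p : ℝ → ℝ} (h : IsPrimitive u p) (hu : MemL2ul u)
    (hp : MemL2ul p) (x : ℝ) : |u x| ≤ (l2ulNorm u).toReal + (l2ulNorm p).toReal := by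
  refine abs_le_of_enorm_le (by positivity) ((h.enorm_le x).trans ?_)
  rw [ENNReal.ofReal_add (by positivity) (by positivity), ENNReal.ofReal_toReal hu.2.1.ne,
    ENNReal.ofReal_toReal hp.2.1.ne]
  exact add_le_add (l2Norm_unit_le_l2ulNorm _ _) (l2Norm_unit_le_l2ulNorm _ _)

lemma UlPath.eventually_l2ulNorm_le {f : ℝ → ℝ → ℝ} (hf : UlPath f) {t : ℝ} (ht : 0 < t) :
    ∃ B : ℝ, 0 ≤ B ∧ ∀ᶠ s in 𝓝 t, (l2ulNorm (f s)).toReal ≤ B := by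
  refine ⟨(l2ulNorm (f t)).toReal + 1, by positivity, ?_⟩
  filter_upwards [eventually_pos_nhds ht, (hf.cont t ht).eventually_lt_const one_pos] with s hs h1
  have h2 : l2ulNorm (f s) ≤ l2ulNorm (fun x => f s x - f t x) + l2ulNorm (f t) := by
    refine le_trans (le_of_eq ?_) (l2ulNorm_add_le ((hf.mem s hs).sub (hf.mem t ht)).1
      (hf.mem t ht).1)
    congr 1
    ext x
    ring
  refine ENNReal.toReal_le_of_le_ofReal (by positivity) ?_
  rw [ENNReal.ofReal_add (by positivity) (by positivity), ENNReal.ofReal_toReal (hf.mem t ht).2.1.ne,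
    add_comm, ENNReal.ofReal_one]
  refine h2.trans ?_
  gcongr

lemma UlPath.eventually_abs_le {u p : ℝ → ℝ → ℝ} (hu : UlPath u) (hp : UlPath p)
    (hup : ∀ t > 0, IsPrimitive (u t) (p t)) {t : ℝ} (ht : 0 < t) :
    ∃ B : ℝ, 0 ≤ B ∧ ∀ᶠ s in 𝓝 t, ∀ x, |u s x| ≤ B := by
  obtain ⟨B, hB0, hB⟩ := hu.eventually_l2ulNorm_le ht
  obtain ⟨B', hB0', hB'⟩ := hp.eventually_l2ulNorm_le ht
  refine ⟨B + B', by positivity, ?_⟩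
  filter_upwards [hB, hB', eventually_pos_nhds ht] with s h1 h2 hs x
  exact ((hup s hs).abs_le_l2ulNorm (hu.mem s hs) (hp.mem s hs) x).trans (add_le_add h1 h2)

lemma WaveSystem.eventually_abs_le {α : ℝ} {u p q G : ℝ → ℝ → ℝ} (h : WaveSystem α u p q G) {t : ℝ}
    (ht : 0 < t) : ∃ B : ℝ, 0 ≤ B ∧ ∀ᶠ s in 𝓝 t, ∀ x, |u s x| ≤ B :=
  h.path_u.eventually_abs_le h.path_p h.prim ht

lemma exists_abs_comp_le {F : ℝ → ℝ} (hF : Continuous F) (B : ℝ) :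
    ∃ K, 0 ≤ K ∧ ∀ z, |z| ≤ B → |F z| ≤ K := by
  obtain ⟨K, hK⟩ := (isCompact_Icc (a := -B) (b := B)).exists_bound_of_continuousOn hF.continuousOn
  exact ⟨max K 0, le_max_right _ _, fun z hz => (hK z (abs_le.1 hz)).trans (le_max_left _ _)⟩

/-- `C¹` functions are Lipschitz on bounded intervals. -/
lemma exists_lipschitz_on_bounded {F : ℝ → ℝ} (hF : ContDiff ℝ 1 F) (B : ℝ) :
    ∃ K, 0 ≤ K ∧ ∀ y z, |y| ≤ B → |z| ≤ B → |F z - F y| ≤ K * |z - y| := by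
  obtain ⟨K, hK0, hK⟩ := exists_abs_comp_le (hF.continuous_deriv le_rfl) B
  refine ⟨K, hK0, fun y z hy hz => ?_⟩
  exact (convex_Icc (-B) B).norm_image_sub_le_of_norm_deriv_le
    (fun w _ => (hF.differentiable one_ne_zero) w) (fun w hw => hK w (abs_le.2 hw))
    (abs_le.1 hy) (abs_le.1 hz)

/-- Second order Taylor estimate on bounded intervals. -/
lemma exists_taylor_on_bounded {V : ℝ → ℝ} (hV : ContDiff ℝ 2 V) (B : ℝ) :
    ∃ K, 0 ≤ K ∧ ∀ y z, |y| ≤ B → |z| ≤ B →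
      |V z - V y - deriv V y * (z - y)| ≤ K * (z - y) ^ 2 := by
  have hV' : ContDiff ℝ 1 (deriv V) := hV.iterate_deriv' 1 1
  obtain ⟨K, hK0, hK⟩ := exists_lipschitz_on_bounded hV' B
  refine ⟨K, hK0, fun y z hy hz => ?_⟩
  have hd : ∀ w, HasDerivAt (fun w => V w - deriv V y * w) (deriv V w - deriv V y) w := fun w =>
    (hV.differentiable two_ne_zero w).hasDerivAt.sub
      (by simpa using (hasDerivAt_id w).const_mul (deriv V y))
  have := (convex_uIcc y z).norm_image_sub_le_of_norm_hasDerivWithin_le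
    (C := K * |z - y|) (fun w _ => (hd w).hasDerivWithinAt) (fun w hw => ?_)
    left_mem_uIcc right_mem_uIcc
  · rw [Real.norm_eq_abs, Real.norm_eq_abs, mul_assoc, abs_mul_abs_self, ← sq] at this
    convert this using 2
    ring
  · have hwB : |w| ≤ B := by
      have h1 : uIcc y z ⊆ Icc (-B) B := uIcc_subset_Icc (abs_le.1 hy) (abs_le.1 hz)
      exact abs_le.2 (h1 hw)
    refine (hK y w hy hwB).trans (mul_le_mul_of_nonneg_left ?_ hK0)
    exact abs_sub_left_of_mem_uIcc hw

lemma memL2ul_comp {F f : ℝ → ℝ} (hF : ContDiff ℝ 1 F) (hf : MemL2ul f) {B : ℝ}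
    (hB : ∀ x, |f x| ≤ B) : MemL2ul (fun x => F (f x)) := by
  obtain ⟨K, hK0, hK⟩ := exists_lipschitz_on_bounded hF B
  obtain ⟨M, hM0, hM⟩ := exists_abs_comp_le hF.continuous B
  refine hf.of_le (hF.continuous.comp_aestronglyMeasurable hf.1)
    ((l2ulNorm_le_of_bound fun x => hM _ (hB x)).trans_lt ENNReal.ofReal_lt_top) (c := K)
    fun x y => hK _ _ (hB y) (hB x)

lemma WaveSystem.hasDerivAt_mulL2 {α κ : ℝ} {u p q G : ℝ → ℝ → ℝ} (h : WaveSystem α u p q G)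
    (hκ : 0 < κ) {t : ℝ} (ht : 0 < t) :
    HasDerivAt (fun s => mulL2 (wt κ) (u s)) (mulL2 (wt κ) (q t)) t := by
  have hw : ∀ x, |wt κ x| ≤ 1 * wt κ x := fun x => by rw [one_mul, abs_of_pos (wt_pos κ x)]
  have key := hasDerivAt_shiftL2_of_weak_transport (c := 0) isOpen_Ioi (mem_Ioi.2 ht)
    (h.path_u.continuousOn_mulL2 hκ.ne' (continuous_wt κ) hw)
    (h.path_q.continuousOn_mulL2 hκ.ne' (continuous_wt κ) hw) (fun φ hφ s hs => ?_)
  · simpa only [zero_mul, neg_zero, shiftL2_zero] using key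
  · have hs : 0 < s := hs
    rw [neg_zero, zero_mul, zero_add, inner_mulL2_test ((h.path_q.mem s hs).memLp_wt_mul hκ.ne')]
    refine (h.deriv_u _ (hφ.mul_left (contDiff_wt κ)) s hs).congr_of_eventuallyEq ?_
    filter_upwards [eventually_pos_nhds hs] with r hr
    exact inner_mulL2_test ((h.path_u.mem r hr).memLp_wt_mul hκ.ne') hφ

lemma integrable_wt_sq_mul {κ : ℝ} (hκ : κ ≠ 0) {f : ℝ → ℝ} (hf : MemL2ul f) :
    Integrable (fun x => wt κ x ^ 2 * f x) := by
  simpa using (memL2ul_const 1).integrable_wt_sq hf hκ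

lemma norm_mulL2_sq {κ : ℝ} (hκ : κ ≠ 0) {f : ℝ → ℝ} (hf : MemL2ul f) :
    ‖mulL2 (wt κ) f‖ ^ 2 = wI κ f f := by
  rw [← real_inner_self_eq_norm_sq, inner_mulL2 (hf.memLp_wt_mul hκ) (hf.memLp_wt_mul hκ)]
  simp only [wI, sq]

lemma mulL2_sub {κ : ℝ} (hκ : κ ≠ 0) {f g : ℝ → ℝ} (hf : MemL2ul f) (hg : MemL2ul g) :
    mulL2 (wt κ) (fun x => f x - g x) = mulL2 (wt κ) f - mulL2 (wt κ) g := by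
  rw [mulL2_eq (hf.memLp_wt_mul hκ), mulL2_eq (hg.memLp_wt_mul hκ),
    mulL2_eq ((hf.sub hg).memLp_wt_mul hκ), ← MemLp.toLp_sub]
  congr 1
  ext x
  simp
  ring

/-- The weighted position is strongly differentiable in L², so after removing the linear Taylor term
the remainder is at most K‖u(s) - u(t)‖² = O((s-t)²). The local sup bound on u provides K with no
growth condition on V. -/
lemma WaveSystem.hasDerivAt_potential {α κ : ℝ} {u p q G : ℝ → ℝ → ℝ} (h : WaveSystem α u p q G)
    (hκ : 0 < κ) {V : ℝ → ℝ} (hV : ContDiff ℝ 2 V) {t : ℝ} (ht : 0 < t) :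
    HasDerivAt (fun s => ∫ x, wt κ x ^ 2 * V (u s x))
      (wI κ (fun x => deriv V (u t x)) (q t)) t := by
  obtain ⟨B, hB0, hB⟩ := h.eventually_abs_le ht
  obtain ⟨K, hK0, hK⟩ := exists_taylor_on_bounded hV B
  have hut := h.path_u.mem t ht
  have hBt : ∀ x, |u t x| ≤ B := hB.self_of_nhds
  have hV't : MemL2ul (fun x => deriv V (u t x)) :=
    memL2ul_comp (hV.iterate_deriv' 1 1) hut hBt
  have hU := h.hasDerivAt_mulL2 hκ ht
  set A := mulL2 (wt κ) (fun x => deriv V (u t x)) with hA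
  have hlin : HasDerivAt (fun s => inner ℝ A (mulL2 (wt κ) (u s) - mulL2 (wt κ) (u t)))
      (wI κ (fun x => deriv V (u t x)) (q t)) t := by
    have h1 := (hasDerivAt_const t A).inner ℝ (hU.sub_const (mulL2 (wt κ) (u t)))
    rw [inner_zero_left, add_zero, hA, inner_mulL2 (hV't.memLp_wt_mul hκ.ne')
      ((h.path_q.mem t ht).memLp_wt_mul hκ.ne')] at h1
    simpa only [wI, sq] using h1
  have hrem : HasDerivAt (fun s => (∫ x, wt κ x ^ 2 * V (u s x)) - (∫ x, wt κ x ^ 2 * V (u t x)) -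
      inner ℝ A (mulL2 (wt κ) (u s) - mulL2 (wt κ) (u t))) 0 t := by
    rw [hasDerivAt_iff_isLittleO]
    have hO : (fun s => ‖mulL2 (wt κ) (u s) - mulL2 (wt κ) (u t)‖ ^ 2) =o[𝓝 t] fun s => s - t := by
      have h1 := hU.isBigO_sub
      have h2 : (fun s => ‖mulL2 (wt κ) (u s) - mulL2 (wt κ) (u t)‖ ^ 2)
          =O[𝓝 t] fun s => (s - t) ^ 2 := h1.norm_left.pow 2
      refine h2.trans_isLittleO ?_
      have h3 : (fun s : ℝ => (s - t) * (s - t)) =o[𝓝 t] fun s => (s - t) * 1 := by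
        refine (Asymptotics.isBigO_refl _ _).mul_isLittleO ?_
        rw [Asymptotics.isLittleO_one_iff]
        have : ContinuousAt (fun s => s - t) t := by fun_prop
        simpa [ContinuousAt] using this
      simpa [sq] using h3
    refine Asymptotics.IsBigO.trans_isLittleO ?_ hO
    refine Asymptotics.IsBigO.of_bound K ?_
    filter_upwards [hB, eventually_pos_nhds ht] with s hBs hs
    have hus := h.path_u.mem s hs
    have hd := hus.sub hut
    simp only [sub_self, inner_zero_right, sub_zero, smul_zero]
    rw [Real.norm_of_nonneg (sq_nonneg _), ← mulL2_sub hκ.ne' hus hut, norm_mulL2_sq hκ.ne' hd, hA,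
      inner_mulL2 (hV't.memLp_wt_mul hκ.ne') (hd.memLp_wt_mul hκ.ne')]
    have i1 := HasInt.of_integrable (integrable_wt_sq_mul hκ.ne'
      (memL2ul_comp (hV.of_le (by norm_num)) hus hBs))
    have i2 := HasInt.of_integrable (integrable_wt_sq_mul hκ.ne'
      (memL2ul_comp (hV.of_le (by norm_num)) hut hBt))
    have i3 := hasInt_wI hκ hV't hd
    have i4 := (hasInt_wI hκ hd hd).const_mul K
    have i5 := (hasInt_wI hκ hd hd).const_mul (-K)
    have i6 := (i1.sub i2).sub i3
    simp only [wI, ← sq] at i6 i4 i5 ⊢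
    rw [Real.norm_eq_abs, abs_le]
    constructor
    · rw [← neg_mul]
      refine i5.mono i6 fun x => ?_
      have := (abs_le.1 (hK _ _ (hBt x) (hBs x))).1
      nlinarith [mul_le_mul_of_nonneg_left this (sq_nonneg (wt κ x))]
    · refine i6.mono i4 fun x => ?_
      have := (abs_le.1 (hK _ _ (hBt x) (hBs x))).2
      nlinarith [mul_le_mul_of_nonneg_left this (sq_nonneg (wt κ x))]
  refine (((hrem.add hlin).const_add (∫ x, wt κ x ^ 2 * V (u t x))).congr_of_eventuallyEq
    (Eventually.of_forall fun s => ?_)).congr_deriv (by simp)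
  simp only [Pi.add_apply]
  ring

/-- The density of the energy functional. -/
noncomputable def energyDensity (α δ : ℝ) (W : ℝ → ℝ) (u p q : ℝ) : ℝ :=
  α / 2 * q ^ 2 + p ^ 2 / 2 + δ * (α * (u * q) + u ^ 2 / 2) + W u

/-- The localized energy functional. -/
noncomputable def energy (κ α δ : ℝ) (W : ℝ → ℝ) (u p q : ℝ → ℝ) : ℝ :=
  ∫ x, wt κ x ^ 2 * energyDensity α δ W (u x) (p x) (q x)

/-- Completing the square gives α u q ≥ -u²/4 - α²q²; the condition δα ≤ 1/4 lets half of the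
kinetic term absorb δα²q². -/
lemma energyDensity_ge {α δ : ℝ} (hα : 0 < α) (hδ : 0 < δ) (hδα : δ * α ≤ 1 / 4) (W : ℝ → ℝ)
    (u p q : ℝ) : α / 4 * q ^ 2 + p ^ 2 / 2 + δ / 4 * u ^ 2 + W u ≤ energyDensity α δ W u p q := by
  unfold energyDensity
  have h1 : 0 ≤ δ * (u / 2 + α * q) ^ 2 := by positivity
  have h2 : δ * α * (α * q ^ 2) ≤ 1 / 4 * (α * q ^ 2) := by gcongr
  nlinarith

lemma energyDensity_le {α δ : ℝ} (hα : 0 < α) (hδ : 0 < δ) (hδα : δ * α ≤ 1 / 4) (W : ℝ → ℝ)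
    (u p q : ℝ) : energyDensity α δ W u p q ≤ (α + δ + 1) * (u ^ 2 + p ^ 2 + q ^ 2) + W u := by
  unfold energyDensity
  have h1 : 0 ≤ δ * (u / 2 - α * q) ^ 2 := by positivity
  have h2 : δ * α * (α * q ^ 2) ≤ 1 / 4 * (α * q ^ 2) := by gcongr
  have := mul_nonneg hα.le (sq_nonneg u)
  have := mul_nonneg hα.le (sq_nonneg p)
  have := mul_nonneg hα.le (sq_nonneg q)
  have := mul_nonneg hδ.le (sq_nonneg p)
  have := mul_nonneg hδ.le (sq_nonneg q)
  nlinarith [mul_nonneg hδ.le (sq_nonneg u), sq_nonneg u, sq_nonneg p, sq_nonneg q]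

lemma hasInt_wI_sq {κ : ℝ} (hκ : 0 < κ) {f : ℝ → ℝ} (hf : MemL2ul f) :
    HasInt (fun x => wt κ x ^ 2 * f x ^ 2) (wI κ f f) := by
  simpa only [sq (f _)] using hasInt_wI hκ hf hf

lemma hasInt_energy {κ α δ : ℝ} (hκ : 0 < κ) {W : ℝ → ℝ} {u p q : ℝ → ℝ} (hu : MemL2ul u)
    (hp : MemL2ul p) (hq : MemL2ul q) (hW : MemL2ul (fun x => W (u x))) :
    HasInt (fun x => wt κ x ^ 2 * energyDensity α δ W (u x) (p x) (q x))
        (energy κ α δ W u p q) ∧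
      energy κ α δ W u p q = 1 / 2 * (α * wI κ q q + wI κ p p) +
        δ * (α * wI κ u q + 1 / 2 * wI κ u u) + ∫ x, wt κ x ^ 2 * W (u x) := by
  have h1 := (((hasInt_wI hκ hq hq).const_mul α).add (hasInt_wI hκ hp hp)).const_mul (1 / 2)
  have h2 := (((hasInt_wI hκ hu hq).const_mul α).add
    ((hasInt_wI hκ hu hu).const_mul (1 / 2))).const_mul δ
  have h3 := (h1.add h2).add (HasInt.of_integrable (integrable_wt_sq_mul hκ.ne' hW))
  have e : (fun x => wt κ x ^ 2 * energyDensity α δ W (u x) (p x) (q x)) = fun x =>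
      1 / 2 * (α * (wt κ x ^ 2 * (q x * q x)) + wt κ x ^ 2 * (p x * p x)) +
        δ * (α * (wt κ x ^ 2 * (u x * q x)) + 1 / 2 * (wt κ x ^ 2 * (u x * u x))) +
      wt κ x ^ 2 * W (u x) := by
    ext x
    unfold energyDensity
    ring
  rw [← e] at h3
  exact ⟨⟨h3.1, rfl⟩, h3.2⟩

/-- Damping controls only q²; the δ-term supplies -p² and, through coercivity, -a u². Young's
inequality absorbs the cross terms, and the smallness of κ absorbs the flux, since |m'| ≤ κm. -/
lemma dissipation_le {α δ κ a b γ : ℝ} (hδ : 0 < δ) (hδα : δ * α ≤ 1 / 4) (hκ : 0 < κ)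
    (ha : 0 < a) (hκ1 : κ ≤ 1 / 4) (hκδ : κ ≤ δ / 4) (hκa : κ ≤ a / 4) (hγ1 : γ ≤ 1 / 4)
    (hγδ : γ ≤ δ / 2) (hγa : γ ≤ δ * a / 2) {u p q F w m m' : ℝ} (hm : 0 ≤ m)
    (hm' : |m'| ≤ κ * m) (hw : a * u ^ 2 - b ≤ u * w) :
    m ^ 2 * (-q ^ 2 + q * F + δ * (α * q ^ 2 - p ^ 2 - u * (w - F)))
      - 2 * (m * m') * (p * q + δ * (u * p)) ≤
    m ^ 2 * (-γ * (u ^ 2 + p ^ 2 + q ^ 2) + δ * b + (1 + δ / a) * F ^ 2) := by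
  have h1 : |2 * (m * m') * (p * q + δ * (u * p))| ≤
      m ^ 2 * (κ * (p ^ 2 + q ^ 2) + κ * δ * (u ^ 2 + p ^ 2)) := by
    have e1 : |2 * (m * m')| ≤ 2 * (κ * m ^ 2) := by
      rw [abs_mul, abs_mul, abs_of_nonneg hm, abs_two]
      nlinarith [mul_le_mul_of_nonneg_left hm' hm]
    have e2 : 2 * |p * q + δ * (u * p)| ≤ (p ^ 2 + q ^ 2) + δ * (u ^ 2 + p ^ 2) := by
      have h2 := abs_add_le (p * q) (δ * (u * p))
      rw [abs_mul, abs_mul, abs_mul, abs_of_pos hδ] at h2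
      have h3 : 0 ≤ δ * (|u| - |p|) ^ 2 := by positivity
      nlinarith [sq_nonneg (|p| - |q|), sq_abs p, sq_abs q, sq_abs u]
    rw [abs_mul]
    calc |2 * (m * m')| * |p * q + δ * (u * p)|
        ≤ 2 * (κ * m ^ 2) * |p * q + δ * (u * p)| := by gcongr
      _ = κ * m ^ 2 * (2 * |p * q + δ * (u * p)|) := by ring
      _ ≤ κ * m ^ 2 * ((p ^ 2 + q ^ 2) + δ * (u ^ 2 + p ^ 2)) := by gcongr
      _ = _ := by ring
  have h2 : -q ^ 2 + q * F + δ * (α * q ^ 2 - p ^ 2 - u * (w - F)) +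
      (κ * (p ^ 2 + q ^ 2) + κ * δ * (u ^ 2 + p ^ 2)) ≤
      -γ * (u ^ 2 + p ^ 2 + q ^ 2) + δ * b + (1 + δ / a) * F ^ 2 := by
    have q1 : q * F ≤ q ^ 2 / 4 + F ^ 2 := by nlinarith [sq_nonneg (q / 2 - F)]
    have q2 : δ * (α * q ^ 2) ≤ q ^ 2 / 4 := by nlinarith [sq_nonneg q]
    have q3 : δ * (a * u ^ 2 - b) ≤ δ * (u * w) := by gcongr
    have q4 : δ * (u * F) ≤ δ * a / 4 * u ^ 2 + δ / a * F ^ 2 := by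
      have : 0 ≤ δ / a * (a * u / 2 - F) ^ 2 := by positivity
      have e : δ / a * (a * u / 2 - F) ^ 2 = δ * a / 4 * u ^ 2 - δ * (u * F) + δ / a * F ^ 2 := by
        field_simp
        ring
      linarith
    have q5 : κ * δ * u ^ 2 ≤ δ * a / 4 * u ^ 2 := by nlinarith [mul_nonneg hδ.le (sq_nonneg u)]
    have q6 : κ * p ^ 2 ≤ δ / 4 * p ^ 2 := by gcongr
    have q7 : κ * δ * p ^ 2 ≤ δ / 4 * p ^ 2 := by nlinarith [mul_nonneg hδ.le (sq_nonneg p)]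
    have q8 : κ * q ^ 2 ≤ 1 / 4 * q ^ 2 := by gcongr
    have q9 : γ * q ^ 2 ≤ 1 / 4 * q ^ 2 := by gcongr
    have q10 : γ * p ^ 2 ≤ δ / 2 * p ^ 2 := by gcongr
    have q11 : γ * u ^ 2 ≤ δ * a / 2 * u ^ 2 := by gcongr
    linarith
  have h3 := mul_le_mul_of_nonneg_left h2 (sq_nonneg m)
  have h4 := (abs_le.1 h1).1
  linarith

/-- The splitting G = W'(u) - F serves two purposes: W is the shifted potential and F = 0 in the a
priori bound, whereas W is quadratic and F = u - G for differences of solutions. -/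
lemma WaveSystem.exists_hasDerivAt_energy {α δ κ a b γ : ℝ} (hα : 0 < α) (hδ : 0 < δ)
    (hδα : δ * α ≤ 1 / 4) (hκ : 0 < κ) (ha : 0 < a) (hκ1 : κ ≤ 1 / 4) (hκδ : κ ≤ δ / 4)
    (hκa : κ ≤ a / 4) (hγ1 : γ ≤ 1 / 4) (hγδ : γ ≤ δ / 2) (hγa : γ ≤ δ * a / 2)
    {W : ℝ → ℝ} (hW : ContDiff ℝ 2 W) (hab : ∀ z, a * z ^ 2 - b ≤ z * deriv W z)
    {u p q G F : ℝ → ℝ → ℝ} (h : WaveSystem α u p q G) (hF : UlPath F)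
    (hG : ∀ t x, G t x = deriv W (u t x) - F t x) {t : ℝ} (ht : 0 < t) :
    ∃ D, HasDerivAt (fun s => energy κ α δ W (u s) (p s) (q s)) D t ∧
      D ≤ -γ * (wI κ (u t) (u t) + wI κ (p t) (p t) + wI κ (q t) (q t)) +
        δ * b * wI κ (fun _ => 1) (fun _ => 1) + (1 + δ / a) * wI κ (F t) (F t) := by
  obtain ⟨B, hB0, hB⟩ := h.eventually_abs_le ht
  have d1 := (h.hasDerivAt_wI_kinetic hα hκ ht).const_mul (1 / 2)
  have d2 := (h.hasDerivAt_wI_mixed hα hκ ht).const_mul δ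
  have d3 := h.hasDerivAt_potential hκ hW ht
  have hu := h.path_u.mem t ht
  have hp := h.path_p.mem t ht
  have hq := h.path_q.mem t ht
  have hGt := h.path_G.mem t ht
  have hFt := hF.mem t ht
  have hW' : MemL2ul (fun x => deriv W (u t x)) :=
    memL2ul_comp (hW.iterate_deriv' 1 1) hu hB.self_of_nhds
  refine ⟨_, ((d1.add d2).add d3).congr_of_eventuallyEq ?_, ?_⟩
  · filter_upwards [hB, eventually_pos_nhds ht] with s hBs hs
    exact (hasInt_energy hκ (h.path_u.mem s hs) (h.path_p.mem s hs) (h.path_q.mem s hs)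
      (memL2ul_comp (hW.of_le (by norm_num)) (h.path_u.mem s hs) hBs)).2
  · have i1 := ((((hasInt_wI_sq hκ hq).const_mul (-2)).sub
      ((hasInt_wI hκ hq hGt).const_mul 2)).sub ((hasInt_wJ hκ hp hq).const_mul 4)).const_mul (1 / 2)
    have i2 := (((((hasInt_wI_sq hκ hq).const_mul α).sub (hasInt_wI_sq hκ hp)).sub
      (hasInt_wI hκ hu hGt)).sub ((hasInt_wJ hκ hu hp).const_mul 2)).const_mul δ
    have i3 := (i1.add i2).add (hasInt_wI hκ hW' hq)
    have j1 := (((hasInt_wI_sq hκ hu).add (hasInt_wI_sq hκ hp)).add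
      (hasInt_wI_sq hκ hq)).const_mul (-γ)
    have j2 := (hasInt_wI_sq hκ (memL2ul_const 1)).const_mul (δ * b)
    have j3 := (hasInt_wI_sq hκ hFt).const_mul (1 + δ / a)
    refine i3.mono ((j1.add j2).add j3) fun x => ?_
    have key := dissipation_le (q := q t x) (p := p t x) (F := F t x) hδ hδα hκ ha hκ1 hκδ hκa hγ1
      hγδ hγa (wt_pos κ x).le (abs_deriv_wt_le hκ.le x) (hab (u t x))
    rw [← hG] at key
    have hF' : F t x = deriv W (u t x) - G t x := by rw [hG]; ring
    -- Only the F paired with q is expanded, to match the kinetic and potential derivatives; F² must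
    -- remain on the right.
    nth_rewrite 1 [hF'] at key
    linarith

/-! ### Uniform bounds for all positive times -/

lemma wNorm_eq {κ : ℝ} (hκ : κ ≠ 0) {f : ℝ → ℝ} (hf : MemL2ul f) :
    wNorm κ f = ENNReal.ofReal (√(wI κ f f)) := by
  have h1 : ‖mulL2 (wt κ) f‖ = (wNorm κ f).toReal := by
    rw [mulL2_eq (hf.memLp_wt_mul hκ), Lp.norm_toLp]
    rfl
  rw [← norm_mulL2_sq hκ hf, Real.sqrt_sq (norm_nonneg _), h1]
  exact (ENNReal.ofReal_toReal (hf.memLp_wt_mul hκ).eLpNorm_ne_top).symm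

lemma wI_self_nonneg (κ : ℝ) (f : ℝ → ℝ) : 0 ≤ wI κ f f :=
  integral_nonneg fun _ => mul_nonneg (sq_nonneg _) (mul_self_nonneg _)

lemma exists_wI_shift_le {κ : ℝ} (hκ : κ ≠ 0) : ∃ C : ℝ, 0 < C ∧ ∀ f : ℝ → ℝ, MemL2ul f → ∀ ξ,
    wI κ (fun x => f (ξ + x)) (fun x => f (ξ + x)) ≤ C * (l2ulNorm f).toReal ^ 2 := by
  obtain ⟨C, hC0, hC⟩ := exists_wNorm_le hκ
  refine ⟨C ^ 2, by positivity, fun f hf ξ => ?_⟩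
  have h1 := hC _ (hf.shift ξ).1
  rw [wNorm_eq hκ (hf.shift ξ), l2ulNorm_shift, ← ENNReal.ofReal_toReal hf.2.1.ne,
    ← ENNReal.ofReal_mul hC0.le, ENNReal.ofReal_le_ofReal_iff (by positivity)] at h1
  rw [← mul_pow, ← Real.sqrt_le_left (by positivity)]
  exact h1

lemma l2ulNorm_le_of_wI_shift_le {κ B : ℝ} (hκ : κ ≠ 0) {f : ℝ → ℝ} (hf : MemL2ul f)
    (h : ∀ ξ, wI κ (fun x => f (ξ + x)) (fun x => f (ξ + x)) ≤ B) :
    l2ulNorm f ≤ ENNReal.ofReal ((wt κ 1)⁻¹ * √B) := by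
  have := wt_pos κ 1
  refine iSup_le fun ξ => (l2Norm_unit_le_wNorm (κ := κ) f ξ).trans ?_
  rw [wNorm_eq hκ (hf.shift ξ), ← ENNReal.ofReal_mul (by positivity)]
  refine ENNReal.ofReal_le_ofReal ?_
  gcongr
  exact h ξ

/-- The Sobolev embedding uses the window [x, x+1], contained in [-(R+1), R+1], where the weight is
at least wt(R+1). -/
lemma IsPrimitive.abs_le_of_wI_le {κ R K : ℝ} (hκ : κ ≠ 0) {u p : ℝ → ℝ} (h : IsPrimitive u p)
    (hu : MemL2ul u) (hp : MemL2ul p) (hK : wI κ u u + wI κ p p ≤ K) {x : ℝ} (hx : |x| ≤ R) :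
    |u x| ≤ 2 * ((wt κ (R + 1))⁻¹ * √K) := by
  have hw := wt_pos κ (R + 1)
  have hsub : Icc x (x + 1) ⊆ Icc (-(R + 1)) (R + 1) := by
    have := abs_le.1 hx
    exact Icc_subset_Icc (by linarith) (by linarith)
  have hle : ∀ {f : ℝ → ℝ}, MemL2ul f → wI κ f f ≤ K →
      l2Norm (Icc x (x + 1)) f ≤ ENNReal.ofReal ((wt κ (R + 1))⁻¹ * √K) := by
    intro f hf hfK
    refine (l2Norm_mono_set hsub f).trans ((l2Norm_Icc_le_wNorm (κ := κ) f).trans ?_)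
    rw [wNorm_eq hκ hf, ← ENNReal.ofReal_mul (by positivity)]
    refine ENNReal.ofReal_le_ofReal ?_
    gcongr
  refine abs_le_of_enorm_le (by positivity) ((h.enorm_le x).trans ?_)
  rw [two_mul, ENNReal.ofReal_add (by positivity) (by positivity)]
  have h1 := wI_self_nonneg κ u
  have h2 := wI_self_nonneg κ p
  exact add_le_add (hle hu (by linarith)) (hle hp (by linarith))

lemma energy_shift {κ α δ : ℝ} {W : ℝ → ℝ} {u p q : ℝ → ℝ} {M : ℝ} (hα : 0 < α) (hδ : 0 < δ)
    (hδα : δ * α ≤ 1 / 4) (hW0 : ∀ z, 0 ≤ W z) {B : ℝ} (hB : ∀ x, |u x| ≤ B) (hκ : 0 < κ)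
    (hW : ContDiff ℝ 1 W)
    (hu : MemL2ul u) (hp : MemL2ul p) (hq : MemL2ul q)
    (hM : ∀ ξ, energy κ α δ W (fun x => u (ξ + x)) (fun x => p (ξ + x)) (fun x => q (ξ + x)) ≤ M)
    (ξ : ℝ) : ∫⁻ x in Icc ξ (ξ + 1), ENNReal.ofReal (energyDensity α δ W (u x) (p x) (q x)) ≤
      ENNReal.ofReal ((wt κ 1)⁻¹ ^ 2 * M) := by
  have hw := wt_pos κ 1
  have he0 : ∀ u p q, 0 ≤ energyDensity α δ W u p q := fun u p q =>
    le_trans (by have := hW0 u; positivity) (energyDensity_ge hα hδ hδα W u p q)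
  have hE := (hasInt_energy (α := α) (δ := δ) hκ (hu.shift ξ) (hp.shift ξ) (hq.shift ξ)
    (memL2ul_comp hW (hu.shift ξ) fun x => hB (ξ + x))).1
  have h1 : ∫⁻ x in Icc ξ (ξ + 1), ENNReal.ofReal (energyDensity α δ W (u x) (p x) (q x)) =
      ∫⁻ x in Icc 0 1,
        ENNReal.ofReal (energyDensity α δ W (u (ξ + x)) (p (ξ + x)) (q (ξ + x))) := by
    have hmp : MeasurePreserving (fun x : ℝ => ξ + x)
        (volume.restrict ((fun x => ξ + x) ⁻¹' Icc ξ (ξ + 1))) (volume.restrict (Icc ξ (ξ + 1))) :=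
      (measurePreserving_add_left volume ξ).restrict_preimage_emb (measurableEmbedding_addLeft ξ) _
    rw [← hmp.lintegral_comp_emb (measurableEmbedding_addLeft ξ)]
    simp
  rw [h1]
  calc ∫⁻ x in Icc 0 1, ENNReal.ofReal (energyDensity α δ W (u (ξ + x)) (p (ξ + x)) (q (ξ + x)))
      ≤ ∫⁻ x in Icc 0 1, ENNReal.ofReal ((wt κ 1)⁻¹ ^ 2) * ENNReal.ofReal
        (wt κ x ^ 2 * energyDensity α δ W (u (ξ + x)) (p (ξ + x)) (q (ξ + x))) := by
        refine setLIntegral_mono' measurableSet_Icc fun x hx => ?_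
        rw [← ENNReal.ofReal_mul (by positivity), ← mul_assoc, ← mul_pow]
        refine ENNReal.ofReal_le_ofReal (le_mul_of_one_le_left (he0 _ _ _) (one_le_pow₀ ?_))
        rw [inv_mul_eq_div, one_le_div hw]
        exact wt_ge_of_abs_le (abs_le.2 ⟨by linarith [hx.1], hx.2⟩)
    _ ≤ ∫⁻ x, ENNReal.ofReal ((wt κ 1)⁻¹ ^ 2) * ENNReal.ofReal
        (wt κ x ^ 2 * energyDensity α δ W (u (ξ + x)) (p (ξ + x)) (q (ξ + x))) :=
        setLIntegral_le_lintegral _ _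
    _ = ENNReal.ofReal ((wt κ 1)⁻¹ ^ 2 *
        energy κ α δ W (fun x => u (ξ + x)) (fun x => p (ξ + x)) (fun x => q (ξ + x))) := by
        rw [lintegral_const_mul' _ _ (by simp), ← ofReal_integral_eq_lintegral_ofReal hE.1
          (ae_of_all _ fun x => mul_nonneg (sq_nonneg _) (he0 _ _ _)), hE.2,
          ENNReal.ofReal_mul (by positivity)]
    _ ≤ _ := ENNReal.ofReal_le_ofReal (mul_le_mul_of_nonneg_left (hM ξ) (by positivity))

/-- The energy at a point where the local norm is controlled is bounded by a constant plus half of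
the supremum of all translated energies. -/
lemma exists_energy_le_add_half {κ α δ : ℝ} (hα : 0 < α) (hδ : 0 < δ)
    (hδα : δ * α ≤ 1 / 4) (hκ : 0 < κ) {W : ℝ → ℝ} (hW : ContDiff ℝ 1 W) (hW0 : ∀ z, 0 ≤ W z)
    (K : ℝ) : ∃ C, 0 ≤ C ∧ ∀ (u p q : ℝ → ℝ) (B M : ℝ), IsPrimitive u p → MemL2ul u → MemL2ul p →
      MemL2ul q → (∀ x, |u x| ≤ B) → wI κ u u + wI κ p p + wI κ q q ≤ K →
      (∀ ξ, energy κ α δ W (fun x => u (ξ + x)) (fun x => p (ξ + x)) (fun x => q (ξ + x)) ≤ M) →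
      energy κ α δ W u p q ≤ C + M / 2 := by
  obtain ⟨C₀, hC₀, hC⟩ := lintegral_wt_mul_le hκ.ne'
  have hw := wt_pos κ 1
  set C₂ : ℝ := C₀ * (wt κ 1)⁻¹ ^ 2 with hC₂
  have hC₂0 : 0 < C₂ := by positivity
  -- With (κR)² = 2C₂, the product wt(R) C₂ = C₂/(1 + 2C₂) is at most 1/2, the factor in front of M.
  set R : ℝ := √(2 * C₂) / κ with hR
  have hR0 : 0 ≤ R := by positivity
  have hRw : wt κ R * C₂ ≤ 1 / 2 := by
    have : (κ * R) ^ 2 = 2 * C₂ := by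
      rw [hR, mul_div_cancel₀ _ hκ.ne', Real.sq_sqrt (by positivity)]
    rw [wt, this, inv_mul_eq_div, div_le_div_iff₀ (by positivity) (by norm_num)]
    linarith
  obtain ⟨L, hL0, hL⟩ := exists_abs_comp_le hW.continuous (2 * ((wt κ (R + 1))⁻¹ * √K))
  refine ⟨(α + δ + 1) * |K| + L * wI κ (fun _ => 1) (fun _ => 1), ?_, ?_⟩
  · have := wI_self_nonneg κ (fun _ => 1)
    positivity
  intro u p q B M hup hu hp hq hB hK hM
  have he0 : ∀ u p q, 0 ≤ energyDensity α δ W u p q := fun u p q =>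
    le_trans (by have := hW0 u; positivity) (energyDensity_ge hα hδ hδα W u p q)
  have hE := (hasInt_energy (α := α) (δ := δ) hκ hu hp hq (memL2ul_comp hW hu hB)).1
  have hM0 : 0 ≤ M := by
    refine le_trans ?_ (hM 0)
    exact integral_nonneg fun x => mul_nonneg (sq_nonneg _) (he0 _ _ _)
  have hem : AEStronglyMeasurable (fun x => energyDensity α δ W (u x) (p x) (q x)) volume := by
    have : AEStronglyMeasurable (fun x => W (u x)) volume := hW.continuous.comp_aestronglyMeasurable hu.1
    have := hu.1
    have := hp.1
    have := hq.1
    unfold energyDensity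
    fun_prop
  have hlin := hC (fun x => ENNReal.ofReal (energyDensity α δ W (u x) (p x) (q x)))
    hem.aemeasurable.ennreal_ofReal _ (energy_shift hα hδ hδα hW0 hB hκ hW hu hp hq hM)
  simp only [← ENNReal.ofReal_mul (wt_pos κ _).le] at hlin
  rw [← ENNReal.ofReal_mul hC₀.le, ← mul_assoc, ← hC₂] at hlin
  have hint : Integrable (fun x => wt κ x * energyDensity α δ W (u x) (p x) (q x)) := by
    refine ⟨(continuous_wt κ).aestronglyMeasurable.mul hem, ?_⟩
    rw [hasFiniteIntegral_iff_ofReal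
      (ae_of_all _ fun x => mul_nonneg (wt_pos κ x).le (he0 _ _ _))]
    exact hlin.trans_lt ENNReal.ofReal_lt_top
  rw [← ofReal_integral_eq_lintegral_ofReal hint
    (ae_of_all _ fun x => mul_nonneg (wt_pos κ x).le (he0 _ _ _)),
    ENNReal.ofReal_le_ofReal_iff (by positivity)] at hlin
  have j1 := (((hasInt_wI_sq hκ hu).add (hasInt_wI_sq hκ hp)).add
    (hasInt_wI_sq hκ hq)).const_mul (α + δ + 1)
  have j2 := (hasInt_wI_sq hκ (memL2ul_const 1)).const_mul L
  have j3 := (HasInt.of_integrable hint).const_mul (wt κ R)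
  have key := hE.mono ((j1.add j2).add j3) fun x => ?_
  · have h1 : wt κ R * ∫ x, wt κ x * energyDensity α δ W (u x) (p x) (q x) ≤ M / 2 := by
      calc _ ≤ wt κ R * (C₂ * M) := mul_le_mul_of_nonneg_left hlin (wt_pos κ R).le
        _ = wt κ R * C₂ * M := by ring
        _ ≤ 1 / 2 * M := by gcongr
        _ = M / 2 := by ring
    have h2 : (α + δ + 1) * (wI κ u u + wI κ p p + wI κ q q) ≤ (α + δ + 1) * |K| := by
      gcongr
      exact hK.trans (le_abs_self K)
    linarith
  · have hwx := wt_pos κ x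
    have hwR := wt_pos κ R
    have he := he0 (u x) (p x) (q x)
    -- Inside |x| ≤ R the bound K controls u pointwise, hence W(u) ≤ L. Outside, wt² ≤ wt(R) wt, and
    -- the integral of wt times the energy density is at most C₂M by window averaging.
    rcases le_total |x| R with hx | hx
    · have hLx : W (u x) ≤ L := (le_abs_self _).trans (hL _ (hup.abs_le_of_wI_le hκ.ne' hu hp
        (by linarith [wI_self_nonneg κ q]) hx))
      have h1 := energyDensity_le hα hδ hδα W (u x) (p x) (q x)
      have h2 := mul_le_mul_of_nonneg_left (h1.trans (add_le_add_right hLx _)) (sq_nonneg (wt κ x))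
      have h3 : 0 ≤ wt κ R * (wt κ x * energyDensity α δ W (u x) (p x) (q x)) := by positivity
      linarith
    · have h1 : wt κ x ≤ wt κ R := by
        have := wt_ge_of_abs_le (κ := κ) (x := R) (R := |x|) (by rwa [abs_of_nonneg hR0])
        simpa [wt, mul_pow] using this
      have h2 : wt κ x ^ 2 * energyDensity α δ W (u x) (p x) (q x) ≤
          wt κ R * (wt κ x * energyDensity α δ W (u x) (p x) (q x)) := by
        rw [sq, mul_assoc]
        gcongr
      have h3 : 0 ≤ (α + δ + 1) * (wt κ x ^ 2 * u x ^ 2 + wt κ x ^ 2 * p x ^ 2 +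
        wt κ x ^ 2 * q x ^ 2) + L * (wt κ x ^ 2 * 1 ^ 2) := by positivity
      linarith

lemma sub_le_of_hasDerivAt_le {f : ℝ → ℝ} {a b c : ℝ} (hab : a ≤ b)
    (h : ∀ s ∈ Icc a b, ∃ D, HasDerivAt f D s ∧ D ≤ c) : f b - f a ≤ c * (b - a) := by
  refine (convex_Icc a b).image_sub_le_mul_sub_of_deriv_le (f := f) (C := c) ?_ ?_ ?_ a
    (left_mem_Icc.2 hab) b (right_mem_Icc.2 hab) hab
  · exact fun s hs => (h s hs).choose_spec.1.continuousAt.continuousWithinAt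
  · exact fun s hs => (h s (interior_subset hs)).choose_spec.1.differentiableAt.differentiableWithinAt
  · intro s hs
    obtain ⟨D, hD, hDc⟩ := h s (interior_subset hs)
    rwa [hD.deriv]

/-- Potentials with `z V'(z) ≥ a z² - b` are bounded below. -/
lemma exists_lower_bound {V : ℝ → ℝ} (hV : ContDiff ℝ 1 V) {a b : ℝ} (ha : 0 < a)
    (hab : ∀ z, a * z ^ 2 - b ≤ z * deriv V z) : ∃ C, ∀ z, 0 ≤ V z + C := by
  set R : ℝ := |b| / a + 1 with hR
  have hR0 : 0 < R := by positivity
  have hbR : b ≤ a * R ^ 2 := by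
    have h1 : a * R = |b| + a := by rw [hR]; field_simp
    have h2 : 1 ≤ R := by rw [hR]; linarith [show 0 ≤ |b| / a by positivity]
    nlinarith [le_abs_self b, abs_nonneg b]
  obtain ⟨K, hK0, hK⟩ := exists_abs_comp_le hV.continuous R
  refine ⟨K, fun z => ?_⟩
  have hd := hV.differentiable one_ne_zero
  rcases le_or_gt |z| R with hz | hz
  · linarith [(abs_le.1 (hK z hz)).1]
  have hsign : ∀ w, R ≤ |w| → 0 ≤ w * deriv V w := fun w hw => by
    have : R ^ 2 ≤ w ^ 2 := by rw [← sq_abs w]; gcongr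
    nlinarith [hab w]
  rcases lt_abs.1 hz with hz' | hz'
  · have hmono : MonotoneOn V (Ici R) := by
      refine monotoneOn_of_deriv_nonneg (convex_Ici R) hd.continuous.continuousOn
        hd.differentiableOn fun w hw => ?_
      rw [interior_Ici, mem_Ioi] at hw
      exact nonneg_of_mul_nonneg_right (hsign w (hw.le.trans (le_abs_self w))) (hR0.trans hw)
    have := hmono (mem_Ici.2 le_rfl) (mem_Ici.2 hz'.le) hz'.le
    linarith [(abs_le.1 (hK R (by rw [abs_of_pos hR0]))).1]
  · have hanti : AntitoneOn V (Iic (-R)) := by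
      refine antitoneOn_of_deriv_nonpos (convex_Iic (-R)) hd.continuous.continuousOn
        hd.differentiableOn fun w hw => ?_
      rw [interior_Iic, mem_Iio] at hw
      have h1 := hsign w (le_abs.2 (Or.inr (by linarith)))
      by_contra hc
      push Not at hc
      nlinarith
    have := hanti (mem_Iic.2 (by linarith)) (mem_Iic.2 le_rfl) (show z ≤ -R by linarith)
    linarith [(abs_le.1 (hK (-R) (by rw [abs_neg, abs_of_pos hR0]))).1]

/-- Admissible parameters for the energy inequality. -/
lemma exists_energy_parameters {α a : ℝ} (hα : 0 < α) (ha : 0 < a) : ∃ δ κ γ : ℝ, 0 < δ ∧ 0 < κ ∧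
    0 < γ ∧ δ * α ≤ 1 / 4 ∧ κ ≤ 1 / 4 ∧ κ ≤ δ / 4 ∧ κ ≤ a / 4 ∧ γ ≤ 1 / 4 ∧ γ ≤ δ / 2 ∧
    γ ≤ δ * a / 2 := by
  have hδ : 0 < 1 / (4 * α) := by positivity
  refine ⟨1 / (4 * α), min (1 / 4) (min (1 / (4 * α) / 4) (a / 4)),
    min (1 / 4) (min (1 / (4 * α) / 2) (1 / (4 * α) * a / 2)), hδ, by positivity, by positivity,
    le_of_eq (by field_simp), min_le_left _ _, ?_, ?_, min_le_left _ _, ?_, ?_⟩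
  · exact (min_le_right _ _).trans (min_le_left _ _)
  · exact (min_le_right _ _).trans (min_le_right _ _)
  · exact (min_le_right _ _).trans (min_le_left _ _)
  · exact (min_le_right _ _).trans (min_le_right _ _)

lemma WaveSystem.shift_space {α : ℝ} {u p q G : ℝ → ℝ → ℝ} (h : WaveSystem α u p q G) (ξ : ℝ) :
    WaveSystem α (fun t x => u t (ξ + x)) (fun t x => p t (ξ + x))
      (fun t x => q t (ξ + x)) (fun t x => G t (ξ + x)) := by
  simpa only [add_zero] using h.shift le_rfl ξ

lemma ulPath_zero : UlPath (fun _ _ => 0) := by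
  refine ⟨fun t _ => memL2ul_const 0, fun t _ => ?_⟩
  refine tendsto_const_nhds.congr fun s => ?_
  refine (le_antisymm ((l2ulNorm_le_of_bound (c := 0) fun x => ?_).trans (by simp)) zero_le).symm
  simp

/-- Let M bound all translated energies at time t. On [t, t+1], a given translate either has N > c/γ
throughout, so its energy does not increase, or has N ≤ c/γ at some instant, where
`exists_energy_le_add_half` applies. In both cases M is again a bound at t+1 if it is large enough.
-/
lemma WaveSystem.exists_bound {α : ℝ} {u p q : ℝ → ℝ → ℝ} {V : ℝ → ℝ} {a b : ℝ}
    (h : WaveSystem α u p q (fun t x => deriv V (u t x))) (hα : 0 < α) (hV : ContDiff ℝ 2 V)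
    (ha : 0 < a) (hab : ∀ z, a * z ^ 2 - b ≤ z * deriv V z) :
    ∃ B : ℝ, 0 ≤ B ∧ ∀ t ≥ 1, l2ulNorm (u t) ≤ ENNReal.ofReal B ∧ l2ulNorm (p t) ≤ ENNReal.ofReal B ∧
      l2ulNorm (q t) ≤ ENNReal.ofReal B := by
  obtain ⟨δ, κ, γ, hδ, hκ, hγ, hδα, hκ1, hκδ, hκa, hγ1, hγδ, hγa⟩ := exists_energy_parameters hα ha
  obtain ⟨C₀, hC₀⟩ := exists_lower_bound (hV.of_le (by norm_num)) ha hab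
  set W : ℝ → ℝ := fun z => V z + C₀ with hWdef
  have hW : ContDiff ℝ 2 W := hV.add contDiff_const
  have hW1 : ContDiff ℝ 1 W := hW.of_le (by norm_num)
  have hdW : deriv W = deriv V := by
    ext z
    simp [hWdef]
  have hb : 0 ≤ b := by
    have := hab 0
    simp at this
    linarith
  set c : ℝ := δ * b * wI κ (fun _ => 1) (fun _ => 1) with hc
  have hc0 : 0 ≤ c := by
    have := wI_self_nonneg κ (fun _ => 1)
    positivity
  set N : ℝ → ℝ → ℝ := fun ξ t => wI κ (fun x => u t (ξ + x)) (fun x => u t (ξ + x)) +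
    wI κ (fun x => p t (ξ + x)) (fun x => p t (ξ + x)) +
    wI κ (fun x => q t (ξ + x)) (fun x => q t (ξ + x)) with hN
  set E : ℝ → ℝ → ℝ := fun ξ t => energy κ α δ W (fun x => u t (ξ + x)) (fun x => p t (ξ + x))
    (fun x => q t (ξ + x)) with hE
  have hderiv : ∀ ξ, ∀ t > 0, ∃ D, HasDerivAt (E ξ) D t ∧ D ≤ -γ * N ξ t + c := by
    intro ξ t ht
    obtain ⟨D, hD, hDle⟩ := (h.shift_space ξ).exists_hasDerivAt_energy hα hδ hδα hκ ha hκ1 hκδ hκa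
      hγ1 hγδ hγa hW (by rwa [hdW]) ulPath_zero (fun t x => by rw [hdW, sub_zero]) ht
    refine ⟨D, hD, hDle.trans (le_of_eq ?_)⟩
    have : wI κ (fun _ => 0) (fun _ => 0) = 0 := by simp [wI]
    simp only [this, hN, hc]
    ring
  have hN0 : ∀ ξ t, 0 ≤ N ξ t := fun ξ t => by
    have h1 := wI_self_nonneg κ (fun x => u t (ξ + x))
    have h2 := wI_self_nonneg κ (fun x => p t (ξ + x))
    have h3 := wI_self_nonneg κ (fun x => q t (ξ + x))
    positivity
  have hgrow : ∀ ξ t s, 0 < t → t ≤ s → E ξ s ≤ E ξ t + c * (s - t) := by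
    intro ξ t s ht hts
    have := sub_le_of_hasDerivAt_le (f := E ξ) (c := c) hts fun r hr => by
      obtain ⟨D, hD, hDle⟩ := hderiv ξ r (ht.trans_le hr.1)
      exact ⟨D, hD, hDle.trans (by nlinarith [hN0 ξ r])⟩
    linarith
  obtain ⟨C₁, hC₁0, hC₁⟩ := exists_energy_le_add_half hα hδ hδα hκ hW1 hC₀ (c / γ)
  have hbdd : ∀ t > 0, ∃ B, ∀ x, |u t x| ≤ B := fun t ht => by
    obtain ⟨B, _, hB⟩ := h.eventually_abs_le ht
    exact ⟨B, hB.self_of_nhds⟩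
  -- At an instant s with N ≤ c/γ all energies are at most M + c, so the one considered is at most
  -- C₁ + (M+c)/2. Growth up to t+1 adds at most c, whence the threshold.
  have hstep : ∀ t > 0, ∀ M, (∀ ξ, E ξ t ≤ M) → 2 * (C₁ + 3 / 2 * c) ≤ M →
      ∀ ξ, E ξ (t + 1) ≤ M := by
    intro t ht M hM hMC ξ
    by_cases hex : ∃ s ∈ Icc t (t + 1), N ξ s ≤ c / γ
    · obtain ⟨s, hs, hNs⟩ := hex
      have hs0 : 0 < s := ht.trans_le hs.1
      obtain ⟨B, hB⟩ := hbdd s hs0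
      have h1 := hC₁ _ _ _ B (M + c) ((h.prim s hs0).shift ξ) ((h.path_u.mem s hs0).shift ξ)
        ((h.path_p.mem s hs0).shift ξ) ((h.path_q.mem s hs0).shift ξ) (fun x => hB _) hNs
        (fun η => by
          have h2 := hgrow (ξ + η) t s ht hs.1
          have h3 := hM (ξ + η)
          have h4 : c * (s - t) ≤ c * 1 := mul_le_mul_of_nonneg_left (by linarith [hs.2]) hc0
          simp only [hE, add_assoc] at h2 h3 ⊢
          linarith)
      have h2 := hgrow ξ s (t + 1) hs0 hs.2
      have h4 : c * (t + 1 - s) ≤ c * 1 := mul_le_mul_of_nonneg_left (by linarith [hs.1]) hc0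
      have h5 : E ξ s ≤ C₁ + (M + c) / 2 := h1
      linarith
    · push Not at hex
      have := sub_le_of_hasDerivAt_le (f := E ξ) (c := 0) (show t ≤ t + 1 by linarith) fun r hr => by
        obtain ⟨D, hD, hDle⟩ := hderiv ξ r (ht.trans_le hr.1)
        have h1 := hex r hr
        rw [div_lt_iff₀ hγ] at h1
        exact ⟨D, hD, hDle.trans (by linarith)⟩
      linarith [hM ξ]
  obtain ⟨M₀, hM₀⟩ : ∃ M₀, ∀ ξ, E ξ 1 ≤ M₀ := by
    obtain ⟨B, hB⟩ := hbdd 1 one_pos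
    obtain ⟨L, hL0, hL⟩ := exists_abs_comp_le hW1.continuous B
    obtain ⟨C, hC0, hC⟩ := exists_wI_shift_le hκ.ne'
    refine ⟨(α + δ + 1) * (C * (l2ulNorm (u 1)).toReal ^ 2 + C * (l2ulNorm (p 1)).toReal ^ 2 +
      C * (l2ulNorm (q 1)).toReal ^ 2) + L * wI κ (fun _ => 1) (fun _ => 1), fun ξ => ?_⟩
    have hu := h.path_u.mem 1 one_pos
    have hp := h.path_p.mem 1 one_pos
    have hq := h.path_q.mem 1 one_pos
    have j0 := (hasInt_energy (α := α) (δ := δ) hκ (hu.shift ξ) (hp.shift ξ) (hq.shift ξ)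
      (memL2ul_comp hW1 (hu.shift ξ) fun x => hB (ξ + x))).1
    have j1 := (((hasInt_wI_sq hκ (hu.shift ξ)).add (hasInt_wI_sq hκ (hp.shift ξ))).add
      (hasInt_wI_sq hκ (hq.shift ξ))).const_mul (α + δ + 1)
    have j2 := (hasInt_wI_sq hκ (memL2ul_const 1)).const_mul L
    have key := j0.mono (j1.add j2) fun x => by
      have hLx := (le_abs_self _).trans (hL _ (hB (ξ + x)))
      have h1 := energyDensity_le hα hδ hδα W (u 1 (ξ + x)) (p 1 (ξ + x)) (q 1 (ξ + x))
      have h2 := mul_le_mul_of_nonneg_left (h1.trans (add_le_add_right hLx _)) (sq_nonneg (wt κ x))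
      linarith
    refine key.trans ?_
    gcongr
    · exact hC _ hu ξ
    · exact hC _ hp ξ
    · exact hC _ hq ξ
  set M := max M₀ (2 * (C₁ + 3 / 2 * c)) with hM
  have hnat : ∀ n : ℕ, ∀ ξ, E ξ (1 + n) ≤ M := by
    intro n
    induction n with
    | zero => 
      intro ξ
      rw [Nat.cast_zero, add_zero]
      exact (hM₀ ξ).trans (le_max_left _ _)
    | succ n ih =>
      intro ξ
      have := hstep (1 + n) (by positivity) M ih (le_max_right _ _) ξ
      push_cast
      rwa [← add_assoc]
  have hall : ∀ t ≥ 1, ∀ ξ, E ξ t ≤ M + c := by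
    intro t ht ξ
    have h1 := Nat.floor_le (show 0 ≤ t - 1 by linarith)
    have h2 := Nat.lt_floor_add_one (t - 1)
    have h3 := hgrow ξ (1 + ⌊t - 1⌋₊) t (by positivity) (by linarith)
    have h4 : c * (t - (1 + ⌊t - 1⌋₊)) ≤ c * 1 := mul_le_mul_of_nonneg_left (by linarith) hc0
    linarith [hnat ⌊t - 1⌋₊ ξ]
  obtain ⟨m, hm0, hm1, hm2, hm3⟩ : ∃ m : ℝ, 0 < m ∧ m ≤ α / 4 ∧ m ≤ 1 / 2 ∧ m ≤ δ / 4 :=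
    ⟨min (α / 4) (min (1 / 2) (δ / 4)), by positivity, min_le_left _ _,
      (min_le_right _ _).trans (min_le_left _ _), (min_le_right _ _).trans (min_le_right _ _)⟩
  have hNall : ∀ t ≥ 1, ∀ ξ, N ξ t ≤ (M + c) / m := by
    intro t ht ξ
    have ht0 : 0 < t := by linarith
    obtain ⟨B, hB⟩ := hbdd t ht0
    rw [le_div_iff₀ hm0, mul_comm]
    refine le_trans ?_ (hall t ht ξ)
    have hu := (h.path_u.mem t ht0).shift ξ
    have hp := (h.path_p.mem t ht0).shift ξ
    have hq := (h.path_q.mem t ht0).shift ξ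
    have j0 := (hasInt_energy (α := α) (δ := δ) hκ hu hp hq
      (memL2ul_comp hW1 hu fun x => hB (ξ + x))).1
    refine ((((hasInt_wI_sq hκ hu).add (hasInt_wI_sq hκ hp)).add
      (hasInt_wI_sq hκ hq)).const_mul m).mono j0 fun x => ?_
    have h1 := energyDensity_ge hα hδ hδα W (u t (ξ + x)) (p t (ξ + x)) (q t (ξ + x))
    have h2 := mul_le_mul_of_nonneg_left h1 (sq_nonneg (wt κ x))
    have h3 : m * (u t (ξ + x) ^ 2 + p t (ξ + x) ^ 2 + q t (ξ + x) ^ 2) ≤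
        α / 4 * q t (ξ + x) ^ 2 + p t (ξ + x) ^ 2 / 2 + δ / 4 * u t (ξ + x) ^ 2 +
          W (u t (ξ + x)) := by
      have := hC₀ (u t (ξ + x))
      nlinarith [sq_nonneg (u t (ξ + x)), sq_nonneg (p t (ξ + x)), sq_nonneg (q t (ξ + x))]
    have h4 := mul_le_mul_of_nonneg_left h3 (sq_nonneg (wt κ x))
    linarith
  refine ⟨(wt κ 1)⁻¹ * √((M + c) / m), by have := wt_pos κ 1; positivity, fun t ht => ?_⟩
  have ht0 : 0 < t := by linarith
  have w1 := fun ξ => wI_self_nonneg κ (fun x => u t (ξ + x))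
  have w2 := fun ξ => wI_self_nonneg κ (fun x => p t (ξ + x))
  have w3 := fun ξ => wI_self_nonneg κ (fun x => q t (ξ + x))
  refine ⟨l2ulNorm_le_of_wI_shift_le hκ.ne' (h.path_u.mem t ht0) fun ξ => ?_,
    l2ulNorm_le_of_wI_shift_le hκ.ne' (h.path_p.mem t ht0) fun ξ => ?_,
    l2ulNorm_le_of_wI_shift_le hκ.ne' (h.path_q.mem t ht0) fun ξ => ?_⟩ <;>
  · have := hNall t ht ξ
    simp only [hN] at this
    linarith [w1 ξ, w2 ξ, w3 ξ]

/-! ### Uniform continuity for all positive times -/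

/-- The function (f - η/c) exp(c(s - t₀)) is nonincreasing. -/
lemma le_of_hasDerivAt_le_neg_mul {f : ℝ → ℝ} {c η t₀ : ℝ} (hc : 0 < c) (hη : 0 ≤ η)
    (h0 : 0 ≤ f t₀) (h : ∀ s ≥ t₀, ∃ D, HasDerivAt f D s ∧ D ≤ -c * f s + η) {t : ℝ} (ht : t₀ ≤ t) :
    f t ≤ f t₀ + η / c := by
  have key := sub_le_of_hasDerivAt_le (f := fun s => (f s - η / c) * Real.exp (c * (s - t₀)))
    (c := 0) ht fun s hs => by
      obtain ⟨D, hD, hDle⟩ := h s hs.1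
      have h1 : HasDerivAt (fun s => Real.exp (c * (s - t₀))) (Real.exp (c * (s - t₀)) * c) s := by
        have : HasDerivAt (fun s => c * (s - t₀)) c s := by
          simpa using ((hasDerivAt_id s).sub_const t₀).const_mul c
        exact this.exp
      refine ⟨_, (hD.sub_const (η / c)).mul h1, ?_⟩
      have h2 : D + c * (f s - η / c) ≤ 0 := by
        rw [mul_sub, mul_div_cancel₀ _ hc.ne']
        linarith
      nlinarith [Real.exp_pos (c * (s - t₀))]
  simp only [sub_self, mul_zero, Real.exp_zero, mul_one, zero_mul, sub_nonpos] at key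
  have h1 : 1 ≤ Real.exp (c * (t - t₀)) := Real.one_le_exp (mul_nonneg hc.le (by linarith))
  have h2 : 0 ≤ η / c := by positivity
  rcases le_total (f t) (η / c) with h3 | h3
  · linarith
  · nlinarith

/-- Linear stability: if the zeroth order part of a solution stays small for all times `≥ 1` and
the source is controlled by it, the solution stays small in the energy norm. -/
lemma WaveSystem.exists_linear_bound {α K : ℝ} (hα : 0 < α) (hK : 0 ≤ K) :
    ∃ C : ℝ, 0 < C ∧ ∀ (u p q G : ℝ → ℝ → ℝ) (η : ℝ), 0 ≤ η → WaveSystem α u p q G →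
      (∀ t ≥ 1, ∀ x, |G t x| ≤ K * |u t x|) →
      (∀ t ≥ 1, l2ulNorm (u t) ≤ ENNReal.ofReal η) → l2ulNorm (p 1) ≤ ENNReal.ofReal η →
      l2ulNorm (q 1) ≤ ENNReal.ofReal η → ∀ t ≥ 1, l2ulNorm (p t) ≤ ENNReal.ofReal (C * η) ∧
        l2ulNorm (q t) ≤ ENNReal.ofReal (C * η) := by
  obtain ⟨δ, κ, γ, hδ, hκ, hγ, hδα, hκ1, hκδ, hκa, hγ1, hγδ, hγa⟩ :=
    exists_energy_parameters hα one_pos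
  obtain ⟨C₀, hC₀0, hC₀⟩ := exists_wI_shift_le hκ.ne'
  -- A quadratic potential is coercive with a = 1, b = 0 and makes the energy comparable to N. The
  -- price is the forcing F = u - G, at most (1+K)|u|, whose weighted square integral is O(η²)
  -- because u is assumed small at all times.
  set W : ℝ → ℝ := fun z => z ^ 2 / 2 with hWdef
  have hW : ContDiff ℝ 2 W := by fun_prop
  have hdW : ∀ z, deriv W z = z := fun z => by simp [hWdef]
  set A : ℝ := α + δ + 2 with hA
  have hA0 : 0 < A := by positivity
  -- The energy at time 1 plus forcing divided by the decay rate γ/A, both in units of η².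
  set S : ℝ := A * (3 * C₀) + (1 + δ / 1) * (1 + K) ^ 2 * C₀ / (γ / A) with hS
  have hS0 : 0 < S := by positivity
  obtain ⟨m, hm0, hm1, hm2⟩ : ∃ m : ℝ, 0 < m ∧ m ≤ α / 4 ∧ m ≤ 1 / 2 :=
    ⟨min (α / 4) (1 / 2), by positivity, min_le_left _ _, min_le_right _ _⟩
  have hw := wt_pos κ 1
  refine ⟨(wt κ 1)⁻¹ * √(S / m), by positivity, fun u p q G η hη h hGu hu1 hp1 hq1 => ?_⟩
  have hsq : ∀ f, MemL2ul f → l2ulNorm f ≤ ENNReal.ofReal η → ∀ ξ,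
      wI κ (fun x => f (ξ + x)) (fun x => f (ξ + x)) ≤ C₀ * η ^ 2 := by
    intro f hf hfη ξ
    refine (hC₀ f hf ξ).trans ?_
    gcongr
    exact ENNReal.toReal_le_of_le_ofReal hη hfη
  have hW1 : ContDiff ℝ 1 W := hW.of_le (by norm_num)
  have hW0 : ∀ z, 0 ≤ W z := fun z => by positivity
  have hbdd : ∀ t > 0, ∃ B, ∀ x, |u t x| ≤ B := fun t ht => by
    obtain ⟨B, _, hB⟩ := h.eventually_abs_le ht
    exact ⟨B, hB.self_of_nhds⟩
  set E : ℝ → ℝ → ℝ := fun ξ t => energy κ α δ W (fun x => u t (ξ + x)) (fun x => p t (ξ + x))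
    (fun x => q t (ξ + x)) with hE
  have hEint : ∀ t > 0, ∀ ξ, HasInt (fun x => wt κ x ^ 2 *
      energyDensity α δ W (u t (ξ + x)) (p t (ξ + x)) (q t (ξ + x))) (E ξ t) := by
    intro t ht ξ
    obtain ⟨B, hB⟩ := hbdd t ht
    exact (hasInt_energy hκ ((h.path_u.mem t ht).shift ξ) ((h.path_p.mem t ht).shift ξ)
      ((h.path_q.mem t ht).shift ξ) (memL2ul_comp hW1 ((h.path_u.mem t ht).shift ξ)
        fun x => hB (ξ + x))).1
  have hEle : ∀ t > 0, ∀ ξ, E ξ t ≤ A * (wI κ (fun x => u t (ξ + x)) (fun x => u t (ξ + x)) +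
      wI κ (fun x => p t (ξ + x)) (fun x => p t (ξ + x)) +
      wI κ (fun x => q t (ξ + x)) (fun x => q t (ξ + x))) := by
    intro t ht ξ
    refine (hEint t ht ξ).mono ((((hasInt_wI_sq hκ ((h.path_u.mem t ht).shift ξ)).add
      (hasInt_wI_sq hκ ((h.path_p.mem t ht).shift ξ))).add
      (hasInt_wI_sq hκ ((h.path_q.mem t ht).shift ξ))).const_mul A) fun x => ?_
    have h1 := energyDensity_le hα hδ hδα W (u t (ξ + x)) (p t (ξ + x)) (q t (ξ + x))
    have h2 : energyDensity α δ W (u t (ξ + x)) (p t (ξ + x)) (q t (ξ + x)) ≤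
        A * (u t (ξ + x) ^ 2 + p t (ξ + x) ^ 2 + q t (ξ + x) ^ 2) := by
      simp only [hWdef] at h1
      nlinarith [sq_nonneg (u t (ξ + x)), sq_nonneg (p t (ξ + x)), sq_nonneg (q t (ξ + x))]
    have h3 := mul_le_mul_of_nonneg_left h2 (sq_nonneg (wt κ x))
    linarith
  have hEge : ∀ t > 0, ∀ ξ, m * (wI κ (fun x => p t (ξ + x)) (fun x => p t (ξ + x)) +
      wI κ (fun x => q t (ξ + x)) (fun x => q t (ξ + x))) ≤ E ξ t := by
    intro t ht ξ
    refine (((hasInt_wI_sq hκ ((h.path_p.mem t ht).shift ξ)).add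
      (hasInt_wI_sq hκ ((h.path_q.mem t ht).shift ξ))).const_mul m).mono (hEint t ht ξ) fun x => ?_
    have h1 := energyDensity_ge hα hδ hδα W (u t (ξ + x)) (p t (ξ + x)) (q t (ξ + x))
    have h2 : m * (p t (ξ + x) ^ 2 + q t (ξ + x) ^ 2) ≤
        energyDensity α δ W (u t (ξ + x)) (p t (ξ + x)) (q t (ξ + x)) := by
      have := hW0 (u t (ξ + x))
      have := mul_nonneg hδ.le (sq_nonneg (u t (ξ + x)))
      nlinarith [sq_nonneg (p t (ξ + x)), sq_nonneg (q t (ξ + x))]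
    have h3 := mul_le_mul_of_nonneg_left h2 (sq_nonneg (wt κ x))
    linarith
  have hE0 : ∀ t > 0, ∀ ξ, 0 ≤ E ξ t := fun t ht ξ => le_trans (mul_nonneg hm0.le
    (add_nonneg (wI_self_nonneg _ _) (wI_self_nonneg _ _))) (hEge t ht ξ)
  have hmain : ∀ ξ, ∀ t ≥ 1, E ξ t ≤ S * η ^ 2 := by
    intro ξ t ht
    have h1 := le_of_hasDerivAt_le_neg_mul (f := E ξ) (c := γ / A) (t₀ := 1)
      (η := (1 + δ / 1) * (1 + K) ^ 2 * (C₀ * η ^ 2)) (by positivity) (by positivity)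
      (hE0 1 one_pos ξ) (fun s hs => ?_) ht
    · have h2 := hEle 1 one_pos ξ
      have h3 := hsq _ (h.path_u.mem 1 one_pos) (hu1 1 le_rfl) ξ
      have h4 := hsq _ (h.path_p.mem 1 one_pos) hp1 ξ
      have h5 := hsq _ (h.path_q.mem 1 one_pos) hq1 ξ
      calc E ξ t ≤ _ := h1
        _ ≤ A * (C₀ * η ^ 2 + C₀ * η ^ 2 + C₀ * η ^ 2) +
          (1 + δ / 1) * (1 + K) ^ 2 * (C₀ * η ^ 2) / (γ / A) := by
            gcongr
            refine h2.trans ?_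
            gcongr
        _ = S * η ^ 2 := by rw [hS]; ring
    · have hs0 : 0 < s := by linarith [show 1 ≤ s from hs]
      have hsys := h.shift_space ξ
      obtain ⟨D, hD, hDle⟩ := hsys.exists_hasDerivAt_energy (F := fun t x => u t (ξ + x) - G t (ξ + x))
        (b := 0) hα hδ hδα hκ one_pos hκ1 hκδ hκa hγ1 hγδ hγa hW
        (fun z => by rw [hdW]; nlinarith) (hsys.path_u.sub hsys.path_G)
        (fun t x => by rw [hdW]; ring) hs0
      refine ⟨D, hD, hDle.trans ?_⟩
      have hF : wI κ (fun x => u s (ξ + x) - G s (ξ + x)) (fun x => u s (ξ + x) - G s (ξ + x)) ≤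
          (1 + K) ^ 2 * (C₀ * η ^ 2) := by
        refine le_trans ?_ (mul_le_mul_of_nonneg_left (hsq _ (h.path_u.mem s hs0) (hu1 s hs) ξ)
          (by positivity))
        refine (hasInt_wI_sq hκ ((hsys.path_u.sub hsys.path_G).mem s hs0)).mono
          ((hasInt_wI_sq hκ (hsys.path_u.mem s hs0)).const_mul _) fun x => ?_
        have h1 : |u s (ξ + x) - G s (ξ + x)| ≤ (1 + K) * |u s (ξ + x)| := by
          have := abs_sub (u s (ξ + x)) (G s (ξ + x))
          have := hGu s hs (ξ + x)
          linarith
        have h2 : (u s (ξ + x) - G s (ξ + x)) ^ 2 ≤ (1 + K) ^ 2 * u s (ξ + x) ^ 2 := by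
          rw [← sq_abs, ← sq_abs (u s (ξ + x)), ← mul_pow]
          gcongr
        have h3 := mul_le_mul_of_nonneg_left h2 (sq_nonneg (wt κ x))
        linarith
      have h1 := hEle s hs0 ξ
      have h2 := mul_le_mul_of_nonneg_left h1 (show 0 ≤ γ / A by positivity)
      rw [← mul_assoc, div_mul_cancel₀ _ hA0.ne'] at h2
      have h3 := mul_le_mul_of_nonneg_left hF (show 0 ≤ 1 + δ / 1 by positivity)
      linarith
  intro t ht
  have ht0 : 0 < t := by linarith
  have hfin : (wt κ 1)⁻¹ * √(S * η ^ 2 / m) = (wt κ 1)⁻¹ * √(S / m) * η := by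
    rw [mul_div_right_comm, Real.sqrt_mul (by positivity), Real.sqrt_sq hη, mul_assoc]
  rw [← hfin]
  refine ⟨l2ulNorm_le_of_wI_shift_le hκ.ne' (h.path_p.mem t ht0) fun ξ => ?_,
    l2ulNorm_le_of_wI_shift_le hκ.ne' (h.path_q.mem t ht0) fun ξ => ?_⟩ <;>
  · rw [le_div_iff₀ hm0]
    have h1 := hEge t ht0 ξ
    have h2 := hmain ξ t ht
    have h3 := wI_self_nonneg κ (fun x => p t (ξ + x))
    have h4 := wI_self_nonneg κ (fun x => q t (ξ + x))
    nlinarith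

/-! ### Moduli of continuity under translations in space and time -/

lemma MemL2ul.tendsto_shift {f : ℝ → ℝ} (hf : MemL2ul f) :
    Tendsto (fun h : ℝ => l2ulNorm (fun x => f (h + x) - f x)) (𝓝 0) (𝓝 0) := by
  have h1 : Tendsto (fun h : ℝ => -h) (𝓝 0) (𝓝 0) := by
    simpa using (continuous_neg (G := ℝ)).tendsto 0
  refine (hf.2.2.comp h1).congr fun h => ?_
  simp only [Function.comp, sub_neg_eq_add, add_comm h]

lemma l2ulNorm_shift_sub_le {f g : ℝ → ℝ} (hf : MemL2ul f) (hg : MemL2ul g) (h : ℝ) :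
    l2ulNorm (fun x => g (h + x) - f x) ≤
      l2ulNorm (fun x => g x - f x) + l2ulNorm (fun x => f (h + x) - f x) := by
  rw [← l2ulNorm_shift (fun x => g x - f x) h]
  refine le_trans (le_of_eq ?_) (l2ulNorm_add_le ((hg.sub hf).shift h).1 ((hf.shift h).sub hf).1)
  congr 1
  ext x
  ring

lemma UlPath.tendsto_shift {f : ℝ → ℝ → ℝ} (hf : UlPath f) {t : ℝ} (ht : 0 < t) {ε : ℝ≥0∞}
    (hε : 0 < ε) : ∃ r > 0, ∀ h k : ℝ, |h| < r → |k| < r →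
      l2ulNorm (fun x => f (t + k) (h + x) - f t x) ≤ ε := by
  have hε2 : 0 < ε / 2 := ENNReal.half_pos hε.ne'
  obtain ⟨r₁, hr₁, h₁⟩ := Metric.eventually_nhds_iff.1
    ((hf.mem t ht).tendsto_shift.eventually_lt_const hε2)
  obtain ⟨r₂, hr₂, h₂⟩ := Metric.eventually_nhds_iff.1
    (((hf.cont t ht).eventually_lt_const hε2).and (eventually_pos_nhds ht))
  refine ⟨min r₁ r₂, lt_min hr₁ hr₂, fun h k hh hk => ?_⟩
  have e2 := h₂ (y := t + k) (by simpa [Real.dist_eq] using hk.trans_le (min_le_right _ _))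
  refine (l2ulNorm_shift_sub_le (hf.mem t ht) (hf.mem _ e2.2) h).trans ?_
  have e1 := h₁ (y := h) (by simpa [Real.dist_eq] using hh.trans_le (min_le_left _ _))
  rw [← ENNReal.add_halves ε]
  exact add_le_add e2.1.le e1.le

/-- Mean value inequality along translations. The choice g = 0 gives a Lipschitz bound, and g = p an
error estimate for difference quotients; both are needed, as are the two analogous choices in the
time version below. -/
lemma exists_l2ulNorm_shift_sub_le : ∃ C : ℝ, 0 < C ∧ ∀ (u p g : ℝ → ℝ) (h M : ℝ), 0 ≤ M →
    IsPrimitive u p → MemL2ul u → MemL2ul p → MemL2ul g →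
    (∀ s ∈ uIcc 0 h, l2ulNorm (fun x => p (s + x) - g x) ≤ ENNReal.ofReal M) →
    l2ulNorm (fun x => u (h + x) - u x - h * g x) ≤ ENNReal.ofReal (C * M * |h|) := by
  obtain ⟨C, hC0, hC⟩ := exists_l2ulNorm_sub_le_of_weak_hasDerivAt
  refine ⟨C, hC0, fun u p g h M hM hup hu hp hg hle => ?_⟩
  have := hC (fun s x => u (s + x)) (fun s x => p (s + x)) g 0 h M hM hg
    (fun s _ => hu.shift s) (fun s _ => hp.shift s)
    (fun φ hφ s _ => hup.hasDerivAt_integral_shift hφ s)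
    (Eventually.of_forall fun s => hu.shift s) hle
  simpa using this

lemma WaveSystem.exists_l2ulNorm_sub_le : ∃ C : ℝ, 0 < C ∧ ∀ (α : ℝ) (u p q G : ℝ → ℝ → ℝ)
    (g : ℝ → ℝ) (t t' M : ℝ), 0 ≤ M → WaveSystem α u p q G → 0 < t → 0 < t' → MemL2ul g →
    (∀ s ∈ uIcc t t', l2ulNorm (fun x => q s x - g x) ≤ ENNReal.ofReal M) →
    l2ulNorm (fun x => u t' x - u t x - (t' - t) * g x) ≤ ENNReal.ofReal (C * M * |t' - t|) := by
  obtain ⟨C, hC0, hC⟩ := exists_l2ulNorm_sub_le_of_weak_hasDerivAt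
  refine ⟨C, hC0, fun α u p q G g t t' M hM h ht ht' hg hle => ?_⟩
  have hpos : ∀ s ∈ uIcc t t', 0 < s := fun s hs =>
    (lt_min ht ht').trans_le hs.1
  refine hC u q g t t' M hM hg (fun s hs => h.path_u.mem s (hpos s hs))
    (fun s hs => h.path_q.mem s (hpos s hs)) (fun φ hφ s hs => h.deriv_u φ hφ s (hpos s hs)) ?_ hle
  have : Ioi (0 : ℝ) ∈ 𝓝ˢ (uIcc t t') := isOpen_Ioi.mem_nhdsSet.2 fun s hs => hpos s hs
  filter_upwards [this] with s hs
  exact h.path_u.mem s hs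

/-- Solutions are uniformly continuous in the energy norm with respect to translations in space and
in time. -/
lemma WaveSystem.exists_modulus {α : ℝ} {u p q : ℝ → ℝ → ℝ} {V : ℝ → ℝ}
    (h : WaveSystem α u p q (fun t x => deriv V (u t x))) (hα : 0 < α) (hV : ContDiff ℝ 2 V) {B : ℝ}
    (hB0 : 0 ≤ B) (hBp : ∀ t ≥ 1, l2ulNorm (p t) ≤ ENNReal.ofReal B)
    (hBq : ∀ t ≥ 1, l2ulNorm (q t) ≤ ENNReal.ofReal B) (hBu : ∀ t ≥ 1, ∀ x, |u t x| ≤ B)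
    {ε : ℝ} (hε : 0 < ε) : ∃ r > 0, ∀ t ≥ 1, ∀ h k : ℝ, |h| < r → 0 ≤ k → k < r →
      l2ulNorm (fun x => u (t + k) (h + x) - u t x) ≤ ENNReal.ofReal ε ∧
      l2ulNorm (fun x => p (t + k) (h + x) - p t x) ≤ ENNReal.ofReal ε ∧
      l2ulNorm (fun x => q (t + k) (h + x) - q t x) ≤ ENNReal.ofReal ε := by
  obtain ⟨K, hK0, hK⟩ := exists_lipschitz_on_bounded (hV.iterate_deriv' 1 1) B
  obtain ⟨C, hC0, hC⟩ := WaveSystem.exists_linear_bound hα hK0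
  obtain ⟨C₁, hC₁0, hC₁⟩ := exists_l2ulNorm_shift_sub_le
  obtain ⟨C₂, hC₂0, hC₂⟩ := WaveSystem.exists_l2ulNorm_sub_le
  -- The first entry serves u, the second serves p and q after the loss of C in the linear bound.
  set η : ℝ := min ε (ε / C) with hη
  have hη0 : 0 < η := by positivity
  have hη' : 0 < ENNReal.ofReal η := by simpa using hη0
  obtain ⟨r₁, hr₁, h₁⟩ := h.path_p.tendsto_shift one_pos hη'
  obtain ⟨r₂, hr₂, h₂⟩ := h.path_q.tendsto_shift one_pos hη'
  set r₃ : ℝ := η / (2 * (C₁ * B + C₂ * B + 1)) with hr₃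
  have hr₃0 : 0 < r₃ := by positivity
  refine ⟨min r₁ (min r₂ r₃), by positivity, fun t ht h' k hh hk0 hk => ?_⟩
  have hk1 : |k| < min r₁ (min r₂ r₃) := by rwa [abs_of_nonneg hk0]
  have hsys := (h.shift hk0 h').sub h
  -- Boundedness of p and q makes the position difference small at every time, not only initially;
  -- this is the hypothesis of the linear bound. For p and q, smallness is needed only at time 1.
  have hu : ∀ t ≥ 1, l2ulNorm (fun x => u (t + k) (h' + x) - u t x) ≤ ENNReal.ofReal η := by
    intro t ht
    have ht1 : 1 ≤ t := ht
    have ht0 : 0 < t := by linarith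
    have htk : 1 ≤ t + k := by linarith
    have htk0 : 0 < t + k := by linarith
    have e1 := hC₁ (u (t + k)) (p (t + k)) (fun _ => 0) h' B hB0 (h.prim _ htk0)
      (h.path_u.mem _ htk0) (h.path_p.mem _ htk0) (memL2ul_const 0) (fun s _ => by
        simp only [sub_zero]
        rw [l2ulNorm_shift (p (t + k))]
        exact hBp _ htk)
    have e2 := hC₂ α u p q _ (fun _ => 0) t (t + k) B hB0 h ht0 htk0 (memL2ul_const 0) (fun s hs => by
        simp only [sub_zero]
        exact hBq _ (by
          rw [uIcc_of_le (by linarith)] at hs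
          exact ht1.trans hs.1))
    simp only [mul_zero, sub_zero, add_sub_cancel_left] at e1 e2
    have hm1 := ((h.path_u.mem _ htk0).shift h').sub (h.path_u.mem _ htk0)
    have hm2 := (h.path_u.mem _ htk0).sub (h.path_u.mem _ ht0)
    calc l2ulNorm (fun x => u (t + k) (h' + x) - u t x) = l2ulNorm (fun x =>
          (u (t + k) (h' + x) - u (t + k) x) + (u (t + k) x - u t x)) := by
          congr 1
          ext x
          ring
      _ ≤ ENNReal.ofReal (C₁ * B * |h'|) + ENNReal.ofReal (C₂ * B * |k|) :=
          (l2ulNorm_add_le hm1.1 hm2.1).trans (add_le_add e1 e2)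
      _ = ENNReal.ofReal (C₁ * B * |h'| + C₂ * B * |k|) :=
          (ENNReal.ofReal_add (by positivity) (by positivity)).symm
      _ ≤ ENNReal.ofReal η := by
          refine ENNReal.ofReal_le_ofReal ?_
          have a1 : |h'| ≤ r₃ := (hh.trans_le ((min_le_right _ _).trans (min_le_right _ _))).le
          have a2 : |k| ≤ r₃ := (hk1.trans_le ((min_le_right _ _).trans (min_le_right _ _))).le
          calc C₁ * B * |h'| + C₂ * B * |k| ≤ C₁ * B * r₃ + C₂ * B * r₃ := by gcongr
            _ ≤ 2 * (C₁ * B + C₂ * B + 1) * r₃ := by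
              have : 0 ≤ (C₁ * B + C₂ * B) * r₃ := by positivity
              nlinarith
            _ = η := by rw [hr₃]; field_simp
  have hp1 := h₁ h' k (hh.trans_le (min_le_left _ _)) (hk1.trans_le (min_le_left _ _))
  have hq1 := h₂ h' k (hh.trans_le ((min_le_right _ _).trans (min_le_left _ _)))
    (hk1.trans_le ((min_le_right _ _).trans (min_le_left _ _)))
  have key := hC _ _ _ _ η hη0.le hsys (fun t ht x => hK _ _ (hBu t ht x)
    (hBu (t + k) (by linarith [show 1 ≤ t from ht]) _)) hu hp1 hq1 t ht
  have hCη : C * η ≤ ε := by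
    calc C * η ≤ C * (ε / C) := by gcongr; exact min_le_right _ _
      _ = ε := by field_simp
  exact ⟨(hu t ht).trans (ENNReal.ofReal_le_ofReal (min_le_left _ _)),
    key.1.trans (ENNReal.ofReal_le_ofReal hCη), key.2.trans (ENNReal.ofReal_le_ofReal hCη)⟩

/-! ### Weak solutions of the damped wave equation as wave systems -/

lemma exists_abs_integral_mul_test_le {φ : ℝ → ℝ} (hφ : IsTestFunction φ) : ∃ C : ℝ, 0 ≤ C ∧
    ∀ f : ℝ → ℝ, MemLp (fun x => wt 1 x * f x) 2 volume →
      |∫ x, f x * φ x| ≤ C * (wNorm 1 f).toReal := by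
  have h1 : IsTestFunction (fun x => (1 + (1 * x) ^ 2) * φ x) := hφ.mul_left (by fun_prop)
  refine ⟨‖h1.toL2‖, norm_nonneg _, fun f hf => ?_⟩
  have e : ∫ x, f x * φ x = inner ℝ (hf.toLp _) h1.toL2 := by
    rw [IsTestFunction.inner_toLp]
    congr 1
    ext x
    unfold wt
    field_simp
  rw [e, mul_comm]
  refine (abs_real_inner_le_norm _ _).trans (le_of_eq ?_)
  rw [Lp.norm_toLp]
  rfl

lemma MemL2ul.locallyIntegrable {f : ℝ → ℝ} (hf : MemL2ul f) : LocallyIntegrable f := by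
  have h1 := ((hf.memLp_wt_mul one_ne_zero).locallyIntegrable (by norm_num))
  rw [locallyIntegrable_iff] at h1 ⊢
  intro k hk
  have h2 := (h1 k hk).continuousOn_mul (g := fun x => 1 + (1 * x) ^ 2)
    (by fun_prop : Continuous fun x : ℝ => 1 + (1 * x) ^ 2).continuousOn hk
  refine h2.congr (ae_of_all _ fun x => ?_)
  unfold wt
  field_simp

lemma hasWeakDeriv_weakDeriv {f : ℝ → ℝ} (h : ∃ g, HasWeakDeriv f g) :
    HasWeakDeriv f (weakDeriv f) := by
  have e : weakDeriv f = h.choose := dif_pos h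
  rw [e]
  exact h.choose_spec

lemma le_sqrt_sq_add_sq (a b : ℝ≥0∞) : a ≤ (a ^ 2 + b ^ 2) ^ (1 / 2 : ℝ) := by
  calc a = (a ^ 2) ^ (1 / 2 : ℝ) := by
        rw [← ENNReal.rpow_natCast, ← ENNReal.rpow_mul]
        norm_num
    _ ≤ _ := by gcongr; exact le_self_add

lemma sqrt_sq_add_sq_le (a b : ℝ≥0∞) : (a ^ 2 + b ^ 2) ^ (1 / 2 : ℝ) ≤ a + b := by
  calc (a ^ 2 + b ^ 2) ^ (1 / 2 : ℝ) ≤ ((a + b) ^ 2) ^ (1 / 2 : ℝ) := by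
        gcongr
        calc a ^ 2 + b ^ 2 ≤ a ^ 2 + b ^ 2 + 2 * a * b := le_self_add
          _ = (a + b) ^ 2 := by ring
    _ = a + b := by
        rw [← ENNReal.rpow_natCast, ← ENNReal.rpow_mul]
        norm_num

lemma l2ulNorm_le_h1ulNorm (f : ℝ → ℝ) : l2ulNorm f ≤ h1ulNorm f := le_sqrt_sq_add_sq _ _

lemma l2ulNorm_weakDeriv_le_h1ulNorm (f : ℝ → ℝ) : l2ulNorm (weakDeriv f) ≤ h1ulNorm f := by
  unfold h1ulNorm
  rw [add_comm]
  exact le_sqrt_sq_add_sq _ _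

lemma UlPath.comp {u : ℝ → ℝ → ℝ} (hu : UlPath u) {F : ℝ → ℝ} (hF : ContDiff ℝ 1 F)
    (hB : ∀ t > 0, ∃ B : ℝ, 0 ≤ B ∧ ∀ᶠ s in 𝓝 t, ∀ x, |u s x| ≤ B) :
    UlPath (fun t x => F (u t x)) := by
  refine ⟨fun t ht => ?_, fun t ht => ?_⟩
  · obtain ⟨B, _, hB⟩ := hB t ht
    exact memL2ul_comp hF (hu.mem t ht) hB.self_of_nhds
  · obtain ⟨B, _, hB⟩ := hB t ht
    obtain ⟨K, _, hK⟩ := exists_lipschitz_on_bounded hF B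
    refine tendsto_ennreal_zero_mul K (hu.cont t ht) ?_
    filter_upwards [hB] with s hs
    exact l2ulNorm_le_mul fun x => hK _ _ (hB.self_of_nhds x) (hs x)

/-- Absolutely continuous representatives of the u t make pointwise bounds meaningful. At positive
times the one-sided limits within `Ici 0` become two-sided, and u_xx is replaced by the weak
derivative of p. -/
lemma IsDampedWaveSolution.exists_waveSystem {α : ℝ} {V : ℝ → ℝ} (hV : ContDiff ℝ 2 V)
    {u ut : ℝ → ℝ → ℝ} (h : IsDampedWaveSolution α V (Ici 0) u ut) :
    ∃ w : ℝ → ℝ → ℝ, (∀ t ≥ 0, u t =ᵐ[volume] w t) ∧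
      WaveSystem α w (fun t => weakDeriv (u t)) ut (fun t x => deriv V (w t x)) := by
  have hE := h.energyPath
  have hex : ∀ t : ℝ, ∃ w : ℝ → ℝ, 0 ≤ t → u t =ᵐ[volume] w ∧ IsPrimitive w (weakDeriv (u t)) := by
    intro t
    by_cases ht : 0 ≤ t
    · obtain ⟨w, hw⟩ := (hasWeakDeriv_weakDeriv (hE.memH1ul t ht).2.1).exists_isPrimitive
      exact ⟨w, fun _ => hw⟩
    · exact ⟨0, fun h' => absurd h' ht⟩
  choose w hw using hex
  have hnhds : ∀ t : ℝ, 0 < t → 𝓝[Ici 0] t = 𝓝 t := fun t ht =>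
    nhdsWithin_eq_nhds.2 (Ici_mem_nhds ht)
  have hae : ∀ s t, 0 ≤ s → 0 ≤ t → (fun x => w s x - w t x) =ᵐ[volume] u s - u t := by
    intro s t hs ht
    filter_upwards [(hw s hs).1, (hw t ht).1] with x h1 h2
    rw [Pi.sub_apply, h1, h2]
  have path_u : UlPath w := by
    refine ⟨fun t ht => (hE.memH1ul t ht.le).1.congr_ae (hw t ht.le).1, fun t ht => ?_⟩
    have h1 := hE.continuous_h1ul t ht.le
    rw [hnhds t ht] at h1
    refine tendsto_of_tendsto_of_tendsto_of_le_of_le' tendsto_const_nhds h1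
      (Eventually.of_forall fun _ => zero_le) ?_
    filter_upwards [eventually_pos_nhds ht] with s hs
    rw [l2ulNorm_congr_ae (hae s t hs.le ht.le)]
    exact l2ulNorm_le_h1ulNorm _
  have path_p : UlPath (fun t => weakDeriv (u t)) := by
    refine ⟨fun t ht => (hE.memH1ul t ht.le).2.2, fun t ht => ?_⟩
    have h1 := hE.continuous_h1ul t ht.le
    rw [hnhds t ht] at h1
    refine tendsto_of_tendsto_of_tendsto_of_le_of_le' tendsto_const_nhds h1
      (Eventually.of_forall fun _ => zero_le) ?_
    filter_upwards [eventually_pos_nhds ht] with s hs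
    have h2 := (hasWeakDeriv_weakDeriv (hE.memH1ul s hs.le).2.1).sub
      (hasWeakDeriv_weakDeriv (hE.memH1ul t ht.le).2.1)
    rw [← l2ulNorm_congr_ae h2.weakDeriv_ae_eq]
    exact l2ulNorm_weakDeriv_le_h1ulNorm (u s - u t)
  have path_q : UlPath ut := by
    refine ⟨fun t ht => hE.memL2ul t ht.le, fun t ht => ?_⟩
    have h1 := hE.continuous_l2ul t ht.le
    rwa [hnhds t ht] at h1
  have hprim : ∀ t > 0, IsPrimitive (w t) (weakDeriv (u t)) := fun t ht => (hw t ht.le).2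
  refine ⟨w, fun t ht => (hw t ht).1, path_u, path_p, path_q,
    path_u.comp (hV.iterate_deriv' 1 1) fun t ht => path_u.eventually_abs_le path_p hprim ht,
    hprim, fun φ hφ t ht => ?_, fun φ hφ t ht => ?_⟩
  · rw [hasDerivAt_iff_tendsto_slope, tendsto_iff_norm_sub_tendsto_zero]
    obtain ⟨C, hC0, hC⟩ := exists_abs_integral_mul_test_le hφ
    obtain ⟨C', hC0', hC'⟩ := exists_wNorm_le one_ne_zero
    have h1 := hE.hasDeriv_l2ul t ht.le
    have e1 : 𝓝[Ici 0 \ {t}] t = 𝓝[≠] t := by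
      rw [sdiff_eq, nhdsWithin_inter, hnhds t ht]
      exact inf_of_le_right nhdsWithin_le_nhds
    rw [e1] at h1
    have hmem : ∀ s > 0, MemL2ul (fun x => (s - t)⁻¹ * (w s x - w t x) - ut t x) := fun s hs =>
      (((path_u.mem s hs).sub (path_u.mem t ht)).const_mul _).sub (path_q.mem t ht)
    have h2 : Tendsto (fun s => l2ulNorm (fun x => (s - t)⁻¹ * (w s x - w t x) - ut t x))
        (𝓝[≠] t) (𝓝 0) := by
      refine h1.congr' ?_
      filter_upwards [(eventually_pos_nhds ht).filter_mono nhdsWithin_le_nhds] with s hs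
      refine l2ulNorm_congr_ae ?_
      filter_upwards [hae s t hs.le ht.le] with x hx
      rw [Pi.sub_apply, Pi.smul_apply, ← hx, smul_eq_mul]
    have h3 : Tendsto (fun s => wNorm 1 (fun x => (s - t)⁻¹ * (w s x - w t x) - ut t x))
        (𝓝[≠] t) (𝓝 0) := by
      refine tendsto_ennreal_zero_mul C' h2 ?_
      filter_upwards [(eventually_pos_nhds ht).filter_mono nhdsWithin_le_nhds] with s hs
      exact hC' _ (hmem s hs).1
    have h4 := ((ENNReal.tendsto_toReal ENNReal.zero_ne_top).comp h3).const_mul C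
    rw [ENNReal.toReal_zero, mul_zero] at h4
    refine squeeze_zero' (Eventually.of_forall fun _ => norm_nonneg _) ?_ h4
    filter_upwards [(eventually_pos_nhds ht).filter_mono nhdsWithin_le_nhds] with s hs
    refine le_trans (le_of_eq ?_) (hC _ ((hmem s hs).memLp_wt_mul one_ne_zero))
    have i1 := ((HasInt.of_integrable ((path_u.mem s hs).integrable_mul_test hφ)).sub
      (HasInt.of_integrable ((path_u.mem t ht).integrable_mul_test hφ))).const_mul (s - t)⁻¹
    have i2 := i1.sub (HasInt.of_integrable ((path_q.mem t ht).integrable_mul_test hφ))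
    rw [Real.norm_eq_abs, slope_def_field, div_eq_inv_mul, ← i2.2]
    congr 2
    ext x
    ring
  · have h1 := (h.equation φ hφ t ht.le).hasDerivAt (Ici_mem_nhds ht)
    refine h1.congr_deriv ?_
    have e1 : ∫ x, u t x * deriv (deriv φ) x = ∫ x, w t x * deriv (deriv φ) x :=
      integral_congr_ae ((hw t ht.le).1.mono fun x hx => by simp only [hx])
    have e2 : ∫ x, deriv V (u t x) * φ x = ∫ x, deriv V (w t x) * φ x :=
      integral_congr_ae ((hw t ht.le).1.mono fun x hx => by simp only [hx])
    rw [e1, e2, (hprim t ht).hasWeakDeriv.2.2 _ hφ.deriv]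

/-! ### Convergence of sequences of paths -/

lemma wNorm_add_le {κ : ℝ} {f g : ℝ → ℝ} (hf : AEStronglyMeasurable f volume)
    (hg : AEStronglyMeasurable g volume) :
    wNorm κ (fun x => f x + g x) ≤ wNorm κ f + wNorm κ g := by
  have hw := (continuous_wt κ).aestronglyMeasurable (μ := volume)
  refine le_trans (le_of_eq ?_) (eLpNorm_add_le (hw.mul hf) (hw.mul hg) (by norm_num))
  unfold wNorm
  congr 1
  ext x
  simp only [Pi.add_apply]
  ring

lemma wNorm_le_mul {κ : ℝ} {f g : ℝ → ℝ} {c : ℝ} (h : ∀ x, |f x| ≤ c * |g x|) :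
    wNorm κ f ≤ ENNReal.ofReal c * wNorm κ g := by
  refine eLpNorm_le_mul_eLpNorm_of_ae_le_mul (ae_of_all _ fun x => ?_) 2
  rw [norm_mul, norm_mul, mul_left_comm]
  exact mul_le_mul_of_nonneg_left (h x) (norm_nonneg _)

/-- A family of bounded functions that is small on a large interval is small in the weighted
norm. -/
lemma exists_wNorm_le_of_abs_le (B : ℝ) {η : ℝ} (hη : 0 < η) : ∃ R ε : ℝ, 0 < R ∧ 0 < ε ∧
    ∀ f : ℝ → ℝ, (∀ x, |f x| ≤ B) → (∀ x, |x| ≤ R → |f x| ≤ ε) →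
      wNorm 1 f ≤ ENNReal.ofReal η := by
  set I : ℝ := ∫ x, wt 1 x with hI
  have hI0 : 0 ≤ I := integral_nonneg fun x => (wt_pos 1 x).le
  obtain ⟨ε, hε0, hε⟩ : ∃ ε : ℝ, 0 < ε ∧ ε ^ 2 * I ≤ η ^ 2 / 2 := by
    refine ⟨η / √(2 * (I + 1)), by positivity, ?_⟩
    rw [div_pow, Real.sq_sqrt (by positivity), div_mul_eq_mul_div,
      div_le_div_iff₀ (by positivity) (by norm_num)]
    nlinarith [sq_nonneg η]
  obtain ⟨R, hR0, hR⟩ : ∃ R : ℝ, 0 < R ∧ B ^ 2 * wt 1 R * I ≤ η ^ 2 / 2 := by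
    refine ⟨√(2 * (B ^ 2 * I + 1) / η ^ 2), by positivity, ?_⟩
    have h1 : wt 1 (√(2 * (B ^ 2 * I + 1) / η ^ 2)) ≤ η ^ 2 / (2 * (B ^ 2 * I + 1)) := by
      unfold wt
      rw [one_mul, Real.sq_sqrt (by positivity)]
      refine (inv_anti₀ (by positivity) (le_add_of_nonneg_left zero_le_one)).trans ?_
      rw [inv_div]
    calc B ^ 2 * wt 1 _ * I ≤ B ^ 2 * (η ^ 2 / (2 * (B ^ 2 * I + 1))) * I := by gcongr
      _ = η ^ 2 * (B ^ 2 * I) / (2 * (B ^ 2 * I + 1)) := by ring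
      _ ≤ η ^ 2 / 2 := by
        rw [div_le_div_iff₀ (by positivity) (by norm_num)]
        nlinarith [sq_nonneg η]
  refine ⟨R, ε, hR0, hε0, fun f hfB hfε => ?_⟩
  rw [← sq_le_sq_iff_ennreal, wNorm, eLpNorm_two_sq]
  have hpt : ∀ x, ‖wt 1 x * f x‖ₑ ^ 2 ≤ ENNReal.ofReal ((ε ^ 2 + B ^ 2 * wt 1 R) * wt 1 x) := by
    intro x
    have hw := wt_pos 1 x
    have hw1 := wt_le_one 1 x
    have hwR := wt_pos 1 R
    rw [Real.enorm_eq_ofReal_abs, ← ENNReal.ofReal_pow (abs_nonneg _), sq_abs, mul_pow]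
    refine ENNReal.ofReal_le_ofReal ?_
    have hww : wt 1 x ^ 2 ≤ wt 1 x := by nlinarith
    rcases le_total |x| R with hx | hx
    · have h1 : f x ^ 2 ≤ ε ^ 2 := by
        rw [← sq_abs]
        gcongr
        exact hfε x hx
      have h2 : 0 ≤ B ^ 2 * wt 1 R * wt 1 x := by positivity
      calc wt 1 x ^ 2 * f x ^ 2 ≤ wt 1 x * ε ^ 2 := by gcongr
        _ ≤ _ := by linarith
    · have h1 : wt 1 x ≤ wt 1 R := by
        have := wt_ge_of_abs_le (κ := 1) (x := R) (R := |x|) (by rwa [abs_of_pos hR0])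
        simpa [wt] using this
      have h3 : f x ^ 2 ≤ B ^ 2 := by
        rw [← sq_abs]
        gcongr
        exact hfB x
      have h2 : 0 ≤ ε ^ 2 * wt 1 x := by positivity
      calc wt 1 x ^ 2 * f x ^ 2 = wt 1 x * wt 1 x * f x ^ 2 := by ring
        _ ≤ wt 1 R * wt 1 x * B ^ 2 := by gcongr
        _ ≤ _ := by linarith
  calc ∫⁻ x, ‖wt 1 x * f x‖ₑ ^ 2
      ≤ ∫⁻ x, ENNReal.ofReal ((ε ^ 2 + B ^ 2 * wt 1 R) * wt 1 x) := lintegral_mono hpt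
    _ = ENNReal.ofReal ((ε ^ 2 + B ^ 2 * wt 1 R) * I) := by
      have hwR := wt_pos 1 R
      rw [← ofReal_integral_eq_lintegral_ofReal ((integrable_wt one_ne_zero).const_mul _)
        (ae_of_all _ fun x => mul_nonneg (by positivity) (wt_pos 1 x).le), integral_const_mul]
    _ ≤ ENNReal.ofReal η ^ 2 := by
      rw [← ENNReal.ofReal_pow hη.le]
      refine ENNReal.ofReal_le_ofReal ?_
      linarith

/-- Convergence of a sequence of paths in the weighted norm, uniformly on bounded time
intervals. -/
def WConv (X : ℕ → ℝ → ℝ → ℝ) (Y : ℝ → ℝ → ℝ) : Prop :=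
  ∀ T : ℝ, ∀ η > 0, ∃ N, ∀ n ≥ N, ∀ τ, |τ| ≤ T →
    wNorm 1 (fun y => X n τ y - Y τ y) ≤ ENNReal.ofReal η

/-- Multiplication by the weight reduces the claim to completeness of L² at each time; the Cauchy
index does not depend on τ, so neither does the rate of convergence. -/
lemma exists_wConv_of_cauchy {X : ℕ → ℝ → ℝ → ℝ} (hX : ∀ n τ, MemL2ul (X n τ))
    (hc : ∀ T : ℝ, ∀ η > 0, ∃ N, ∀ n ≥ N, ∀ m ≥ N, ∀ τ, |τ| ≤ T →
      wNorm 1 (fun y => X n τ y - X m τ y) ≤ ENNReal.ofReal η) :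
    ∃ Y : ℝ → ℝ → ℝ, (∀ τ, AEStronglyMeasurable (Y τ) volume) ∧ WConv X Y := by
  set a : ℕ → ℝ → L2R := fun n τ => mulL2 (wt 1) (X n τ) with ha
  have hm : ∀ n τ, MemLp (fun x => wt 1 x * X n τ x) 2 volume := fun n τ =>
    (hX n τ).memLp_wt_mul one_ne_zero
  have hnorm : ∀ T : ℝ, ∀ η > 0, ∃ N, ∀ n ≥ N, ∀ m ≥ N, ∀ τ, |τ| ≤ T → ‖a n τ - a m τ‖ ≤ η := by
    intro T η hη
    obtain ⟨N, hN⟩ := hc T η hη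
    refine ⟨N, fun n hn m hm' τ hτ => ?_⟩
    rw [ha, norm_mulL2_sub (hm n τ) (hm m τ)]
    exact ENNReal.toReal_le_of_le_ofReal hη.le (hN n hn m hm' τ hτ)
  have hcau : ∀ τ, CauchySeq (fun n => a n τ) := by
    intro τ
    rw [Metric.cauchySeq_iff]
    intro ε hε
    obtain ⟨N, hN⟩ := hnorm |τ| (ε / 2) (by positivity)
    refine ⟨N, fun n hn m hm => ?_⟩
    rw [dist_eq_norm]
    exact (hN n hn m hm τ le_rfl).trans_lt (by linarith)
  choose A hA using fun τ => cauchySeq_tendsto_of_complete (hcau τ)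
  have hw : ∀ x, wt 1 x ≠ 0 := fun x => (wt_pos 1 x).ne'
  have hwA : ∀ τ, (fun x => wt 1 x * ((wt 1 x)⁻¹ * A τ x)) = A τ := fun τ => by
    ext x
    field_simp [hw x]
  refine ⟨fun τ x => (wt 1 x)⁻¹ * A τ x, fun τ => ?_, fun T η hη => ?_⟩
  · exact ((continuous_wt 1).inv₀ hw).aestronglyMeasurable.mul (Lp.aestronglyMeasurable _)
  · obtain ⟨N, hN⟩ := hnorm T η hη
    refine ⟨N, fun n hn τ hτ => ?_⟩
    have h1 : ‖a n τ - A τ‖ ≤ η := by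
      refine le_of_tendsto ((tendsto_const_nhds (x := a n τ)).sub (hA τ)).norm ?_
      filter_upwards [eventually_ge_atTop N] with m hm'
      exact hN n hn m hm' τ hτ
    have h2 : wNorm 1 (fun y => X n τ y - (wt 1 y)⁻¹ * A τ y) = eLpNorm (a n τ - A τ : L2R) 2 volume := by
      refine eLpNorm_congr_ae ?_
      filter_upwards [coeFn_mulL2 (hm n τ), Lp.coeFn_sub (a n τ) (A τ)] with x e1 e2
      rw [e2, Pi.sub_apply, mul_sub, congrFun (hwA τ) x]
      simp only [ha, e1]
    rw [h2, ← ENNReal.ofReal_toReal (Lp.memLp (a n τ - A τ)).eLpNorm_ne_top, ← Lp.norm_def]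
    exact ENNReal.ofReal_le_ofReal h1

/-- Convergence in `L²` on bounded intervals. -/
def LocConv (f : ℕ → ℝ → ℝ) (g : ℝ → ℝ) : Prop :=
  (∀ n, AEStronglyMeasurable (f n) volume) ∧ AEStronglyMeasurable g volume ∧
    ∀ R : ℝ, Tendsto (fun n => l2Norm (Icc (-R) R) (fun y => f n y - g y)) atTop (𝓝 0)

lemma WConv.locConv {X : ℕ → ℝ → ℝ → ℝ} {Y : ℝ → ℝ → ℝ} (h : WConv X Y)
    (hX : ∀ n τ, MemL2ul (X n τ)) (hY : ∀ τ, AEStronglyMeasurable (Y τ) volume) (τ : ℝ) :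
    LocConv (fun n => X n τ) (Y τ) := by
  refine ⟨fun n => (hX n τ).1, hY τ, fun R => ?_⟩
  have h1 : Tendsto (fun n => wNorm 1 (fun y => X n τ y - Y τ y)) atTop (𝓝 0) := by
    rw [ENNReal.tendsto_nhds_zero]
    intro ε hε
    obtain ⟨r, hr0, hr⟩ := ENNReal.lt_iff_exists_nnreal_btwn.1 hε
    obtain ⟨N, hN⟩ := h |τ| r (by exact_mod_cast hr0)
    filter_upwards [eventually_ge_atTop N] with n hn
    refine (hN n hn τ le_rfl).trans ?_
    rw [ENNReal.ofReal_coe_nnreal]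
    exact hr.le
  exact tendsto_ennreal_zero_mul (wt 1 R)⁻¹ h1 (Eventually.of_forall fun n => l2Norm_Icc_le_wNorm _)

namespace LocConv

variable {f f' : ℕ → ℝ → ℝ} {g g' : ℝ → ℝ}

lemma sub (h : LocConv f g) (h' : LocConv f' g') :
    LocConv (fun n x => f n x - f' n x) (fun x => g x - g' x) := by
  refine ⟨fun n => (h.1 n).sub (h'.1 n), h.2.1.sub h'.2.1, fun R =>
    tendsto_ennreal_zero_add (h.2.2 R) (h'.2.2 R) (Eventually.of_forall fun n => ?_)⟩
  refine le_trans (le_of_eq ?_) (eLpNorm_sub_le ((h.1 n).sub h.2.1).restrict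
    ((h'.1 n).sub h'.2.1).restrict (by norm_num))
  unfold l2Norm
  congr 1
  ext x
  simp only [Pi.sub_apply]
  ring

lemma const_mul (h : LocConv f g) (c : ℝ) : LocConv (fun n x => c * f n x) (fun x => c * g x) := by
  refine ⟨fun n => (h.1 n).const_mul c, h.2.1.const_mul c, fun R =>
    tendsto_ennreal_zero_mul |c| (h.2.2 R) (Eventually.of_forall fun n => ?_)⟩
  refine eLpNorm_le_mul_eLpNorm_of_ae_le_mul (ae_of_all _ fun x => ?_) 2
  rw [← mul_sub, norm_mul, Real.norm_eq_abs c]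

lemma shift (h : LocConv f g) (ξ : ℝ) : LocConv (fun n x => f n (ξ + x)) (fun x => g (ξ + x)) := by
  have hmp := measurePreserving_add_left (volume : Measure ℝ) ξ
  refine ⟨fun n => (h.1 n).comp_measurePreserving hmp, h.2.1.comp_measurePreserving hmp, fun R =>
    tendsto_of_tendsto_of_tendsto_of_le_of_le tendsto_const_nhds (h.2.2 (R + |ξ|))
      (fun _ => zero_le) fun n => ?_⟩
  have := l2Norm_Icc_shift (-R) R (fun y => f n y - g y) ξ
  refine this.le.trans (l2Norm_mono_set (Icc_subset_Icc ?_ ?_) _)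
  · linarith [neg_abs_le ξ]
  · linarith [le_abs_self ξ]

/-- Lower semicontinuity: each unit window lies in a bounded interval, where convergence is strong.
Every uniformly local property of the limit is obtained in this way, although convergence is only
local. -/
lemma l2ulNorm_le (h : LocConv f g) {M : ℝ≥0∞} (hM : ∀ᶠ n in atTop, l2ulNorm (f n) ≤ M) :
    l2ulNorm g ≤ M := by
  refine iSup_le fun ξ => ?_
  have h1 := (h.2.2 (|ξ| + 1)).const_add M
  rw [add_zero] at h1
  refine ge_of_tendsto h1 ?_
  filter_upwards [hM] with n hn
  have h2 : l2Norm (Icc ξ (ξ + 1)) g ≤ l2Norm (Icc ξ (ξ + 1)) (f n) +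
      l2Norm (Icc ξ (ξ + 1)) (fun y => f n y - g y) := by
    refine le_trans (le_of_eq ?_) (eLpNorm_sub_le (h.1 n).restrict
      ((h.1 n).sub h.2.1).restrict (by norm_num))
    unfold l2Norm
    congr 1
    ext x
    simp
  refine h2.trans (add_le_add ((l2Norm_unit_le_l2ulNorm _ _).trans hn) (l2Norm_mono_set ?_ _))
  refine Icc_subset_Icc ?_ ?_
  · linarith [neg_abs_le ξ]
  · linarith [le_abs_self ξ]

/-- Local convergence says nothing about uniform continuity of translations at infinity; a modulus
common to all n does, by lower semicontinuity applied to f(s + ·) - f. -/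
lemma memL2ul (h : LocConv f g) {M : ℝ} (hM : ∀ n, l2ulNorm (f n) ≤ ENNReal.ofReal M)
    (hmod : ∀ ε > 0, ∃ r > 0, ∀ n, ∀ s, |s| < r →
      l2ulNorm (fun x => f n (s + x) - f n x) ≤ ENNReal.ofReal ε) : MemL2ul g := by
  refine ⟨h.2.1, (h.l2ulNorm_le (Eventually.of_forall hM)).trans_lt ENNReal.ofReal_lt_top, ?_⟩
  rw [ENNReal.tendsto_nhds_zero]
  intro ε hε
  obtain ⟨e, he0, he⟩ := ENNReal.lt_iff_exists_nnreal_btwn.1 hε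
  obtain ⟨r, hr, hmod⟩ := hmod e (by exact_mod_cast he0)
  filter_upwards [Metric.ball_mem_nhds (0 : ℝ) hr] with s hs
  have hs' : |-s| < r := by simpa using hs
  have := ((h.shift (-s)).sub h).l2ulNorm_le (Eventually.of_forall fun n => hmod n (-s) hs')
  rw [ENNReal.ofReal_coe_nnreal] at this
  refine le_trans (le_of_eq ?_) (this.trans he.le)
  congr 1
  ext x
  ring_nf

end LocConv

lemma WConv.tendstoUniformlyOn_integral {X : ℕ → ℝ → ℝ → ℝ} {Y : ℝ → ℝ → ℝ} (h : WConv X Y)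
    (hX : ∀ n τ, MemL2ul (X n τ)) (hY : ∀ τ, MemL2ul (Y τ)) {φ : ℝ → ℝ} (hφ : IsTestFunction φ)
    {T : ℝ} {s : Set ℝ} (hs : ∀ τ ∈ s, |τ| ≤ T) :
    TendstoUniformlyOn (fun n τ => ∫ x, X n τ x * φ x) (fun τ => ∫ x, Y τ x * φ x) atTop s := by
  obtain ⟨C, hC0, hC⟩ := exists_abs_integral_mul_test_le hφ
  rw [Metric.tendstoUniformlyOn_iff]
  intro ε hε
  obtain ⟨N, hN⟩ := h T (ε / (2 * (C + 1))) (by positivity)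
  filter_upwards [eventually_ge_atTop N] with n hn τ hτ
  have h1 := hC _ (((hX n τ).sub (hY τ)).memLp_wt_mul one_ne_zero)
  have h2 := ENNReal.toReal_le_of_le_ofReal (by positivity) (hN n hn τ (hs τ hτ))
  have i := (HasInt.of_integrable ((hX n τ).integrable_mul_test hφ)).sub
    (HasInt.of_integrable ((hY τ).integrable_mul_test hφ))
  simp only [← sub_mul] at i
  rw [i.2] at h1
  rw [dist_comm, Real.dist_eq]
  calc _ ≤ _ := h1
    _ ≤ C * (ε / (2 * (C + 1))) := by gcongr
    _ < ε := by
      rw [mul_div_assoc', div_lt_iff₀ (by positivity)]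
      nlinarith

lemma WConv.tendsto_integral {X : ℕ → ℝ → ℝ → ℝ} {Y : ℝ → ℝ → ℝ} (h : WConv X Y)
    (hX : ∀ n τ, MemL2ul (X n τ)) (hY : ∀ τ, MemL2ul (Y τ)) {φ : ℝ → ℝ} (hφ : IsTestFunction φ)
    (τ : ℝ) : Tendsto (fun n => ∫ x, X n τ x * φ x) atTop (𝓝 (∫ x, Y τ x * φ x)) :=
  (h.tendstoUniformlyOn_integral hX hY hφ (s := {τ}) (T := |τ|)
    (fun τ' h' => by rw [mem_singleton_iff.1 h'])).tendsto_at (mem_singleton τ)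

/-- If up to small errors `h X` is approximated by sequences that are Cauchy, then `X` is Cauchy. -/
lemma wNorm_cauchy_of_approx {X : ℕ → ℝ → ℝ → ℝ} (hX : ∀ n τ, MemL2ul (X n τ))
    (happ : ∀ T : ℝ, ∀ η > 0, ∃ h : ℝ, 0 < h ∧ ∃ D : ℕ → ℝ → ℝ → ℝ,
      (∀ n τ, AEStronglyMeasurable (D n τ) volume) ∧
      (∃ N, ∀ n ≥ N, ∀ τ, |τ| ≤ T →
        wNorm 1 (fun y => D n τ y - h * X n τ y) ≤ ENNReal.ofReal (η * h)) ∧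
      ∃ N, ∀ n ≥ N, ∀ m ≥ N, ∀ τ, |τ| ≤ T →
        wNorm 1 (fun y => D n τ y - D m τ y) ≤ ENNReal.ofReal (η * h)) :
    ∀ T : ℝ, ∀ η > 0, ∃ N, ∀ n ≥ N, ∀ m ≥ N, ∀ τ, |τ| ≤ T →
      wNorm 1 (fun y => X n τ y - X m τ y) ≤ ENNReal.ofReal η := by
  intro T η hη
  obtain ⟨h, hh, D, hD, ⟨N₁, hN₁⟩, N₂, hN₂⟩ := happ T (η / 3) (by positivity)
  refine ⟨max N₁ N₂, fun n hn m hm τ hτ => ?_⟩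
  have a1 := hN₁ n (le_of_max_le_left hn) τ hτ
  have a2 := hN₁ m (le_of_max_le_left hm) τ hτ
  have a3 := hN₂ n (le_of_max_le_right hn) m (le_of_max_le_right hm) τ hτ
  have m1 := (hD n τ).sub ((hX n τ).const_mul h).1
  have m2 := (hD m τ).sub ((hX m τ).const_mul h).1
  have m3 := (hD n τ).sub (hD m τ)
  have b1 : wNorm 1 (fun y => (-1) * (D n τ y - h * X n τ y)) ≤ ENNReal.ofReal (η / 3 * h) := by
    refine (wNorm_le_mul (c := 1) fun x => ?_).trans (by simpa using a1)
    rw [abs_mul]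
    simp
  have e : wNorm 1 (fun y => h * (X n τ y - X m τ y)) ≤ ENNReal.ofReal (η * h) := by
    calc wNorm 1 (fun y => h * (X n τ y - X m τ y)) = wNorm 1 (fun y =>
          ((-1) * (D n τ y - h * X n τ y) + (D m τ y - h * X m τ y)) + (D n τ y - D m τ y)) := by
          congr 1
          ext y
          ring
      _ ≤ ENNReal.ofReal (η / 3 * h) + ENNReal.ofReal (η / 3 * h) + ENNReal.ofReal (η / 3 * h) := by
          refine (wNorm_add_le ((m1.const_mul (-1)).add m2) m3).trans (add_le_add ?_ a3)
          exact (wNorm_add_le (m1.const_mul (-1)) m2).trans (add_le_add b1 a2)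
      _ = ENNReal.ofReal (η * h) := by
          rw [← ENNReal.ofReal_add (by positivity) (by positivity),
            ← ENNReal.ofReal_add (by positivity) (by positivity)]
          congr 1
          ring
  calc wNorm 1 (fun y => X n τ y - X m τ y)
      ≤ ENNReal.ofReal h⁻¹ * wNorm 1 (fun y => h * (X n τ y - X m τ y)) := by
        refine wNorm_le_mul fun x => ?_
        rw [abs_mul, abs_of_pos hh, ← mul_assoc, inv_mul_cancel₀ hh.ne', one_mul]
    _ ≤ ENNReal.ofReal h⁻¹ * ENNReal.ofReal (η * h) := by gcongr
    _ = ENNReal.ofReal η := by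
        rw [← ENNReal.ofReal_mul (by positivity)]
        congr 1
        field_simp

/-- Sequential Arzelà-Ascoli theorem for scalar functions on the plane. -/
lemma exists_subseq_tendstoLocallyUniformly {f : ℕ → ℝ × ℝ → ℝ} {B : ℝ} (hB : ∀ n z, |f n z| ≤ B)
    (hequi : ∀ ε > 0, ∃ r > 0, ∀ n z z', dist z z' < r → |f n z - f n z'| ≤ ε) :
    ∃ σ : ℕ → ℕ, StrictMono σ ∧ ∃ v : ℝ × ℝ → ℝ, Continuous v ∧
      TendstoLocallyUniformly (fun n => f (σ n)) v atTop := by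
  choose! r hr0 hr using hequi
  -- One bound and one modulus for the whole class make it closed under pointwise limits, hence
  -- compact by Tychonoff.
  set A : Set (ℝ × ℝ → ℝ) := {g | (∀ z, |g z| ≤ B) ∧
    ∀ ε > 0, ∀ z z', dist z z' < r ε → |g z - g z'| ≤ ε} with hA
  have hequiA : UniformEquicontinuous ((↑) : A → ℝ × ℝ → ℝ) := by
    rw [Metric.uniformEquicontinuous_iff]
    intro ε hε
    refine ⟨r (ε / 2), hr0 _ (by positivity), fun z z' hz g => ?_⟩
    rw [Real.dist_eq]
    exact (g.2.2 (ε / 2) (by positivity) z z' hz).trans_lt (by linarith)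
  have hcont : ∀ g ∈ A, Continuous g := fun g hg =>
    (hequiA.uniformContinuous ⟨g, hg⟩).continuous
  set S : Set C(ℝ × ℝ, ℝ) := {g | ⇑g ∈ A} with hS
  have himage : ContinuousMap.toFun '' S = A := by
    ext g
    constructor
    · rintro ⟨g', hg', rfl⟩
      exact hg'
    · exact fun hg => ⟨⟨g, hcont g hg⟩, hg, rfl⟩
  have hAcompact : IsCompact A := by
    refine (isCompact_univ_pi fun _ => isCompact_Icc (a := -B) (b := B)).of_isClosed_subset ?_
      fun g hg z _ => abs_le.1 (hg.1 z)
    rw [hA, ofPred_and]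
    refine IsClosed.inter ?_ ?_
    · simp only [ofPred_forall]
      exact isClosed_iInter fun z => isClosed_le (by fun_prop) continuous_const
    · simp only [ofPred_forall]
      exact isClosed_iInter fun ε => isClosed_iInter fun _ => isClosed_iInter fun z =>
        isClosed_iInter fun z' => isClosed_iInter fun _ =>
          isClosed_le (by fun_prop) continuous_const
  have hScompact : IsCompact S := by
    refine ArzelaAscoli.isCompact_of_equicontinuous S (himage ▸ hAcompact) ?_
    exact hequiA.equicontinuous.comp (fun g : S => (⟨g.1, g.2⟩ : A))
  have hf : ∀ n, f n ∈ A := fun n => ⟨hB n, fun ε hε z z' hz => hr ε hε n z z' hz⟩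
  have : FirstCountableTopology C(ℝ × ℝ, ℝ) := inferInstance
  obtain ⟨v, _, σ, hσ, hv⟩ := hScompact.tendsto_subseq
    (x := fun n => (⟨f n, hcont _ (hf n)⟩ : C(ℝ × ℝ, ℝ))) hf
  exact ⟨σ, hσ, v, v.continuous, ContinuousMap.tendsto_iff_tendstoLocallyUniformly.1 hv⟩

/-- The ratio of the weight to its translate is at most 2(1 + ξ²), so weighted convergence survives
translation in space. -/
lemma wNorm_one_shift_le (f : ℝ → ℝ) (ξ : ℝ) :
    wNorm 1 (fun x => f (ξ + x)) ≤ ENNReal.ofReal (2 * (1 + ξ ^ 2)) * wNorm 1 f := by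
  have h1 : wNorm 1 f = eLpNorm (fun x => wt 1 (ξ + x) * f (ξ + x)) 2 volume := by
    have := (measurableEmbedding_addLeft ξ).eLpNorm_map_measure (μ := volume) (p := 2)
      (g := fun x => wt 1 x * f x)
    rwa [(measurePreserving_add_left (volume : Measure ℝ) ξ).map_eq] at this
  rw [h1]
  refine eLpNorm_le_mul_eLpNorm_of_ae_le_mul (ae_of_all _ fun x => ?_) 2
  rw [norm_mul, norm_mul, ← mul_assoc]
  refine mul_le_mul_of_nonneg_right ?_ (norm_nonneg _)
  rw [Real.norm_of_nonneg (wt_pos _ _).le, Real.norm_of_nonneg (wt_pos _ _).le]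
  unfold wt
  rw [← div_eq_mul_inv, inv_eq_one_div, div_le_div_iff₀ (by positivity) (by positivity)]
  nlinarith [sq_nonneg (ξ - x), sq_nonneg (ξ * x)]

lemma aesm_space_shift {Y : ℝ → ℝ → ℝ} (hY : ∀ τ, AEStronglyMeasurable (Y τ) volume) (ξ : ℝ) (τ : ℝ) :
    AEStronglyMeasurable (fun x => Y τ (ξ + x)) volume :=
  (hY τ).comp_measurePreserving (measurePreserving_add_left volume ξ)

namespace WConv

variable {X X' : ℕ → ℝ → ℝ → ℝ} {Y Y' : ℝ → ℝ → ℝ}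

lemma time_shift (h : WConv X Y) (k : ℝ) :
    WConv (fun n τ => X n (τ + k)) (fun τ => Y (τ + k)) := by
  intro T η hη
  obtain ⟨N, hN⟩ := h (T + |k|) η hη
  exact ⟨N, fun n hn τ hτ => hN n hn (τ + k) ((abs_add_le _ _).trans (by gcongr))⟩

lemma of_le_mul (h : WConv X Y) {c : ℝ} (hc : 0 < c) (hle : ∀ n τ,
    wNorm 1 (fun y => X' n τ y - Y' τ y) ≤ ENNReal.ofReal c * wNorm 1 (fun y => X n τ y - Y τ y)) :
    WConv X' Y' := by
  intro T η hη
  obtain ⟨N, hN⟩ := h T (η / c) (by positivity)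
  refine ⟨N, fun n hn τ hτ => (hle n τ).trans ((mul_le_mul_right (hN n hn τ hτ) _).trans ?_)⟩
  rw [← ENNReal.ofReal_mul hc.le, mul_div_cancel₀ _ hc.ne']

lemma space_shift (h : WConv X Y) (ξ : ℝ) :
    WConv (fun n τ x => X n τ (ξ + x)) (fun τ x => Y τ (ξ + x)) :=
  h.of_le_mul (c := 2 * (1 + ξ ^ 2)) (by positivity) fun n τ =>
    wNorm_one_shift_le (fun y => X n τ y - Y τ y) ξ

lemma sub (h : WConv X Y) (h' : WConv X' Y') (hX : ∀ n τ, AEStronglyMeasurable (X n τ) volume)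
    (hY : ∀ τ, AEStronglyMeasurable (Y τ) volume)
    (hX' : ∀ n τ, AEStronglyMeasurable (X' n τ) volume)
    (hY' : ∀ τ, AEStronglyMeasurable (Y' τ) volume) :
    WConv (fun n τ x => X n τ x - X' n τ x) (fun τ x => Y τ x - Y' τ x) := by
  intro T η hη
  obtain ⟨N, hN⟩ := h T (η / 2) (by positivity)
  obtain ⟨N', hN'⟩ := h' T (η / 2) (by positivity)
  refine ⟨max N N', fun n hn τ hτ => ?_⟩
  calc wNorm 1 (fun y => X n τ y - X' n τ y - (Y τ y - Y' τ y))
      = wNorm 1 (fun y => (X n τ y - Y τ y) + (-1) * (X' n τ y - Y' τ y)) := by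
        congr 1
        ext y
        ring
    _ ≤ ENNReal.ofReal (η / 2) + ENNReal.ofReal (η / 2) := by
        refine (wNorm_add_le ((hX n τ).sub (hY τ))
          (((hX' n τ).sub (hY' τ)).const_mul _)).trans ?_
        refine add_le_add (hN n (le_of_max_le_left hn) τ hτ) ?_
        refine (wNorm_le_mul (c := 1) (g := fun y => X' n τ y - Y' τ y) fun y => ?_).trans ?_
        · rw [abs_mul]
          simp
        · simpa using hN' n (le_of_max_le_right hn) τ hτ
    _ = ENNReal.ofReal η := by rw [← ENNReal.ofReal_add (by positivity) (by positivity), add_halves]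

lemma cauchy (h : WConv X Y) (hX : ∀ n τ, AEStronglyMeasurable (X n τ) volume)
    (hY : ∀ τ, AEStronglyMeasurable (Y τ) volume) (T η : ℝ) (hη : 0 < η) :
    ∃ N, ∀ n ≥ N, ∀ m ≥ N, ∀ τ, |τ| ≤ T →
      wNorm 1 (fun y => X n τ y - X m τ y) ≤ ENNReal.ofReal η := by
  obtain ⟨N, hN⟩ := h T (η / 2) (by positivity)
  refine ⟨N, fun n hn m hm τ hτ => ?_⟩
  calc wNorm 1 (fun y => X n τ y - X m τ y)
      = wNorm 1 (fun y => (X n τ y - Y τ y) + (-1) * (X m τ y - Y τ y)) := by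
        congr 1
        ext y
        ring
    _ ≤ ENNReal.ofReal (η / 2) + ENNReal.ofReal (η / 2) := by
        refine (wNorm_add_le ((hX n τ).sub (hY τ)) (((hX m τ).sub (hY τ)).const_mul _)).trans ?_
        refine add_le_add (hN n hn τ hτ) ?_
        refine (wNorm_le_mul (c := 1) (g := fun y => X m τ y - Y τ y) fun y => ?_).trans ?_
        · rw [abs_mul]
          simp
        · simpa using hN m hm τ hτ
    _ = ENNReal.ofReal η := by rw [← ENNReal.ofReal_add (by positivity) (by positivity), add_halves]

end WConv

/-! ### Compact families of solutions -/

/-- A sequence of paths that satisfies the first order system of the damped wave equation on any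
bounded time interval for all large indices, with bounds and moduli of continuity that do not
depend on the index. -/
structure CompactFamily (α : ℝ) (V : ℝ → ℝ) (B : ℝ) (U P Q : ℕ → ℝ → ℝ → ℝ) : Prop where
  mem_u : ∀ n τ, MemL2ul (U n τ)
  mem_p : ∀ n τ, MemL2ul (P n τ)
  mem_q : ∀ n τ, MemL2ul (Q n τ)
  prim : ∀ n τ, IsPrimitive (U n τ) (P n τ)
  bound_p : ∀ n τ, l2ulNorm (P n τ) ≤ ENNReal.ofReal B
  bound_q : ∀ n τ, l2ulNorm (Q n τ) ≤ ENNReal.ofReal B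
  abs_u_le : ∀ n τ x, |U n τ x| ≤ B
  time_modulus : ∀ ε > 0, ∃ r > 0, ∀ n τ h, |h| < r →
    l2ulNorm (fun x => U n (τ + h) x - U n τ x) ≤ ENNReal.ofReal ε ∧
    l2ulNorm (fun x => P n (τ + h) x - P n τ x) ≤ ENNReal.ofReal ε ∧
    l2ulNorm (fun x => Q n (τ + h) x - Q n τ x) ≤ ENNReal.ofReal ε
  space_modulus : ∀ ε > 0, ∃ r > 0, ∀ n τ h, |h| < r →
    l2ulNorm (fun x => U n τ (h + x) - U n τ x) ≤ ENNReal.ofReal ε ∧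
    l2ulNorm (fun x => P n τ (h + x) - P n τ x) ≤ ENNReal.ofReal ε ∧
    l2ulNorm (fun x => Q n τ (h + x) - Q n τ x) ≤ ENNReal.ofReal ε
  time_diff : ∀ ε > 0, ∃ r > 0, ∀ T : ℝ, ∃ N, ∀ n ≥ N, ∀ τ, |τ| ≤ T → ∀ h, |h| < r →
    l2ulNorm (fun x => U n (τ + h) x - U n τ x - h * Q n τ x) ≤ ENNReal.ofReal (ε * |h|)
  eq : ∀ φ, IsTestFunction φ → ∀ T : ℝ, ∃ N, ∀ n ≥ N, ∀ τ, |τ| ≤ T →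
    HasDerivAt (fun s => α * ∫ x, Q n s x * φ x)
      (-(∫ x, P n τ x * deriv φ x) - (∫ x, Q n τ x * φ x) - ∫ x, deriv V (U n τ x) * φ x) τ

lemma l2ulNorm_sub_le_of_forward {f : ℝ → ℝ → ℝ} {r : ℝ} {ε : ℝ≥0∞}
    (hf : ∀ t ≥ 1, ∀ k, 0 ≤ k → k < r → l2ulNorm (fun x => f (t + k) x - f t x) ≤ ε)
    {a b : ℝ} (ha : 1 ≤ a) (hb : 1 ≤ b) (hab : |b - a| < r) :
    l2ulNorm (fun x => f b x - f a x) ≤ ε := by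
  rcases le_total a b with h | h
  · have := hf a ha (b - a) (sub_nonneg.2 h) (lt_of_abs_lt hab)
    rwa [add_sub_cancel] at this
  · have := hf b hb (a - b) (sub_nonneg.2 h) (by rw [abs_sub_comm] at hab; exact lt_of_abs_lt hab)
    rwa [add_sub_cancel, l2ulNorm_sub_comm] at this

/-- The translates of a global solution form a compact family. -/
lemma WaveSystem.exists_compactFamily {α : ℝ} {w p q : ℝ → ℝ → ℝ} {V : ℝ → ℝ} {a b : ℝ}
    (h : WaveSystem α w p q (fun t x => deriv V (w t x))) (hα : 0 < α) (hV : ContDiff ℝ 2 V)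
    (ha : 0 < a) (hab : ∀ z, a * z ^ 2 - b ≤ z * deriv V z) (x t : ℕ → ℝ)
    (ht : Tendsto t atTop atTop) : ∃ B, 0 ≤ B ∧ CompactFamily α V B
      (fun n τ y => w (max (t n + τ) 1) (x n + y)) (fun n τ y => p (max (t n + τ) 1) (x n + y))
      (fun n τ y => q (max (t n + τ) 1) (x n + y)) := by
  obtain ⟨B, hB0, hB⟩ := h.exists_bound hα hV ha hab
  have hpos : ∀ {s : ℝ}, 1 ≤ s → 0 < s := fun hs => by linarith
  -- The Sobolev embedding adds the bounds of w and p; 2B then serves as the common constant.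
  have hwB : ∀ s ≥ 1, ∀ y, |w s y| ≤ 2 * B := by
    intro s hs y
    have h0 := hpos hs
    have e := (h.prim s h0).abs_le_l2ulNorm (h.path_u.mem s h0) (h.path_p.mem s h0) y
    have e1 := ENNReal.toReal_le_of_le_ofReal hB0 (hB s hs).1
    have e2 := ENNReal.toReal_le_of_le_ofReal hB0 (hB s hs).2.1
    linarith
  have hB2 : ENNReal.ofReal B ≤ ENNReal.ofReal (2 * B) :=
    ENNReal.ofReal_le_ofReal (by linarith)
  have hpB : ∀ s ≥ 1, l2ulNorm (p s) ≤ ENNReal.ofReal (2 * B) := fun s hs => (hB s hs).2.1.trans hB2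
  have hqB : ∀ s ≥ 1, l2ulNorm (q s) ≤ ENNReal.ofReal (2 * B) := fun s hs => (hB s hs).2.2.trans hB2
  have hmod := fun {ε : ℝ} (hε : 0 < ε) =>
    h.exists_modulus hα hV (by positivity : 0 ≤ 2 * B) hpB hqB hwB hε
  have htime : ∀ ε > 0, ∃ r > 0, ∀ a ≥ (1 : ℝ), ∀ b ≥ (1 : ℝ), |b - a| < r →
      l2ulNorm (fun x => w b x - w a x) ≤ ENNReal.ofReal ε ∧
      l2ulNorm (fun x => p b x - p a x) ≤ ENNReal.ofReal ε ∧
      l2ulNorm (fun x => q b x - q a x) ≤ ENNReal.ofReal ε := by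
    intro ε hε
    obtain ⟨r, hr, hr'⟩ := hmod hε
    have hr0 : |(0 : ℝ)| < r := by simpa using hr
    refine ⟨r, hr, fun a ha b hb hab => ⟨?_, ?_, ?_⟩⟩
    · exact l2ulNorm_sub_le_of_forward
        (fun s hs k hk hkr => by simpa using (hr' s hs 0 k hr0 hk hkr).1) ha hb hab
    · exact l2ulNorm_sub_le_of_forward
        (fun s hs k hk hkr => by simpa using (hr' s hs 0 k hr0 hk hkr).2.1) ha hb hab
    · exact l2ulNorm_sub_le_of_forward
        (fun s hs k hk hkr => by simpa using (hr' s hs 0 k hr0 hk hkr).2.2) ha hb hab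
  -- Clamping the time at 1 makes the family defined for all τ within the range of the uniform
  -- bounds. The clamp is 1-Lipschitz, so time moduli survive, and it is inactive on any bounded
  -- τ-interval for large n, where the equation is needed.
  have h1 : ∀ n τ, 1 ≤ max (t n + τ) 1 := fun n τ => le_max_right _ _
  have hshift : ∀ (f : ℝ → ℝ → ℝ) (ξ a b : ℝ), l2ulNorm (fun y => f b (ξ + y) - f a (ξ + y)) =
      l2ulNorm (fun y => f b y - f a y) := fun f ξ a b => l2ulNorm_shift (fun y => f b y - f a y) ξ
  have hshift' : ∀ (f : ℝ → ℝ) (ξ s : ℝ), l2ulNorm (fun y => f (ξ + (s + y)) - f (ξ + y)) =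
      l2ulNorm (fun y => f (s + y) - f y) := fun f ξ s => by
    rw [← l2ulNorm_shift (fun y => f (s + y) - f y) ξ]
    simp only [add_left_comm]
  have hlarge : ∀ T : ℝ, ∃ N, ∀ n ≥ N, ∀ τ, |τ| ≤ T → 1 < t n + τ := by
    intro T
    obtain ⟨N, hN⟩ := eventually_atTop.1 (ht.eventually_ge_atTop (T + 2))
    exact ⟨N, fun n hn τ hτ => by linarith [hN n hn, neg_le_of_abs_le hτ]⟩
  refine ⟨2 * B, by positivity, fun n τ => (h.path_u.mem _ (hpos (h1 n τ))).shift _,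
    fun n τ => (h.path_p.mem _ (hpos (h1 n τ))).shift _,
    fun n τ => (h.path_q.mem _ (hpos (h1 n τ))).shift _,
    fun n τ => (h.prim _ (hpos (h1 n τ))).shift _, fun n τ => ?_, fun n τ => ?_,
    fun n τ y => hwB _ (h1 n τ) _, fun ε hε => ?_, fun ε hε => ?_, fun ε hε => ?_,
    fun φ hφ T => ?_⟩
  · rw [l2ulNorm_shift]
    exact hpB _ (h1 n τ)
  · rw [l2ulNorm_shift]
    exact hqB _ (h1 n τ)
  · obtain ⟨r, hr, hr'⟩ := htime ε hε
    refine ⟨r, hr, fun n τ k hk => ?_⟩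
    rw [hshift w, hshift p, hshift q]
    refine hr' _ (h1 n τ) _ (h1 n (τ + k)) ((abs_max_sub_max_le_abs _ _ _).trans_lt ?_)
    rwa [← add_assoc, add_sub_cancel_left]
  · obtain ⟨r, hr, hr'⟩ := hmod hε
    refine ⟨r, hr, fun n τ k hk => ?_⟩
    rw [hshift' (w _), hshift' (p _), hshift' (q _)]
    simpa only [add_zero] using hr' _ (h1 n τ) k 0 hk le_rfl hr
  · obtain ⟨C, hC0, hC⟩ := WaveSystem.exists_l2ulNorm_sub_le
    obtain ⟨r, hr, hr'⟩ := htime (ε / C) (by positivity)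
    -- Capping by 1 keeps τ + k in [-(T+1), T+1], so one index N makes the clamp inactive at both
    -- times.
    refine ⟨min r 1, by positivity, fun T => ?_⟩
    obtain ⟨N, hN⟩ := hlarge (T + 1)
    refine ⟨N, fun n hn τ hτ k hk => ?_⟩
    have e1 : 1 < t n + τ := hN n hn τ (by linarith)
    have e2 : 1 < t n + (τ + k) := hN n hn (τ + k)
      ((abs_add_le _ _).trans (add_le_add hτ (hk.le.trans (min_le_right _ _))))
    rw [max_eq_left e1.le, max_eq_left e2.le]
    have key := hC α w p q _ (q (t n + τ)) (t n + τ) (t n + (τ + k)) (ε / C) (by positivity) h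
      (by linarith) (by linarith) (h.path_q.mem _ (by linarith)) fun s hs => by
        refine (hr' _ e1.le s ?_ ?_).2.2
        · rcases le_total (t n + τ) (t n + (τ + k)) with hle | hle
          · rw [uIcc_of_le hle] at hs
            linarith [hs.1]
          · rw [uIcc_of_ge hle] at hs
            linarith [hs.1]
        · have := abs_sub_left_of_mem_uIcc hs
          rw [← add_assoc, add_sub_cancel_left] at this
          exact this.trans_lt (hk.trans_le (min_le_left _ _))
    rw [← add_assoc, add_sub_cancel_left, mul_div_cancel₀ _ hC0.ne'] at key
    rw [← add_assoc]
    exact (l2ulNorm_shift (fun y => w (t n + τ + k) y - w (t n + τ) y - k * q (t n + τ) y)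
      (x n)).le.trans key
  · obtain ⟨N, hN⟩ := hlarge T
    refine ⟨N, fun n hn τ hτ => ?_⟩
    have e1 : 1 < t n + τ := hN n hn τ hτ
    have key := ((h.shift le_rfl (x n)).eq φ hφ (t n + τ) (by linarith)).comp_const_add (t n) τ
    simp only [add_zero] at key
    rw [max_eq_left e1.le]
    refine key.congr_of_eventuallyEq ?_
    have : ∀ᶠ s in 𝓝 τ, 1 < t n + s :=
      (continuous_const.add continuous_id).continuousAt.eventually (lt_mem_nhds e1)
    filter_upwards [this] with s hs
    rw [max_eq_left hs.le]

namespace CompactFamily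

variable {α B : ℝ} {V : ℝ → ℝ} {U P Q : ℕ → ℝ → ℝ → ℝ}

lemma subseq (h : CompactFamily α V B U P Q) {σ : ℕ → ℕ} (hσ : StrictMono σ) :
    CompactFamily α V B (fun n => U (σ n)) (fun n => P (σ n)) (fun n => Q (σ n)) where
  mem_u n := h.mem_u _
  mem_p n := h.mem_p _
  mem_q n := h.mem_q _
  prim n := h.prim _
  bound_p n := h.bound_p _
  bound_q n := h.bound_q _
  abs_u_le n := h.abs_u_le _
  time_modulus ε hε := by
    obtain ⟨r, hr, hr'⟩ := h.time_modulus ε hε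
    exact ⟨r, hr, fun n => hr' _⟩
  space_modulus ε hε := by
    obtain ⟨r, hr, hr'⟩ := h.space_modulus ε hε
    exact ⟨r, hr, fun n => hr' _⟩
  time_diff ε hε := by
    obtain ⟨r, hr, hr'⟩ := h.time_diff ε hε
    refine ⟨r, hr, fun T => ?_⟩
    obtain ⟨N, hN⟩ := hr' T
    exact ⟨N, fun n hn => hN _ (hn.trans (hσ.id_le n))⟩
  eq φ hφ T := by
    obtain ⟨N, hN⟩ := h.eq φ hφ T
    exact ⟨N, fun n hn => hN _ (hn.trans (hσ.id_le n))⟩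

/-- The Sobolev embedding is applied to increments: the moduli make increments of U and P small
together, so U is equicontinuous jointly in time and space. -/
lemma exists_abs_sub_le (h : CompactFamily α V B U P Q) {ε : ℝ} (hε : 0 < ε) :
    ∃ r > 0, ∀ n, ∀ z z' : ℝ × ℝ, dist z z' < r → |U n z.1 z.2 - U n z'.1 z'.2| ≤ ε := by
  obtain ⟨r₁, hr₁, h₁⟩ := h.time_modulus (ε / 4) (by positivity)
  obtain ⟨r₂, hr₂, h₂⟩ := h.space_modulus (ε / 4) (by positivity)
  have hsup : ∀ {f g : ℝ → ℝ}, IsPrimitive f g → MemL2ul f → MemL2ul g →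
      l2ulNorm f ≤ ENNReal.ofReal (ε / 4) → l2ulNorm g ≤ ENNReal.ofReal (ε / 4) →
      ∀ x, |f x| ≤ ε / 2 := by
    intro f g hfg hf hg e1 e2 x
    have := hfg.abs_le_l2ulNorm hf hg x
    have e1' := ENNReal.toReal_le_of_le_ofReal (by positivity) e1
    have e2' := ENNReal.toReal_le_of_le_ofReal (by positivity) e2
    linarith
  refine ⟨min r₁ r₂, by positivity, fun n ⟨τ, y⟩ ⟨τ', y'⟩ hz => ?_⟩
  rw [Prod.dist_eq, max_lt_iff, Real.dist_eq, Real.dist_eq] at hz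
  have hτ := hz.1.trans_le (min_le_left _ _)
  have hy := hz.2.trans_le (min_le_right _ _)
  have a1 := h₁ n τ' (τ - τ') hτ
  have a2 := h₂ n τ' (y - y') hy
  simp only [add_sub_cancel] at a1
  have b1 := hsup ((h.prim n τ).sub (h.prim n τ')) ((h.mem_u n τ).sub (h.mem_u n τ'))
    ((h.mem_p n τ).sub (h.mem_p n τ')) a1.1 a1.2.1 y
  have b2 := hsup (((h.prim n τ').shift _).sub (h.prim n τ'))
    (((h.mem_u n τ').shift _).sub (h.mem_u n τ')) (((h.mem_p n τ').shift _).sub (h.mem_p n τ'))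
    a2.1 a2.2.1 y'
  rw [sub_add_cancel] at b2
  calc |U n τ y - U n τ' y'| ≤ |U n τ y - U n τ' y| + |U n τ' y - U n τ' y'| := abs_sub_le _ _ _
    _ ≤ ε := by linarith

/-- The positions of a compact family converge along a subsequence. -/
lemma exists_subseq_wConv (h : CompactFamily α V B U P Q) :
    ∃ σ : ℕ → ℕ, StrictMono σ ∧ ∃ v : ℝ → ℝ → ℝ, (∀ τ, Continuous (v τ)) ∧
      (∀ τ x, |v τ x| ≤ B) ∧ WConv (fun n => U (σ n)) v := by
  obtain ⟨σ, hσ, v, hv, hconv⟩ := exists_subseq_tendstoLocallyUniformly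
    (f := fun n z => U n z.1 z.2) (fun n z => h.abs_u_le n z.1 z.2)
    fun ε hε => h.exists_abs_sub_le hε
  have hvB : ∀ z, |v z| ≤ B := fun z =>
    le_of_tendsto ((hconv.tendstoLocallyUniformlyOn (s := univ)).tendsto_at (mem_univ z)).abs (Eventually.of_forall fun n => h.abs_u_le _ _ _)
  refine ⟨σ, hσ, fun τ y => v (τ, y), fun τ => by fun_prop, fun τ x => hvB _, fun T η hη => ?_⟩
  -- The decay of the weight upgrades locally uniform convergence to weighted convergence, given the
  -- uniform bound 2B on differences.
  obtain ⟨R, ε, hR, hε, key⟩ := exists_wNorm_le_of_abs_le (2 * B) hη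
  have hun := (tendstoLocallyUniformlyOn_iff_tendstoUniformlyOn_of_compact
    ((isCompact_Icc (a := -T) (b := T)).prod (isCompact_Icc (a := -R) (b := R)))).1
    hconv.tendstoLocallyUniformlyOn
  obtain ⟨N, hN⟩ := eventually_atTop.1 (Metric.tendstoUniformlyOn_iff.1 hun ε hε)
  refine ⟨N, fun n hn τ hτ => key _ (fun x => ?_) fun x hx => ?_⟩
  · refine (abs_sub _ _).trans ?_
    linarith [h.abs_u_le (σ n) τ x, hvB (τ, x)]
  · have := hN n hn (τ, x) ⟨abs_le.1 hτ, abs_le.1 hx⟩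
    rw [dist_comm, Real.dist_eq] at this
    exact this.le

/-- For fixed small h the increments U(h + ·) - U converge, and they approximate hP with an error
small relative to h and uniform in n, thanks to the spatial modulus of P. Hence P is Cauchy. -/
lemma exists_wConv_p (h : CompactFamily α V B U P Q) {v : ℝ → ℝ → ℝ} (hv : WConv U v)
    (hvm : ∀ τ, AEStronglyMeasurable (v τ) volume) :
    ∃ p : ℝ → ℝ → ℝ, (∀ τ, AEStronglyMeasurable (p τ) volume) ∧ WConv P p := by
  obtain ⟨C₁, hC₁0, hC₁⟩ := exists_l2ulNorm_shift_sub_le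
  obtain ⟨C₂, hC₂0, hC₂⟩ := exists_wNorm_le one_ne_zero
  refine exists_wConv_of_cauchy h.mem_p (wNorm_cauchy_of_approx h.mem_p fun T η hη => ?_)
  obtain ⟨r, hr, hmod⟩ := h.space_modulus (η / (C₁ * C₂)) (by positivity)
  have hD := fun n τ => ((h.mem_u n τ).shift (r / 2)).sub (h.mem_u n τ)
  have hs := fun n τ => ((h.mem_u n τ).shift (r / 2)).1
  have hw := ((hv.space_shift (r / 2)).sub hv hs
    (aesm_space_shift hvm _) (fun n τ => (h.mem_u n τ).1) hvm)
  refine ⟨r / 2, by positivity, _, fun n τ => (hD n τ).1, ⟨0, fun n _ τ _ => ?_⟩,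
    hw.cauchy (fun n τ => (hD n τ).1) (fun τ => (aesm_space_shift hvm _ τ).sub (hvm τ)) T _
      (by positivity)⟩
  refine (hC₂ _ ((hD n τ).sub ((h.mem_p n τ).const_mul _)).1).trans ?_
  have key := hC₁ (U n τ) (P n τ) (P n τ) (r / 2) (η / (C₁ * C₂)) (by positivity) (h.prim n τ)
    (h.mem_u n τ) (h.mem_p n τ) (h.mem_p n τ) fun s hs => by
      rw [uIcc_of_le (by positivity)] at hs
      exact (hmod n τ s (by rw [abs_of_nonneg hs.1]; linarith [hs.2])).2.1
  refine (mul_le_mul_right key _).trans ?_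
  rw [← ENNReal.ofReal_mul hC₂0.le, abs_of_pos (by positivity)]
  refine ENNReal.ofReal_le_ofReal (le_of_eq ?_)
  field_simp

/-- The same argument with increments in time; the approximation holds only for n large depending on
T, since it needs an inactive clamp. -/
lemma exists_wConv_q (h : CompactFamily α V B U P Q) {v : ℝ → ℝ → ℝ} (hv : WConv U v)
    (hvm : ∀ τ, AEStronglyMeasurable (v τ) volume) :
    ∃ q : ℝ → ℝ → ℝ, (∀ τ, AEStronglyMeasurable (q τ) volume) ∧ WConv Q q := by
  obtain ⟨C, hC0, hC⟩ := exists_wNorm_le one_ne_zero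
  refine exists_wConv_of_cauchy h.mem_q (wNorm_cauchy_of_approx h.mem_q fun T η hη => ?_)
  obtain ⟨r, hr, hmod⟩ := h.time_diff (η / C) (by positivity)
  have hD := fun n τ => (h.mem_u n (τ + r / 2)).sub (h.mem_u n τ)
  have hw := (hv.time_shift (r / 2)).sub hv (fun n τ => (h.mem_u n _).1) (fun τ => hvm _)
    (fun n τ => (h.mem_u n τ).1) hvm
  obtain ⟨N, hN⟩ := hmod T
  refine ⟨r / 2, by positivity, _, fun n τ => (hD n τ).1, ⟨N, fun n hn τ hτ => ?_⟩,
    hw.cauchy (fun n τ => (hD n τ).1) (fun τ => (hvm _).sub (hvm τ)) T _ (by positivity)⟩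
  refine (hC _ ((hD n τ).sub ((h.mem_q n τ).const_mul _)).1).trans ?_
  have hr2 : |r / 2| = r / 2 := abs_of_pos (by positivity)
  refine (mul_le_mul_right (hN n hn τ hτ (r / 2) (by rw [hr2]; linarith)) _).trans ?_
  rw [← ENNReal.ofReal_mul hC0.le, hr2]
  refine ENNReal.ofReal_le_ofReal (le_of_eq ?_)
  field_simp

end CompactFamily

/-! ### The limit of a compact family -/

lemma WConv.l2ulNorm_time_sub_le {X : ℕ → ℝ → ℝ → ℝ} {Y : ℝ → ℝ → ℝ} (h : WConv X Y)
    (hX : ∀ n τ, MemL2ul (X n τ)) (hY : ∀ τ, AEStronglyMeasurable (Y τ) volume)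
    (hmod : ∀ ε > 0, ∃ r > 0, ∀ n τ k, |k| < r →
      l2ulNorm (fun x => X n (τ + k) x - X n τ x) ≤ ENNReal.ofReal ε) (τ : ℝ) :
    Tendsto (fun s => l2ulNorm (fun x => Y s x - Y τ x)) (𝓝 τ) (𝓝 0) := by
  rw [ENNReal.tendsto_nhds_zero]
  intro ε hε
  obtain ⟨e, he0, he⟩ := ENNReal.lt_iff_exists_nnreal_btwn.1 hε
  obtain ⟨r, hr, hmod⟩ := hmod e (by exact_mod_cast he0)
  filter_upwards [Metric.ball_mem_nhds τ hr] with s hs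
  rw [Metric.mem_ball, Real.dist_eq] at hs
  refine (((h.locConv hX hY s).sub (h.locConv hX hY τ)).l2ulNorm_le
    (Eventually.of_forall fun n => ?_)).trans ((ENNReal.ofReal_coe_nnreal (p := e)).le.trans he.le)
  have := hmod n τ (s - τ) hs
  rwa [add_sub_cancel] at this

namespace CompactFamily

variable {α B : ℝ} {V : ℝ → ℝ} {U P Q : ℕ → ℝ → ℝ → ℝ} {v p q : ℝ → ℝ → ℝ}

lemma memL2ul_u (h : CompactFamily α V B U P Q) (hv : WConv U v)
    (hvm : ∀ τ, AEStronglyMeasurable (v τ) volume) (τ : ℝ) : MemL2ul (v τ) := by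
  refine (hv.locConv h.mem_u hvm τ).memL2ul (fun n => l2ulNorm_le_of_bound (h.abs_u_le n τ))
    fun ε hε => ?_
  obtain ⟨r, hr, hr'⟩ := h.space_modulus ε hε
  exact ⟨r, hr, fun n s hs => (hr' n τ s hs).1⟩

lemma memL2ul_p (h : CompactFamily α V B U P Q) (hp : WConv P p)
    (hpm : ∀ τ, AEStronglyMeasurable (p τ) volume) (τ : ℝ) : MemL2ul (p τ) := by
  refine (hp.locConv h.mem_p hpm τ).memL2ul (fun n => h.bound_p n τ) fun ε hε => ?_
  obtain ⟨r, hr, hr'⟩ := h.space_modulus ε hε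
  exact ⟨r, hr, fun n s hs => (hr' n τ s hs).2.1⟩

lemma memL2ul_q (h : CompactFamily α V B U P Q) (hq : WConv Q q)
    (hqm : ∀ τ, AEStronglyMeasurable (q τ) volume) (τ : ℝ) : MemL2ul (q τ) := by
  refine (hq.locConv h.mem_q hqm τ).memL2ul (fun n => h.bound_q n τ) fun ε hε => ?_
  obtain ⟨r, hr, hr'⟩ := h.space_modulus ε hε
  exact ⟨r, hr, fun n s hs => (hr' n τ s hs).2.2⟩

lemma hasWeakDeriv_lim (h : CompactFamily α V B U P Q) (hv : WConv U v) (hp : WConv P p)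
    (hvm : ∀ τ, AEStronglyMeasurable (v τ) volume)
    (hpm : ∀ τ, AEStronglyMeasurable (p τ) volume) (τ : ℝ) : HasWeakDeriv (v τ) (p τ) := by
  have mv := h.memL2ul_u hv hvm
  have mp := h.memL2ul_p hp hpm
  refine ⟨(mv τ).locallyIntegrable, (mp τ).locallyIntegrable, fun φ hφ => ?_⟩
  refine tendsto_nhds_unique (hv.tendsto_integral h.mem_u mv hφ.deriv τ) ?_
  exact (hp.tendsto_integral h.mem_p mp hφ τ).neg.congr fun n =>
    ((h.prim n τ).hasWeakDeriv.2.2 φ hφ).symm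

/-- The bound e|h| on the first-order error in time is in the uniformly local norm, with a step size
independent of n, so lower semicontinuity transfers it to the limit. -/
lemma tendsto_l2ulNorm_difference_quotient (h : CompactFamily α V B U P Q) (hv : WConv U v)
    (hq : WConv Q q) (hvm : ∀ τ, AEStronglyMeasurable (v τ) volume)
    (hqm : ∀ τ, AEStronglyMeasurable (q τ) volume) (τ : ℝ) :
    Tendsto (fun s => l2ulNorm ((s - τ)⁻¹ • (v s - v τ) - q τ)) (𝓝[≠] τ) (𝓝 0) := by
  rw [ENNReal.tendsto_nhds_zero]
  intro ε hε
  obtain ⟨e, he0, he⟩ := ENNReal.lt_iff_exists_nnreal_btwn.1 hε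
  obtain ⟨r, hr, hr'⟩ := h.time_diff e (by exact_mod_cast he0)
  obtain ⟨N, hN⟩ := hr' |τ|
  filter_upwards [nhdsWithin_le_nhds (Metric.ball_mem_nhds τ hr), self_mem_nhdsWithin] with s hs hne
  rw [Metric.mem_ball, Real.dist_eq] at hs
  have hs0 : s - τ ≠ 0 := sub_ne_zero.2 hne
  have hlim := ((((hv.locConv h.mem_u hvm s).sub (hv.locConv h.mem_u hvm τ)).sub
    ((hq.locConv h.mem_q hqm τ).const_mul (s - τ))).l2ulNorm_le (M := ENNReal.ofReal (e * |s - τ|))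
    (by
      filter_upwards [eventually_ge_atTop N] with n hn
      have := hN n hn τ le_rfl (s - τ) hs
      rwa [add_sub_cancel] at this))
  calc l2ulNorm ((s - τ)⁻¹ • (v s - v τ) - q τ)
      = l2ulNorm (fun x => (s - τ)⁻¹ * (v s x - v τ x - (s - τ) * q τ x)) := by
        congr 1
        ext x
        simp only [Pi.sub_apply, Pi.smul_apply, smul_eq_mul]
        field_simp
    _ ≤ ENNReal.ofReal |(s - τ)⁻¹| * ENNReal.ofReal (e * |s - τ|) :=
        (l2ulNorm_const_mul _ _).trans (mul_le_mul_right hlim _)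
    _ = e := by
        rw [← ENNReal.ofReal_mul (abs_nonneg _), abs_inv, mul_comm (e : ℝ),
          inv_mul_cancel_left₀ (abs_ne_zero.2 hs0), ENNReal.ofReal_coe_nnreal]
    _ ≤ ε := he.le

lemma isEnergyPath_lim (h : CompactFamily α V B U P Q) (hv : WConv U v) (hp : WConv P p)
    (hq : WConv Q q) (hvm : ∀ τ, AEStronglyMeasurable (v τ) volume)
    (hpm : ∀ τ, AEStronglyMeasurable (p τ) volume)
    (hqm : ∀ τ, AEStronglyMeasurable (q τ) volume) : IsEnergyPath univ v q := by
  have hw := h.hasWeakDeriv_lim hv hp hvm hpm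
  refine ⟨fun τ _ => ⟨h.memL2ul_u hv hvm τ, ⟨_, hw τ⟩,
    (h.memL2ul_p hp hpm τ).congr_ae (hw τ).weakDeriv_ae_eq.symm⟩, fun τ _ => ?_,
    fun τ _ => h.memL2ul_q hq hqm τ, fun τ _ => ?_, fun τ _ => ?_⟩
  · rw [nhdsWithin_univ]
    refine tendsto_ennreal_zero_add
      (hv.l2ulNorm_time_sub_le h.mem_u hvm (fun ε hε => ?_) τ)
      (hp.l2ulNorm_time_sub_le h.mem_p hpm (fun ε hε => ?_) τ)
      (Eventually.of_forall fun s => (sqrt_sq_add_sq_le _ _).trans ?_)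
    · obtain ⟨r, hr, hr'⟩ := h.time_modulus ε hε
      exact ⟨r, hr, fun n τ k hk => (hr' n τ k hk).1⟩
    · obtain ⟨r, hr, hr'⟩ := h.time_modulus ε hε
      exact ⟨r, hr, fun n τ k hk => (hr' n τ k hk).2.1⟩
    · exact add_le_add le_rfl (l2ulNorm_congr_ae ((hw s).sub (hw τ)).weakDeriv_ae_eq).le
  · rw [← compl_eq_univ_sdiff]
    exact h.tendsto_l2ulNorm_difference_quotient hv hq hvm hqm τ
  · rw [nhdsWithin_univ]
    refine hq.l2ulNorm_time_sub_le h.mem_q hqm (fun ε hε => ?_) τ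
    obtain ⟨r, hr, hr'⟩ := h.time_modulus ε hε
    exact ⟨r, hr, fun n τ k hk => (hr' n τ k hk).2.2⟩

/-- On a bounded time interval the tested equation holds for all large n, and its right-hand sides
converge uniformly, so the derivative passes to the limit. The nonlinear term converges because V'
is Lipschitz on the common range [-B, B]. -/
lemma isDampedWaveSolution_lim (h : CompactFamily α V B U P Q) (hV : ContDiff ℝ 2 V)
    (hv : WConv U v) (hp : WConv P p) (hq : WConv Q q)
    (hvm : ∀ τ, AEStronglyMeasurable (v τ) volume)
    (hpm : ∀ τ, AEStronglyMeasurable (p τ) volume)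
    (hqm : ∀ τ, AEStronglyMeasurable (q τ) volume) (hvB : ∀ τ x, |v τ x| ≤ B) :
    IsDampedWaveSolution α V univ v q := by
  refine ⟨h.isEnergyPath_lim hv hp hq hvm hpm hqm, fun φ hφ τ _ => ?_⟩
  have hV' : ContDiff ℝ 1 (deriv V) := hV.iterate_deriv' 1 1
  have mv := h.memL2ul_u hv hvm
  have mp := h.memL2ul_p hp hpm
  have mq := h.memL2ul_q hq hqm
  obtain ⟨K, hK0, hK⟩ := exists_lipschitz_on_bounded hV' B
  have hG : WConv (fun n τ x => deriv V (U n τ x)) (fun τ x => deriv V (v τ x)) :=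
    hv.of_le_mul (c := K + 1) (by positivity) fun n τ => wNorm_le_mul fun x =>
      (hK _ _ (hvB τ x) (h.abs_u_le n τ x)).trans
        (mul_le_mul_of_nonneg_right (by linarith) (abs_nonneg _))
  have hs : ∀ s ∈ Metric.ball τ 1, |s| ≤ |τ| + 1 := fun s hs => by
    rw [Metric.mem_ball, Real.dist_eq] at hs
    linarith [abs_sub_abs_le_abs_sub s τ]
  rw [hasDerivWithinAt_univ, (h.hasWeakDeriv_lim hv hp hvm hpm τ).2.2 _ hφ.deriv]
  have hunif := (((hp.tendstoUniformlyOn_integral h.mem_p mp hφ.deriv hs).neg).sub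
    (hq.tendstoUniformlyOn_integral h.mem_q mq hφ hs)).sub
    (hG.tendstoUniformlyOn_integral (fun n τ => memL2ul_comp hV' (h.mem_u n τ) (h.abs_u_le n τ))
      (fun τ => memL2ul_comp hV' (mv τ) (hvB τ)) hφ hs)
  obtain ⟨N, hN⟩ := h.eq φ hφ (|τ| + 1)
  refine hasDerivAt_of_tendstoUniformlyOn Metric.isOpen_ball hunif ?_
    (fun s _ => (hq.tendsto_integral h.mem_q mq hφ s).const_mul α) (Metric.mem_ball_self one_pos)
  filter_upwards [eventually_ge_atTop N] with n hn s hs'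
  exact hN n hn s (hs s hs')

end CompactFamily

theorem proposition2p3 (α : ℝ) (hα : 0 < α) (V : ℝ → ℝ) (hV : IsBistablePotential V)
    (u ut : ℝ → ℝ → ℝ) (hu : IsDampedWaveSolution α V (Ici 0) u ut)
    (x t : ℕ → ℝ) (ht0 : ∀ n, 0 ≤ t n) (ht : Tendsto t atTop atTop) :
    ∃ σ : ℕ → ℕ, StrictMono σ ∧ ∃ v vt : ℝ → ℝ → ℝ,
      IsDampedWaveSolution α V univ v vt ∧
      ∀ L > 0, ∀ T > 0,
        Tendsto (fun n => ⨆ τ ∈ Icc (-T) T,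
          (h1Norm (Icc (-L) L) (fun y => u (t (σ n) + τ) (x (σ n) + y) - v τ y) +
            l2Norm (Icc (-L) L) (fun y => ut (t (σ n) + τ) (x (σ n) + y) - vt τ y)))
          atTop (𝓝 0) := by
  have hV2 : ContDiff ℝ 2 V := hV.contDiff.of_le (by norm_num)
  obtain ⟨a, ha, b, -, hab⟩ := hV.coercive
  obtain ⟨w, hw, hW⟩ := hu.exists_waveSystem hV2
  obtain ⟨B, -, hF⟩ := hW.exists_compactFamily hα hV2 ha hab x t ht
  obtain ⟨σ, hσ, v, hvc, hvB, hv⟩ := hF.exists_subseq_wConv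
  have hvm : ∀ τ, AEStronglyMeasurable (v τ) volume := fun τ => (hvc τ).aestronglyMeasurable
  have hF' := hF.subseq hσ
  obtain ⟨p, hpm, hp⟩ := hF'.exists_wConv_p hv hvm
  obtain ⟨q, hqm, hq⟩ := hF'.exists_wConv_q hv hvm
  refine ⟨σ, hσ, v, q, hF'.isDampedWaveSolution_lim hV2 hv hp hq hvm hpm hqm hvB,
    fun L _ T _ => ?_⟩
  rw [ENNReal.tendsto_nhds_zero]
  intro ε hε
  obtain ⟨e, he0, he⟩ := ENNReal.lt_iff_exists_nnreal_btwn.1 hε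
  have he0' : (0 : ℝ) < e := by exact_mod_cast he0
  have hwt := wt_pos 1 L
  -- The factor wt 1 L compensates the loss in passing from the weighted norm to L² on [-L, L];
  -- there are three contributions, from u, u_x and u_t.
  obtain ⟨N₁, hN₁⟩ := hv T (wt 1 L * (e / 3)) (by positivity)
  obtain ⟨N₂, hN₂⟩ := hp T (wt 1 L * (e / 3)) (by positivity)
  obtain ⟨N₃, hN₃⟩ := hq T (wt 1 L * (e / 3)) (by positivity)
  have hl2 : ∀ f : ℝ → ℝ, wNorm 1 f ≤ ENNReal.ofReal (wt 1 L * (e / 3)) →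
      l2Norm (Icc (-L) L) f ≤ ENNReal.ofReal (e / 3) := by
    intro f hf
    refine (l2Norm_Icc_le_wNorm (κ := 1) f).trans ((mul_le_mul_right hf _).trans (le_of_eq ?_))
    rw [← ENNReal.ofReal_mul (by positivity), inv_mul_cancel_left₀ hwt.ne']
  -- A base time of at least T + 1 keeps all times at least 1 for |τ| ≤ T, so the clamped family
  -- coincides with the genuine translates.
  filter_upwards [(ht.comp hσ.tendsto_atTop).eventually_ge_atTop (T + 1), eventually_ge_atTop N₁,
    eventually_ge_atTop N₂, eventually_ge_atTop N₃] with n hn h₁ h₂ h₃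
  refine iSup₂_le fun τ hτ => le_trans ?_ he.le
  have hτ' : |τ| ≤ T := abs_le.2 hτ
  have hs : 1 ≤ t (σ n) + τ := by
    simp only [Function.comp_apply] at hn
    linarith [hτ.1]
  have k₁ := hl2 _ (hN₁ n h₁ τ hτ')
  have k₂ := hl2 _ (hN₂ n h₂ τ hτ')
  have k₃ := hl2 _ (hN₃ n h₃ τ hτ')
  simp only [max_eq_left hs] at k₁ k₂ k₃
  have hae : (fun y => u (t (σ n) + τ) (x (σ n) + y)) =ᵐ[volume]
      fun y => w (t (σ n) + τ) (x (σ n) + y) :=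
    (measurePreserving_add_left (volume : Measure ℝ) (x (σ n))).quasiMeasurePreserving.ae_eq_comp
      (hw (t (σ n) + τ) (by linarith))
  have hsub : (fun y => u (t (σ n) + τ) (x (σ n) + y) - v τ y) =ᵐ[volume]
      fun y => w (t (σ n) + τ) (x (σ n) + y) - v τ y := hae.sub (ae_eq_refl (v τ))
  have hwd := ((((hW.prim (t (σ n) + τ) (by linarith)).shift (x (σ n))).hasWeakDeriv.congr_ae
    hae.symm (ae_eq_refl _)).sub (hF'.hasWeakDeriv_lim hv hp hvm hpm τ)).weakDeriv_ae_eq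
  calc _ ≤ l2Norm (Icc (-L) L) (fun y => u (t (σ n) + τ) (x (σ n) + y) - v τ y) +
        l2Norm (Icc (-L) L) (weakDeriv fun y => u (t (σ n) + τ) (x (σ n) + y) - v τ y) +
        l2Norm (Icc (-L) L) (fun y => ut (t (σ n) + τ) (x (σ n) + y) - q τ y) :=
        add_le_add_left (sqrt_sq_add_sq_le _ _) _
    _ ≤ ENNReal.ofReal (e / 3) + ENNReal.ofReal (e / 3) + ENNReal.ofReal (e / 3) := by
        refine add_le_add (add_le_add ?_ ?_) k₃
        · exact (eLpNorm_congr_ae (ae_restrict_of_ae hsub)).le.trans k₁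
        · exact (eLpNorm_congr_ae (ae_restrict_of_ae hwd)).le.trans k₂
    _ = e := by
        rw [← ENNReal.ofReal_add (by positivity) (by positivity),
          ← ENNReal.ofReal_add (by positivity) (by positivity), ← ENNReal.ofReal_coe_nnreal]
        congr 1
        ring
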